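/- **Setting.** Fix $d\ge1$, and let $\|\cdot\|_{L^2}$, $\|\cdot\|_{L^\infty}$ be the norms on $[0,1]^d$. For vectors and matrices, $\|\cdot\|_\infty$ is the largest absolute value of an entry and $\|\cdot\|_0$ the number of nonzero entries. One observes i.i.d. pairs $(X_i,Y_i)$, $Y_i=f^\circ(X_i)+\xi_i$, $i=1,\dots,n$, with $X_i$ uniform on $[0,1]^d$ and $\xi_i\sim N(0,\sigma^2)$, $\sigma>0$, independent of everything else. The risk of an estimator $\hat f$ is $R(\hat f,f^\circ)=\mathrm E\|\hat f-f^\circ\|_{L^2}^2$. The (measurable) estimator $\hat f$ is an empirical risk minimizer over a class $\mathcal F$ if $\hat f\in\mathcal F$ and $\hat f$ minimizes $\sum_{i=1}^n(Y_i-g(X_i))^2$ over $g\in\mathcal F$. **Networks.** For integers $L,S,D\ge1$, $D\ge d$, and real $B\ge1$, let $\mathcal N(L,S,D,B)$ be the set of functions $f=W_{L+1}\circ\rho(W_L\cdot-v_L)\circ\cdots\circ\rho(W_1\cdot-v_1)$ on $\mathbb R^d$, with $\rho(x)=\max\{x,0\}$ applied entrywise, $W_1\in\mathbb R^{D\times d}$,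 $W_2,\dots,W_L\in\mathbb R^{D\times D}$, $W_{L+1}\in\mathbb R^{1\times D}$, $v_1,\dots,v_L\in\mathbb R^D$, $\|W_i\|_\infty,\|v_i\|_\infty\le B$ and $\sum_{i=1}^{L+1}\|W_i\|_0+\sum_{i=1}^L\|v_i\|_0\le S$. For $F>0$ let $\mathcal N_F(L,S,D,B)=\{\operatorname{sgn}(f)\min\{|f|,F\}: f\in\mathcal N(L,S,D,B)\}$. For $C_1',C_2'>0$, $\mathrm{AP}(C_1',C_2')$ is the set of $\phi\in L^2([0,1]^d)$ such that for each $0<\varepsilon<1/2$ there are parameters $L,S,D\le C_1'\log(1/\varepsilon)$, $B\le C_2'/\varepsilon$ and $\tilde\phi\in\mathcal N(L,S,D,B)$ with $\|\tilde\phi-\phi\|_{L^2}\le\varepsilon$. **Wavelets.** A function $\varphi\in L^2([0,1])$ with $\|\varphi\|_{L^2}=1$, extended by $0$ outside $[0,1]$, is an orthonormal wavelet if the functions $\varphi_{k,\ell}(x)=2^{k/2}\varphi(2^kx-\ell)$, $k\ge0$, $0\le\ell<2^k$, are pairwise orthogonal in $L^2([0,1])$. An orthonormal wavelet on $[0,1]^d$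 is a product $\psi(x)=\prod_{i=1}^d\psi^{(i)}(x_i)$ of such functions, and $\psi_{k,\ell}(x)=\prod_i\psi^{(i)}_{k_i,\ell_i}(x_i)$. Let $T_m$ be the set of $(k,\ell)\in\mathbb Z^d\times\mathbb Z^d$ with $k_i\ge0$, $0\le\ell_i<2^{k_i}$ for all $i$ and $\max_ik_i\ge m$. With $\|a\|_{w\ell^p}=\sup_{i\ge1}i^{1/p}|a|_{(i)}$, where $|a|_{(i)}$ is the $i$-th largest absolute value of the terms of $a$, let $\mathcal J^p_\psi(C_1,C_2,\beta)$ be the set of the $L^2([0,1]^d)$-convergent sums $\sum_{(k,\ell)\in T_0}a_{k,\ell}\psi_{k,\ell}$ with $\|a\|_{w\ell^p}\le C_1$ and $\sum_{(k,\ell)\in T_m}a_{k,\ell}^2\le C_22^{-\beta m}$ for $m=0,1,\dots$, as functions that are $0$ outside $[0,1]^d$. For a set $\Psi$ of orthonormal wavelets, let $\mathcal K^p_\Psi(n_s,C_1,C_2,C_3,\beta)$ be the set of the functions $\sum_{j=1}^{n_s}f_j(A_j\cdot-b_j)$ with $A_j\in\mathbb R^{d\times d}$ invertible, $b_j\in\mathbb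 R^d$, $|\det A_j|^{-1},\|A_j\|_\infty,\|b_j\|_\infty\le C_3$, $f_j\in\mathcal J^p_{\psi_j}(C_1,C_2,\beta)$ and $\psi_j\in\Psi$. **Theorem.** Let $C_1',C_2',C_1,C_2,\beta>0$, $0<p<2$ and $\alpha=1/p-1/2$. (i) There is a constant $C>0$, depending only on $d,C_1',C_2',p,C_1,C_2,\beta$, such that for every orthonormal wavelet $\psi\in\mathrm{AP}(C_1',C_2')$ on $[0,1]^d$ there are network sizes $(L_n,S_n,D_n,B_n)$, $n\ge 2$, independent of $\sigma$ and $F$, for which every empirical risk minimizer $\hat f$ over $\mathcal N_F(L_n,S_n,D_n,B_n)$ satisfies $$\sup_{f^\circ\in\mathcal J^p_\psi(C_1,C_2,\beta),\ \|f^\circ\|_{L^\infty}\le F}R(\hat f,f^\circ)\le CF^2n^{-\frac{2\alpha}{2\alpha+1}}(\log n)^3$$ for all $\sigma>0$, $F\ge\max\{1,\sigma\}$ and $n\ge2$. (ii) For every integer $n_s\ge1$ and every $C_3>0$ there is a constant $C'>0$, depending only on $n_s$, $C_3$ and the parameters in (i), such that for every set $\Psi\subset\mathrm{AP}(C_1',C_2')$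 of orthonormal wavelets on $[0,1]^d$ there are network sizes as in (i) for which every empirical risk minimizer $\hat f$ satisfies, for all $\sigma>0$, $F\ge\max\{1,\sigma\}$ and $n\ge2$, $$\sup_{f^\circ\in\mathcal K^p_\Psi(n_s,C_1,C_2,C_3,\beta),\ \|f^\circ\|_{L^\infty}\le F}R(\hat f,f^\circ)\le C'F^2n^{-\frac{2\alpha}{2\alpha+1}}(\log n)^3 .$$ -/

import Mathlib

open MeasureTheory ProbabilityTheory Filter Topology
open scoped ENNReal NNReal

noncomputable section

namespace SparseWavelet

/-- The unit cube `[0,1]^d`. -/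
def cube (d : ℕ) : Set (Fin d → ℝ) := Set.Icc 0 1

/-- Lebesgue measure on the unit cube, i.e. the uniform distribution on it. -/
def cubeMeasure (d : ℕ) : Measure (Fin d → ℝ) := volume.restrict (cube d)

/-! ### ReLU networks -/

/-- The size `(L, S, D, B)` of a class of networks with `d` inputs: number of hidden layers,
sparsity, width of the layers, bound on the weights. -/
structure NetSize (d : ℕ) where
  L : ℕ
  S : ℕ
  D : ℕ
  B : ℝ
  L_pos : 0 < L
  S_pos : 0 < S
  le_D : d ≤ D
  one_le_B : 1 ≤ B

/-- The ReLU function, applied coordinatewise. -/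
def relu {m : ℕ} (x : Fin m → ℝ) : Fin m → ℝ := fun i => max (x i) 0

/-- Weights and shifts of networks with `d` inputs and hidden layers of width `D`. The first
layer is `(W₁, v₁)`, the hidden layer number `k + 2` is `(W k, v k)`, and the output layer is
`Wout`. Only the entries `k < L - 1` of `W` and `v` are used by a network of depth `L`. -/
structure Weights (d D : ℕ) where
  W₁ : Matrix (Fin D) (Fin d) ℝ
  v₁ : Fin D → ℝ
  W : ℕ → Matrix (Fin D) (Fin D) ℝ
  v : ℕ → Fin D → ℝ
  Wout : Matrix (Fin 1) (Fin D) ℝ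

/-- The output of the hidden layer number `k + 1`. -/
def Weights.hidden {d D : ℕ} (w : Weights d D) (x : Fin d → ℝ) : ℕ → Fin D → ℝ
  | 0 => relu (w.W₁.mulVec x - w.v₁)
  | k + 1 => relu ((w.W k).mulVec (w.hidden x k) - w.v k)

/-- The function `W_{L+1} ∘ ρ(W_L · - v_L) ∘ ⋯ ∘ ρ(W₁ · - v₁)`, for `L ≥ 1` hidden layers. -/
def Weights.eval {d D : ℕ} (w : Weights d D) (L : ℕ) (x : Fin d → ℝ) : ℝ :=
  w.Wout.mulVec (w.hidden x (L - 1)) 0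

/-- The number of nonzero entries of a vector. -/
def nnzVec {m : ℕ} (v : Fin m → ℝ) : ℕ := {i | v i ≠ 0}.ncard

/-- The number of nonzero entries of a matrix. -/
def nnzMat {m m' : ℕ} (A : Matrix (Fin m) (Fin m') ℝ) : ℕ :=
  {q : Fin m × Fin m' | A q.1 q.2 ≠ 0}.ncard

/-- All entries of the vector are at most `B` in absolute value. -/
def VecBound {m : ℕ} (v : Fin m → ℝ) (B : ℝ) : Prop := ∀ i, |v i| ≤ B

/-- All entries of the matrix are at most `B` in absolute value. -/
def MatBound {m m' : ℕ} (A : Matrix (Fin m) (Fin m') ℝ) (B : ℝ) : Prop := ∀ i j, |A i j| ≤ B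

/-- The total number of nonzero parameters of a network with `L` hidden layers. -/
def Weights.nnz {d D : ℕ} (w : Weights d D) (L : ℕ) : ℕ :=
  nnzMat w.W₁ + nnzVec w.v₁ + ∑ k ∈ Finset.range (L - 1), (nnzMat (w.W k) + nnzVec (w.v k))
    + nnzMat w.Wout

/-- All parameters of a network with `L` hidden layers are at most `B` in absolute value. -/
def Weights.Bounded {d D : ℕ} (w : Weights d D) (L : ℕ) (B : ℝ) : Prop :=
  MatBound w.W₁ B ∧ VecBound w.v₁ B ∧
    (∀ k < L - 1, MatBound (w.W k) B ∧ VecBound (w.v k) B) ∧ MatBound w.Wout B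

/-- The class `𝒩(L, S, D, B)` of functions realized by sparse ReLU networks. -/
def networks {d : ℕ} (s : NetSize d) : Set ((Fin d → ℝ) → ℝ) :=
  {f | ∃ w : Weights d s.D, w.Bounded s.L s.B ∧ w.nnz s.L ≤ s.S ∧ f = w.eval s.L}

/-- The class `𝒩_F(L, S, D, B)` of networks truncated at the level `F`. -/
def clippedNetworks {d : ℕ} (s : NetSize d) (F : ℝ) : Set ((Fin d → ℝ) → ℝ) :=
  {g | ∃ f ∈ networks s, g = fun x => Real.sign (f x) * min |f x| F}

/-- The class `AP(C₁, C₂)` of functions on the cube that are approximated in `L²([0,1]^d)` by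
light networks. -/
def AP (d : ℕ) (C₁ C₂ : ℝ) : Set ((Fin d → ℝ) → ℝ) :=
  {φ | MemLp φ 2 (cubeMeasure d) ∧
    ∀ ε : ℝ, 0 < ε → ε < 1 / 2 →
      ∃ s : NetSize d,
        ((s.L : ℝ) ≤ C₁ * Real.log (1 / ε) ∧ (s.S : ℝ) ≤ C₁ * Real.log (1 / ε) ∧
          (s.D : ℝ) ≤ C₁ * Real.log (1 / ε) ∧ s.B ≤ C₂ / ε) ∧
        ∃ g ∈ networks s, eLpNorm (g - φ) 2 (cubeMeasure d) ≤ ENNReal.ofReal ε}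

/-! ### Wavelets -/

/-- The indices `(k, ℓ)` with `k ≥ 0` and `0 ≤ ℓ < 2^k`. -/
abbrev DyadicIndex : Type := Σ k : ℕ, Fin (2 ^ k)

/-- The function `2^{k/2} φ(2^k x - ℓ)`. -/
def dilate (φ : ℝ → ℝ) (I : DyadicIndex) (x : ℝ) : ℝ :=
  (2 : ℝ) ^ ((I.1 : ℝ) / 2) * φ (2 ^ I.1 * x - (I.2 : ℕ))

/-- Orthonormal wavelets on `[0,1]`, as functions on the line that vanish outside `[0,1]`. -/
structure IsWavelet₁ (φ : ℝ → ℝ) : Prop where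
  eq_zero : ∀ x, x ∉ Set.Icc (0 : ℝ) 1 → φ x = 0
  memLp : MemLp φ 2 volume
  norm_one : ∫ x in Set.Icc (0 : ℝ) 1, φ x ^ 2 = 1
  orthogonal : ∀ I J : DyadicIndex, I ≠ J →
    ∫ x in Set.Icc (0 : ℝ) 1, dilate φ I x * dilate φ J x = 0

/-- The function `ψ` on `ℝ^d` is the tensor product of the orthonormal wavelets `w i`. -/
def IsTensor {d : ℕ} (ψ : (Fin d → ℝ) → ℝ) (w : Fin d → ℝ → ℝ) : Prop :=
  (∀ i, IsWavelet₁ (w i)) ∧ ψ = fun x => ∏ i, w i (x i)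

/-- Orthonormal wavelets on `[0,1]^d` (functions on `ℝ^d` that vanish outside the cube). -/
def IsWavelet {d : ℕ} (ψ : (Fin d → ℝ) → ℝ) : Prop := ∃ w, IsTensor ψ w

/-- The function `ψ_{k,ℓ} = ∏ i, w_{k i, ℓ i} (x i)`, for `I i = (k i, ℓ i)`. -/
def tensorDilate {d : ℕ} (w : Fin d → ℝ → ℝ) (I : Fin d → DyadicIndex) (x : Fin d → ℝ) : ℝ :=
  ∏ i, dilate (w i) (I i) (x i)

/-- The indices `(k, ℓ)` with `max_i k_i ≥ m` (for `d ≥ 1`). -/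
def tailIndices (d m : ℕ) : Set (Fin d → DyadicIndex) := {I | ∃ i, m ≤ (I i).1}

/-! ### Weak `ℓ^p` norm -/

/-- The `(i + 1)`-th largest absolute value of a family `a` that tends to zero. -/
def rearrangement {ι : Type*} (a : ι → ℝ) (i : ℕ) : ℝ≥0∞ :=
  ⨅ t : {t : ℝ≥0 // {j | t < ‖a j‖₊}.encard ≤ i}, ((t : ℝ≥0) : ℝ≥0∞)

/-- The weak `ℓ^p` norm `sup_{i ≥ 1} i^{1/p} |a|_{(i)}`. -/
def weakNorm {ι : Type*} (p : ℝ) (a : ι → ℝ) : ℝ≥0∞ :=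
  ⨆ i : ℕ, ((i : ℝ≥0∞) + 1) ^ (1 / p) * rearrangement a i

/-! ### The target classes -/

/-- The class `𝒥^p_ψ(C₁, C₂, β)`. Its elements are functions on `[0,1]^d`, extended by zero; the
wavelet series converges unconditionally in `L²([0,1]^d)`. -/
def classJ {d : ℕ} (ψ : (Fin d → ℝ) → ℝ) (p C₁ C₂ β : ℝ) : Set ((Fin d → ℝ) → ℝ) :=
  {f | (∀ x, x ∉ cube d → f x = 0) ∧ MemLp f 2 (cubeMeasure d) ∧
    ∃ w, IsTensor ψ w ∧ ∃ a : (Fin d → DyadicIndex) → ℝ,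
      weakNorm p a ≤ ENNReal.ofReal C₁ ∧
      (∀ m : ℕ, ∑' I : tailIndices d m, ENNReal.ofReal (a I ^ 2)
        ≤ ENNReal.ofReal (C₂ * 2 ^ (-β * m))) ∧
      Tendsto (fun T : Finset (Fin d → DyadicIndex) =>
          eLpNorm (fun x => f x - ∑ I ∈ T, a I * tensorDilate w I x) 2 (cubeMeasure d))
        atTop (𝓝 0)}

/-- The class `𝒦^p_Ψ(n_s, C₁, C₂, C₃, β)`. -/
def classK {d : ℕ} (Ψ : Set ((Fin d → ℝ) → ℝ)) (p : ℝ) (ns : ℕ) (C₁ C₂ C₃ β : ℝ) :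
    Set ((Fin d → ℝ) → ℝ) :=
  {g | ∃ (A : Fin ns → Matrix (Fin d) (Fin d) ℝ) (b : Fin ns → Fin d → ℝ)
      (ψ f : Fin ns → (Fin d → ℝ) → ℝ),
      (∀ j, (A j).det ≠ 0 ∧ |(A j).det|⁻¹ ≤ C₃ ∧ MatBound (A j) C₃ ∧ VecBound (b j) C₃) ∧
      (∀ j, ψ j ∈ Ψ ∧ f j ∈ classJ (ψ j) p C₁ C₂ β) ∧
      g = fun x => ∑ j, f j ((A j).mulVec x - b j)}

/-- The functions of the class `𝓕` with `‖f‖_{L^∞([0,1]^d)} ≤ F`. -/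
def bddBy {d : ℕ} (𝓕 : Set ((Fin d → ℝ) → ℝ)) (F : ℝ) : Set ((Fin d → ℝ) → ℝ) :=
  {f | f ∈ 𝓕 ∧ eLpNorm f ∞ (cubeMeasure d) ≤ ENNReal.ofReal F}

/-! ### Gaussian regression -/

/-- The joint law of the design point `X`, uniform on the cube, and the independent noise
`ξ ∼ N(0, σ²)`. -/
def designNoise (d : ℕ) (σ : ℝ) : Measure ((Fin d → ℝ) × ℝ) :=
  (cubeMeasure d).prod (gaussianReal 0 (Real.toNNReal (σ ^ 2)))

/-- The sample `(X_i, f(X_i) + ξ_i)`, as a function of the `(X_i, ξ_i)`. -/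
def sample {d n : ℕ} (f : (Fin d → ℝ) → ℝ) (q : Fin n → (Fin d → ℝ) × ℝ) :
    Fin n → (Fin d → ℝ) × ℝ :=
  fun i => ((q i).1, f (q i).1 + (q i).2)

/-- The `L²` risk `E ‖f̂ - f‖²` of an estimator `f̂` based on `n` observations. -/
def risk {d n : ℕ} (σ : ℝ) (fhat : (Fin n → (Fin d → ℝ) × ℝ) → (Fin d → ℝ) → ℝ)
    (f : (Fin d → ℝ) → ℝ) : ℝ≥0∞ :=
  ∫⁻ q, eLpNorm (fhat (sample f q) - f) 2 (cubeMeasure d) ^ 2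
    ∂(Measure.pi fun _ : Fin n => designNoise d σ)

/-- The sum of squared residuals of `g` on the data `z`. -/
def empiricalRisk {d n : ℕ} (z : Fin n → (Fin d → ℝ) × ℝ) (g : (Fin d → ℝ) → ℝ) : ℝ :=
  ∑ i, ((z i).2 - g (z i).1) ^ 2

/-- The (measurable) estimator `f̂` is an empirical risk minimizer over `𝓕`. -/
def IsERM {d n : ℕ} (𝓕 : Set ((Fin d → ℝ) → ℝ))
    (fhat : (Fin n → (Fin d → ℝ) × ℝ) → (Fin d → ℝ) → ℝ) : Prop :=
  (Measurable fun q : (Fin n → (Fin d → ℝ) × ℝ) × (Fin d → ℝ) => fhat q.1 q.2) ∧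
    ∀ z : Fin n → (Fin d → ℝ) × ℝ, (∀ i, (z i).1 ∈ cube d) →
      fhat z ∈ 𝓕 ∧ ∀ g ∈ 𝓕, empiricalRisk z (fhat z) ≤ empiricalRisk z g

end SparseWavelet

end

namespace SparseWavelet

/-! ### The uniform distribution on the cube and the noise -/

/-! The risk is at most a squared approximation error plus an entropy term, and the two balance when
about n^{p/2} wavelet coefficients are kept.

Estimation. For a fixed g bounded by F the excess loss has mean ‖g - f°‖², and its exponential
moment at inverse temperature l = 1/(4F²) is at most exp(-l‖g - f°‖²/4); this is where σ ≤ F enters.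
Averaging exponentials over a finite uniform cover with N elements makes this uniform at the price
log N, so that the risk is of order (approximation error)² + F² log N / n, up to the radius 1/n of
the cover (`risk_le_of_cover`). Rounding the nonzero parameters of a network to a grid gives log N
of order S (L log(BD) + log n) (`exists_cover_clippedNetworks`).

Approximation. By the weak ℓ^p bound at most n^{p/2} coefficients exceed t = C₁ n^{-1/2}, and the
squares of the others sum to order t^{2-p}, that is n^{-(1-p/2)}. The tail condition with exponent β
discards the scales above log₂ n / β at a cost of order 1/n. Each remaining basis function is an
L²-normalized affine image of ψ, and ψ is within n^{-2} of a network of size of order log n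
(`exists_net_approx_classJ`).

The obstacle is that `AP` controls this network only on the cube, whereas its dilates are evaluated
far outside. The network is therefore soft-thresholded by a penalty that vanishes well inside the
cube and dominates the network outside it. A network of depth L can be as large as (B(D+1))^{L+1},
so the penalty is amplified by a factor b in every layer, parallel to the network; b is polynomial
in n (`eLpNorm_cutoff_sub_le`). Closeness in L² of the whole space survives affine maps, hence the
class 𝒦 costs only the factors n_s and C₃^{1/2}.

Balance. With S of order n^{p/2} log n, and L and log(BD) of order log n, the entropy term is of
order F² n^{-(1-p/2)} (log n)³, and 1 - p/2 = 2α/(2α+1). Part (i) is the case of one summand and the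
identity map. -/

theorem cubeMeasure_eq_pi (d : ℕ) :
    cubeMeasure d = Measure.pi fun _ : Fin d => (volume : Measure ℝ).restrict (Set.Icc 0 1) := by
  rw [cubeMeasure, cube, ← Set.pi_univ_Icc, volume_pi, Measure.restrict_pi_pi]
  rfl

instance isProbabilityMeasure_unitInterval :
    IsProbabilityMeasure ((volume : Measure ℝ).restrict (Set.Icc 0 1)) :=
  ⟨by simp⟩

instance isProbabilityMeasure_cubeMeasure (d : ℕ) : IsProbabilityMeasure (cubeMeasure d) := by
  rw [cubeMeasure_eq_pi]; infer_instance

instance isProbabilityMeasure_designNoise (d : ℕ) (σ : ℝ) :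
    IsProbabilityMeasure (designNoise d σ) := by
  unfold designNoise; infer_instance

theorem ae_mem_cube (d : ℕ) : ∀ᵐ x ∂cubeMeasure d, x ∈ cube d :=
  ae_restrict_mem measurableSet_Icc

theorem ae_of_ae_cubeMeasure {d n : ℕ} {σ : ℝ} {P : (Fin d → ℝ) → Prop}
    (h : ∀ᵐ x ∂cubeMeasure d, P x) :
    ∀ᵐ q ∂(Measure.pi fun _ : Fin n => designNoise d σ), ∀ i, P (q i).1 := by
  rw [ae_all_iff]
  intro i
  have h1 : ∀ᵐ z ∂designNoise d σ, P z.1 :=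
    Measure.quasiMeasurePreserving_fst.ae h
  exact (measurePreserving_eval (fun _ : Fin n => designNoise d σ) i).quasiMeasurePreserving.ae h1

theorem sq_eLpNorm_two {Ω : Type*} [MeasurableSpace Ω] {μ : Measure Ω} (f : Ω → ℝ) :
    eLpNorm f 2 μ ^ 2 = ∫⁻ x, ENNReal.ofReal (f x ^ 2) ∂μ := by
  have h := eLpNorm_nnreal_pow_eq_lintegral (f := f) (μ := μ) (p := 2) (by norm_num)
  simp only [ENNReal.coe_ofNat, NNReal.coe_ofNat, ENNReal.rpow_ofNat] at h
  rw [h]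
  refine lintegral_congr fun x => ?_
  rw [← sq_abs, ENNReal.ofReal_pow (abs_nonneg _), Real.enorm_eq_ofReal_abs]

/-! ### Oracle inequality for empirical risk minimizers -/

/-- The excess loss of `g` at the design point `z.1` with noise `z.2`. -/
def excessLoss {d : ℕ} (f₀ g : (Fin d → ℝ) → ℝ) (z : (Fin d → ℝ) × ℝ) : ℝ :=
  (g z.1 - f₀ z.1) ^ 2 - 2 * z.2 * (g z.1 - f₀ z.1)

theorem empiricalRisk_sample {d n : ℕ} (f₀ g : (Fin d → ℝ) → ℝ) (q : Fin n → (Fin d → ℝ) × ℝ) :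
    empiricalRisk (sample f₀ q) g = ∑ i, (q i).2 ^ 2 + ∑ i, excessLoss f₀ g (q i) := by
  rw [empiricalRisk, ← Finset.sum_add_distrib]
  refine Finset.sum_congr rfl fun i _ => ?_
  simp only [sample, excessLoss]; ring

/-- The noise is centred and independent of the design, so the cross term integrates to zero and
only the squared distance remains. -/
theorem integrable_excessLoss {d : ℕ} {σ F : ℝ} {f₀ g : (Fin d → ℝ) → ℝ}
    (hf₀ : Measurable f₀) (hg : Measurable g) (hf₀F : ∀ x, |f₀ x| ≤ F) (hgF : ∀ x, |g x| ≤ F) :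
    Integrable (fun x => (g x - f₀ x) ^ 2) (cubeMeasure d) ∧
    Integrable (excessLoss f₀ g) (designNoise d σ) ∧
    ∫ z, excessLoss f₀ g z ∂designNoise d σ = ∫ x, (g x - f₀ x) ^ 2 ∂cubeMeasure d := by
  have hb : ∀ x, |g x - f₀ x| ≤ 2 * F := fun x => by
    have := abs_sub (g x) (f₀ x); linarith [hf₀F x, hgF x]
  have h1 : Integrable (fun x => g x - f₀ x) (cubeMeasure d) :=
    Integrable.of_bound (hg.sub hf₀).aestronglyMeasurable (2 * F) (ae_of_all _ hb)
  have h2 : Integrable (fun x => (g x - f₀ x) ^ 2) (cubeMeasure d) := by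
    refine Integrable.of_bound ((hg.sub hf₀).pow_const 2).aestronglyMeasurable ((2 * F) ^ 2)
      (ae_of_all _ fun x => ?_)
    rw [Real.norm_eq_abs, abs_pow]
    exact pow_le_pow_left₀ (abs_nonneg _) (hb x) 2
  have h3 : Integrable (fun ξ : ℝ => ξ) (gaussianReal 0 (Real.toNNReal (σ ^ 2))) :=
    (memLp_id_gaussianReal 1).integrable le_rfl
  have h4 : Integrable (fun z : (Fin d → ℝ) × ℝ => (g z.1 - f₀ z.1) * z.2) (designNoise d σ) :=
    h1.mul_prod h3
  have h5 : Integrable (fun z : (Fin d → ℝ) × ℝ => (g z.1 - f₀ z.1) ^ 2) (designNoise d σ) :=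
    h2.comp_fst _
  have h6 : excessLoss f₀ g = fun z : (Fin d → ℝ) × ℝ =>
      (g z.1 - f₀ z.1) ^ 2 - 2 * ((g z.1 - f₀ z.1) * z.2) := by
    funext z; simp only [excessLoss]; ring
  refine ⟨h2, ?_, ?_⟩
  · rw [h6]; exact h5.sub (h4.const_mul 2)
  · rw [h6, integral_sub h5 (h4.const_mul 2), integral_const_mul]
    have e1 : ∫ z : (Fin d → ℝ) × ℝ, (g z.1 - f₀ z.1) * z.2 ∂designNoise d σ = 0 := by
      rw [designNoise, integral_prod_mul (fun x => g x - f₀ x) (fun ξ : ℝ => ξ)]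
      simp [integral_id_gaussianReal]
    have e2 : ∫ z : (Fin d → ℝ) × ℝ, (g z.1 - f₀ z.1) ^ 2 ∂designNoise d σ
        = ∫ x, (g x - f₀ x) ^ 2 ∂cubeMeasure d := by
      rw [designNoise, integral_fun_fst (fun x => (g x - f₀ x) ^ 2)]
      simp
    rw [e1, e2]; ring

theorem exp_neg_le_one_sub_half {u : ℝ} (h0 : 0 ≤ u) (h1 : u ≤ 1) : Real.exp (-u) ≤ 1 - u / 2 := by
  have h := Real.add_one_le_exp u
  rw [Real.exp_neg, inv_le_iff_one_le_mul₀ (Real.exp_pos u)]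
  nlinarith

/-- The exponential moment of the excess loss at the scale `4 F²`. -/
theorem integral_exp_excessLoss_le {d : ℕ} {σ F : ℝ} (hσ : 0 < σ) (hσF : σ ≤ F)
    {f₀ g : (Fin d → ℝ) → ℝ} (hf₀ : Measurable f₀) (hg : Measurable g)
    (hf₀F : ∀ x, |f₀ x| ≤ F) (hgF : ∀ x, |g x| ≤ F) :
    Integrable (fun z => Real.exp (-(1 / (4 * F ^ 2)) * excessLoss f₀ g z)) (designNoise d σ) ∧
    ∫ z, Real.exp (-(1 / (4 * F ^ 2)) * excessLoss f₀ g z) ∂designNoise d σ ≤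
      Real.exp (-(1 / (4 * F ^ 2)) * (∫ x, (g x - f₀ x) ^ 2 ∂cubeMeasure d) / 4) := by
  have hF : 0 < F := hσ.trans_le hσF
  set l : ℝ := 1 / (4 * F ^ 2) with hl
  have hl0 : 0 < l := by positivity
  have hb : ∀ x, |g x - f₀ x| ≤ 2 * F := fun x => by
    have := abs_sub (g x) (f₀ x); linarith [hf₀F x, hgF x]
  -- The scale 4F² is the largest possible value of the squared difference; this keeps the exponent
  -- in the range where the exponential is comparable to a linear function.
  have hsq : ∀ x, l * (g x - f₀ x) ^ 2 ≤ 1 := fun x => by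
    have : (g x - f₀ x) ^ 2 ≤ (2 * F) ^ 2 := by
      rw [← sq_abs]; exact pow_le_pow_left₀ (abs_nonneg _) (hb x) 2
    rw [hl, one_div, inv_mul_le_iff₀ (by positivity)]; linarith
  have hr := (integrable_excessLoss (σ := σ) hf₀ hg hf₀F hgF).1
  have hmeas : Measurable fun z : (Fin d → ℝ) × ℝ => Real.exp (-l * excessLoss f₀ g z) := by
    unfold excessLoss; fun_prop
  have hint : Integrable (fun z => Real.exp (-l * excessLoss f₀ g z)) (designNoise d σ) := by
    have h1 : Integrable (fun z : (Fin d → ℝ) × ℝ =>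
        Real.exp (4 * l * F * z.2) + Real.exp (-(4 * l * F) * z.2)) (designNoise d σ) :=
      ((integrable_exp_mul_gaussianReal (4 * l * F)).add
        (integrable_exp_mul_gaussianReal (-(4 * l * F)))).comp_snd _
    refine h1.mono hmeas.aestronglyMeasurable (ae_of_all _ fun z => ?_)
    rw [Real.norm_eq_abs, Real.norm_eq_abs, abs_of_pos (Real.exp_pos _),
      abs_of_pos (add_pos (Real.exp_pos _) (Real.exp_pos _))]
    -- The quadratic part only helps and is dropped; the rest is dominated by two Gaussian
    -- exponentials.
    have h2 : -l * excessLoss f₀ g z ≤ 4 * l * F * |z.2| := by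
      have h3 : z.2 * (g z.1 - f₀ z.1) ≤ |z.2| * (2 * F) :=
        (le_abs_self _).trans (by
          rw [abs_mul]; exact mul_le_mul_of_nonneg_left (hb _) (abs_nonneg _))
      have h4 : 0 ≤ l * (g z.1 - f₀ z.1) ^ 2 := by positivity
      have h5 := mul_le_mul_of_nonneg_left h3 hl0.le
      unfold excessLoss
      nlinarith
    refine (Real.exp_le_exp.2 h2).trans ?_
    rcases abs_cases z.2 with ⟨h, _⟩ | ⟨h, _⟩ <;> rw [h]
    · linarith [Real.exp_pos (-(4 * l * F) * z.2)]
    · rw [show 4 * l * F * -z.2 = -(4 * l * F) * z.2 by ring]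
      linarith [Real.exp_pos ((4 * l * F) * z.2)]
  refine ⟨hint, ?_⟩
  -- Write Δ = g x - f₀ x. The Gaussian moment generating function adds 2l²σ²Δ² to the exponent
  -- -lΔ². Since lσ² ≤ 1/4 this takes away at most half, leaving exp(-lΔ²/2) ≤ 1 - lΔ²/4. The linear
  -- bound can be integrated over x and is turned back into an exponential at the end.
  have hinner : ∀ x, ∫ ξ, Real.exp (-l * excessLoss f₀ g (x, ξ))
      ∂gaussianReal 0 (Real.toNNReal (σ ^ 2)) ≤ 1 - l * (g x - f₀ x) ^ 2 / 4 := fun x => by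
    have h1 : ∀ ξ : ℝ, Real.exp (-l * excessLoss f₀ g (x, ξ)) =
        Real.exp (-l * (g x - f₀ x) ^ 2) * Real.exp ((2 * l * (g x - f₀ x)) * ξ) := fun ξ => by
      rw [← Real.exp_add]; congr 1; simp only [excessLoss]; ring
    simp_rw [h1]
    rw [integral_const_mul]
    have h2 := mgf_gaussianReal (p := gaussianReal 0 (Real.toNNReal (σ ^ 2))) (X := fun ξ => ξ)
      (μ := 0) (v := Real.toNNReal (σ ^ 2)) Measure.map_id' (2 * l * (g x - f₀ x))
    rw [mgf] at h2
    rw [h2, ← Real.exp_add, Real.coe_toNNReal _ (sq_nonneg σ)]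
    have h3 : l * σ ^ 2 ≤ 1 / 4 := by
      rw [hl, one_div, inv_mul_le_iff₀ (by positivity)]
      have := pow_le_pow_left₀ hσ.le hσF 2
      linarith
    have h4 : -l * (g x - f₀ x) ^ 2 + (0 * (2 * l * (g x - f₀ x)) +
        σ ^ 2 * (2 * l * (g x - f₀ x)) ^ 2 / 2) ≤ -(l * (g x - f₀ x) ^ 2 / 2) := by
      have h5 : 0 ≤ l * (g x - f₀ x) ^ 2 := by positivity
      have := mul_le_mul_of_nonneg_right h3 h5
      nlinarith
    refine (Real.exp_le_exp.2 h4).trans ((exp_neg_le_one_sub_half ?_ ?_).trans_eq (by ring))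
    · positivity
    · linarith [hsq x]
  calc ∫ z, Real.exp (-l * excessLoss f₀ g z) ∂designNoise d σ
      = ∫ x, ∫ ξ, Real.exp (-l * excessLoss f₀ g (x, ξ))
          ∂gaussianReal 0 (Real.toNNReal (σ ^ 2)) ∂cubeMeasure d := integral_prod _ hint
    _ ≤ ∫ x, (1 - l * (g x - f₀ x) ^ 2 / 4) ∂cubeMeasure d := by
        refine integral_mono hint.integral_prod_left ?_ hinner
        exact (integrable_const _).sub ((hr.const_mul l).div_const 4)
    _ = 1 - l * (∫ x, (g x - f₀ x) ^ 2 ∂cubeMeasure d) / 4 := by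
        rw [integral_sub (integrable_const _) ((hr.const_mul l).div_const 4), integral_div,
          integral_const_mul]
        simp
    _ ≤ _ := by
        have := Real.add_one_le_exp (-l * (∫ x, (g x - f₀ x) ^ 2 ∂cubeMeasure d) / 4)
        linarith

/-- The inequality |ξ| ≤ (ξ²/σ + σ)/2 reduces the first absolute moment to the variance. -/
theorem integral_abs_noise_le {d : ℕ} {σ : ℝ} (hσ : 0 < σ) :
    Integrable (fun z : (Fin d → ℝ) × ℝ => |z.2|) (designNoise d σ) ∧
    ∫ z : (Fin d → ℝ) × ℝ, |z.2| ∂designNoise d σ ≤ σ := by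
  have h2 : Integrable (fun ξ : ℝ => ξ ^ 2) (gaussianReal 0 (Real.toNNReal (σ ^ 2))) :=
    (memLp_id_gaussianReal 2).integrable_sq
  have h1 : Integrable (fun ξ : ℝ => |ξ|) (gaussianReal 0 (Real.toNNReal (σ ^ 2))) :=
    ((memLp_id_gaussianReal 1).integrable le_rfl).abs
  refine ⟨h1.comp_snd _, ?_⟩
  rw [designNoise, integral_fun_snd (fun ξ : ℝ => |ξ|)]
  have h3 : ∫ ξ, ξ ^ 2 ∂gaussianReal 0 (Real.toNNReal (σ ^ 2)) = σ ^ 2 := by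
    have h := variance_fun_id_gaussianReal (μ := 0) (v := Real.toNNReal (σ ^ 2))
    rw [variance_of_integral_eq_zero aemeasurable_id' (by simp [integral_id_gaussianReal]),
      Real.coe_toNNReal _ (sq_nonneg σ)] at h
    exact h
  have h4 : ∀ ξ : ℝ, |ξ| ≤ (ξ ^ 2 / σ + σ) / 2 := fun ξ => by
    have h5 : 0 ≤ (|ξ| - σ) ^ 2 / σ := by positivity
    have h6 : (|ξ| - σ) ^ 2 / σ = ξ ^ 2 / σ - 2 * |ξ| + σ := by
      field_simp; rw [← sq_abs ξ]; ring
    linarith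
  have h7 : Integrable (fun ξ : ℝ => (ξ ^ 2 / σ + σ) / 2)
      (gaussianReal 0 (Real.toNNReal (σ ^ 2))) :=
    ((h2.div_const σ).add (integrable_const σ)).div_const 2
  have h8 := integral_mono h1 h7 h4
  rw [integral_div, integral_add (h2.div_const σ) (integrable_const σ), integral_div, h3] at h8
  simp only [integral_const, probReal_univ, smul_eq_mul, one_mul] at h8
  simp only [probReal_univ, one_smul]
  refine h8.trans_eq ?_
  field_simp; ring

/-- Replaces the random minimizer `f` by a fixed member `g` of the cover, through (a + b)² ≤ 2a² +
2b². Nothing is required of the measurability of `f`. -/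
theorem eLpNorm_sub_sq_le_of_close {d : ℕ} {f₀ f g : (Fin d → ℝ) → ℝ} {δ : ℝ}
    (hi : Integrable (fun x => (g x - f₀ x) ^ 2) (cubeMeasure d))
    (h : ∀ x ∈ cube d, |f x - g x| ≤ δ) :
    eLpNorm (f - f₀) 2 (cubeMeasure d) ^ 2 ≤
      ENNReal.ofReal (2 * δ ^ 2 + 2 * ∫ x, (g x - f₀ x) ^ 2 ∂cubeMeasure d) := by
  have hi' : Integrable (fun x => 2 * δ ^ 2 + 2 * (g x - f₀ x) ^ 2) (cubeMeasure d) :=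
    (integrable_const _).add (hi.const_mul 2)
  have he : 2 * δ ^ 2 + 2 * ∫ x, (g x - f₀ x) ^ 2 ∂cubeMeasure d =
      ∫ x, (2 * δ ^ 2 + 2 * (g x - f₀ x) ^ 2) ∂cubeMeasure d := by
    rw [integral_add (integrable_const _) (hi.const_mul 2), integral_const, integral_const_mul]
    simp
  rw [sq_eLpNorm_two, he, ofReal_integral_eq_lintegral_ofReal hi'
    (ae_of_all _ fun x => by positivity)]
  refine lintegral_mono_ae ?_
  filter_upwards [ae_mem_cube d] with x hx
  refine ENNReal.ofReal_le_ofReal ?_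
  have h1 : (f x - g x) ^ 2 ≤ δ ^ 2 := by
    rw [← sq_abs]; exact pow_le_pow_left₀ (abs_nonneg _) (h x hx) 2
  simp only [Pi.sub_apply]
  nlinarith [sq_nonneg ((f x - g x) - (g x - f₀ x))]

/-- The difference of the two losses factors as (g - f)(g + f - 2f₀ - 2ξ), and the second factor is
at most 4F + 2|ξ|. -/
theorem excessLoss_le_of_close {d : ℕ} {f₀ f g : (Fin d → ℝ) → ℝ} {F δ : ℝ}
    {z : (Fin d → ℝ) × ℝ} (hf₀F : |f₀ z.1| ≤ F) (hfF : |f z.1| ≤ F) (hgF : |g z.1| ≤ F)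
    (h : |f z.1 - g z.1| ≤ δ) :
    excessLoss f₀ g z ≤ excessLoss f₀ f z + (4 * F * δ + 2 * δ * |z.2|) := by
  have h1 : excessLoss f₀ g z - excessLoss f₀ f z =
      (g z.1 - f z.1) * (g z.1 + f z.1 - 2 * f₀ z.1 - 2 * z.2) := by
    simp only [excessLoss]; ring
  have h2 : |g z.1 + f z.1 - 2 * f₀ z.1 - 2 * z.2| ≤ 4 * F + 2 * |z.2| := by
    rw [abs_le] at *
    rcases abs_cases z.2 with ⟨e, _⟩ | ⟨e, _⟩ <;> constructor <;> linarith
  have h3 : excessLoss f₀ g z - excessLoss f₀ f z ≤ δ * (4 * F + 2 * |z.2|) := by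
    rw [h1]
    refine (le_abs_self _).trans ?_
    rw [abs_mul, abs_sub_comm]
    exact mul_le_mul h h2 (abs_nonneg _) ((abs_nonneg _).trans h)
  linarith

/-- If one of the functions `g j` is `δ`-close to the empirical risk minimizer, its risk is at most
the excess empirical risk of any competitor, up to a log-sum-exp term. -/
theorem sq_dist_le_of_isERM {d n : ℕ} (hn : 0 < n) {F δ : ℝ} (hF : 0 < F)
    {J : Type*} [Fintype J] {f₀ fs fh : (Fin d → ℝ) → ℝ} {g : J → (Fin d → ℝ) → ℝ}
    (hf₀F : ∀ x, |f₀ x| ≤ F) (hfhF : ∀ x, |fh x| ≤ F) (hgF : ∀ j x, |g j x| ≤ F)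
    {q : Fin n → (Fin d → ℝ) × ℝ} (hq : ∀ i, (q i).1 ∈ cube d) (j : J)
    (hj : ∀ x ∈ cube d, |fh x - g j x| ≤ δ)
    (hmin : empiricalRisk (sample f₀ q) fh ≤ empiricalRisk (sample f₀ q) fs) (r : J → ℝ) :
    r j ≤ 4 / n * (∑ i, excessLoss f₀ fs (q i) + ∑ i, (4 * F * δ + 2 * δ * |(q i).2|) +
      4 * F ^ 2 * (Real.log (Fintype.card J) + (Fintype.card J : ℝ)⁻¹ *
        ∑ k, ∏ i, (Real.exp (1 / (4 * F ^ 2) * r k / 4) *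
          Real.exp (-(1 / (4 * F ^ 2)) * excessLoss f₀ (g k) (q i))))) := by
  set l : ℝ := 1 / (4 * F ^ 2) with hl
  have hl0 : 0 < l := by positivity
  have hn' : (0 : ℝ) < n := by exact_mod_cast hn
  have hlF : 4 * F ^ 2 * l = 1 := by rw [hl]; field_simp
  have hN : (0 : ℝ) < Fintype.card J := by
    exact_mod_cast Fintype.card_pos_iff.2 ⟨j⟩
  rw [empiricalRisk_sample, empiricalRisk_sample, add_le_add_iff_left] at hmin
  have h1 : ∑ i, excessLoss f₀ (g j) (q i) ≤
      ∑ i, excessLoss f₀ fs (q i) + ∑ i, (4 * F * δ + 2 * δ * |(q i).2|) := by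
    refine le_trans ?_ (add_le_add_left hmin _)
    rw [← Finset.sum_add_distrib]
    exact Finset.sum_le_sum fun i _ =>
      excessLoss_le_of_close (hf₀F _) (hfhF _) (hgF _ _) (hj _ (hq i))
  -- `U k` is the log-likelihood-type gap between a quarter of the true risk and the empirical risk
  -- of `g k`, in units of 4F². It is normalized so that exp(U k) has mean at most 1.
  set U : J → ℝ := fun k => l * n * r k / 4 - l * ∑ i, excessLoss f₀ (g k) (q i) with hU
  have h2 : ∀ k, ∏ i, (Real.exp (l * r k / 4) * Real.exp (-l * excessLoss f₀ (g k) (q i))) =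
      Real.exp (U k) := fun k => by
    simp_rw [← Real.exp_add]
    rw [← Real.exp_sum, Finset.sum_add_distrib, ← Finset.mul_sum]
    congr 1
    simp only [Finset.sum_const, Finset.card_univ, Fintype.card_fin, nsmul_eq_mul, hU]
    ring
  simp_rw [h2]
  -- From x + 1 ≤ exp x at x = U j - log N. Enlarging exp(U j) to the sum over all k removes the
  -- dependence on the sample-dependent index j.
  have h3 : U j ≤ Real.log (Fintype.card J) + (Fintype.card J : ℝ)⁻¹ * ∑ k, Real.exp (U k) := by
    have h4 := Real.add_one_le_exp (U j - Real.log (Fintype.card J))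
    rw [Real.exp_sub, Real.exp_log hN, div_eq_inv_mul] at h4
    have h5 := mul_le_mul_of_nonneg_left (Finset.single_le_sum (f := fun k => Real.exp (U k))
      (fun k _ => (Real.exp_pos _).le) (Finset.mem_univ j)) (inv_pos.2 hN).le
    linarith
  have h4 : r j = 4 / n * (4 * F ^ 2 * U j + ∑ i, excessLoss f₀ (g j) (q i)) := by
    have h6 : 4 * F ^ 2 * U j = n * r j / 4 - ∑ i, excessLoss f₀ (g j) (q i) := by
      calc 4 * F ^ 2 * U j = (4 * F ^ 2 * l) * (n * r j / 4 - ∑ i, excessLoss f₀ (g j) (q i)) := by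
            simp only [hU]; ring
        _ = _ := by rw [hlF, one_mul]
    rw [h6, sub_add_cancel]; field_simp
  rw [h4]
  have h5 : (0 : ℝ) ≤ 4 * F ^ 2 := by positivity
  have h6 := mul_le_mul_of_nonneg_left h3 h5
  have h7 : (0 : ℝ) ≤ 4 / n := by positivity
  exact mul_le_mul_of_nonneg_left (by linarith) h7

/-- Oracle inequality for empirical risk minimizers over classes with a finite uniform cover. -/
theorem risk_le_of_cover {d n : ℕ} (hn : 0 < n) {σ F δ : ℝ} (hσ : 0 < σ) (hσF : σ ≤ F)
    (hδ : 0 ≤ δ) {𝓕 : Set ((Fin d → ℝ) → ℝ)} (h𝓕 : ∀ f ∈ 𝓕, ∀ x, |f x| ≤ F)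
    {J : Type*} [Fintype J] (g : J → (Fin d → ℝ) → ℝ) (hg : ∀ j, Measurable (g j))
    (hgF : ∀ j x, |g j x| ≤ F) (hcov : ∀ f ∈ 𝓕, ∃ j, ∀ x ∈ cube d, |f x - g j x| ≤ δ)
    {f₀ fs : (Fin d → ℝ) → ℝ} (hf₀ : Measurable f₀) (hf₀F : ∀ x, |f₀ x| ≤ F)
    (hfs : Measurable fs) (hfs𝓕 : fs ∈ 𝓕)
    {fhat : (Fin n → (Fin d → ℝ) × ℝ) → (Fin d → ℝ) → ℝ} (hfhat : IsERM 𝓕 fhat) :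
    risk σ fhat f₀ ≤ ENNReal.ofReal (2 * δ ^ 2 + 8 * (∫ x, (fs x - f₀ x) ^ 2 ∂cubeMeasure d +
      (4 * F * δ + 2 * δ * σ) + 4 * F ^ 2 * (Real.log (Fintype.card J) + 1) / n)) := by
  have hF : 0 < F := hσ.trans_le hσF
  have hn' : (0 : ℝ) < n := by exact_mod_cast hn
  set μ := Measure.pi fun _ : Fin n => designNoise d σ with hμ
  set r : J → ℝ := fun j => ∫ x, (g j x - f₀ x) ^ 2 ∂cubeMeasure d with hr
  set l : ℝ := 1 / (4 * F ^ 2) with hl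
  obtain ⟨hs1, hs2, hs3⟩ := integrable_excessLoss (σ := σ) hf₀ hfs hf₀F (h𝓕 fs hfs𝓕)
  obtain ⟨ha1, ha2⟩ := integral_abs_noise_le (d := d) hσ
  set T₁ : (Fin n → (Fin d → ℝ) × ℝ) → ℝ := fun q => ∑ i, excessLoss f₀ fs (q i) with hT₁
  set T₂ : (Fin n → (Fin d → ℝ) × ℝ) → ℝ :=
    fun q => ∑ i, (4 * F * δ + 2 * δ * |(q i).2|) with hT₂
  set T₃ : (Fin n → (Fin d → ℝ) × ℝ) → ℝ := fun q => ∑ k, ∏ i, (Real.exp (l * r k / 4) *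
    Real.exp (-l * excessLoss f₀ (g k) (q i))) with hT₃
  set N : ℝ := (Fintype.card J : ℝ) with hN
  have hN0 : 0 < N := by
    obtain ⟨j, -⟩ := hcov fs hfs𝓕
    exact Nat.cast_pos.2 (Fintype.card_pos_iff.2 ⟨j⟩)
  have i₁ : Integrable T₁ μ := integrable_finsetSum _ fun i _ =>
    integrable_comp_eval (μ := fun _ : Fin n => designNoise d σ) (i := i) hs2
  have hi : Integrable (fun z : (Fin d → ℝ) × ℝ => 4 * F * δ + 2 * δ * |z.2|)
      (designNoise d σ) := (integrable_const _).add (ha1.const_mul _)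
  have i₂ : Integrable T₂ μ := integrable_finsetSum _ fun i _ =>
    integrable_comp_eval (μ := fun _ : Fin n => designNoise d σ) (i := i)
      (f := fun z : (Fin d → ℝ) × ℝ => 4 * F * δ + 2 * δ * |z.2|) hi
  have i₃' : ∀ k, Integrable (fun q : Fin n → (Fin d → ℝ) × ℝ =>
      ∏ i, (Real.exp (l * r k / 4) * Real.exp (-l * excessLoss f₀ (g k) (q i)))) μ := fun k =>
    Integrable.fintype_prod (f := fun _ z =>
      Real.exp (l * r k / 4) * Real.exp (-l * excessLoss f₀ (g k) z)) fun _ =>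
      (integral_exp_excessLoss_le hσ hσF hf₀ (hg k) hf₀F (hgF k)).1.const_mul _
  have i₃ : Integrable T₃ μ := integrable_finsetSum _ fun k _ => i₃' k
  have e₁ : ∫ q, T₁ q ∂μ = n * ∫ x, (fs x - f₀ x) ^ 2 ∂cubeMeasure d := by
    rw [hT₁, integral_finsetSum _ fun i _ => integrable_comp_eval
      (μ := fun _ : Fin n => designNoise d σ) (i := i) hs2]
    have : ∀ i : Fin n, ∫ q : Fin n → (Fin d → ℝ) × ℝ, excessLoss f₀ fs (q i) ∂μ =
        ∫ x, (fs x - f₀ x) ^ 2 ∂cubeMeasure d := fun i => by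
      rw [hμ, integral_comp_eval (μ := fun _ : Fin n => designNoise d σ)
        hs2.aestronglyMeasurable, hs3]
    refine (Finset.sum_congr rfl fun i _ => this i).trans ?_
    rw [Finset.sum_const, Finset.card_univ, Fintype.card_fin, nsmul_eq_mul]
  have e₂ : ∫ q, T₂ q ∂μ ≤ n * (4 * F * δ + 2 * δ * σ) := by
    rw [hT₂, integral_finsetSum _ fun i _ => integrable_comp_eval
      (μ := fun _ : Fin n => designNoise d σ) (i := i)
      (f := fun z : (Fin d → ℝ) × ℝ => 4 * F * δ + 2 * δ * |z.2|) hi]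
    have : ∀ i : Fin n, ∫ q : Fin n → (Fin d → ℝ) × ℝ, (4 * F * δ + 2 * δ * |(q i).2|) ∂μ ≤
        4 * F * δ + 2 * δ * σ := fun i => by
      rw [hμ, integral_comp_eval (μ := fun _ : Fin n => designNoise d σ)
        (f := fun z : (Fin d → ℝ) × ℝ => 4 * F * δ + 2 * δ * |z.2|)
        hi.aestronglyMeasurable, integral_add (integrable_const _) (ha1.const_mul _),
        integral_const, integral_const_mul]
      have := mul_le_mul_of_nonneg_left ha2 (mul_nonneg zero_le_two hδ)
      simp only [probReal_univ, smul_eq_mul, one_mul]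
      linarith
    refine (Finset.sum_le_sum fun i _ => this i).trans_eq ?_
    simp [mul_add]
  -- By independence each summand is a product of n one-point moments, and the tilt exp(l r/4)
  -- cancels the bound on each of them exactly.
  have e₃ : ∫ q, T₃ q ∂μ ≤ N := by
    rw [hT₃, integral_finsetSum _ fun k _ => i₃' k]
    have : ∀ k, ∫ q : Fin n → (Fin d → ℝ) × ℝ,
        ∏ i, (Real.exp (l * r k / 4) * Real.exp (-l * excessLoss f₀ (g k) (q i))) ∂μ ≤ 1 :=
      fun k => by
      rw [hμ, integral_fintype_prod_eq_prod (fun (_ : Fin n) (z : (Fin d → ℝ) × ℝ) =>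
        Real.exp (l * r k / 4) * Real.exp (-l * excessLoss f₀ (g k) z))]
      refine Finset.prod_le_one (fun i _ => integral_nonneg fun z => by positivity) fun i _ => ?_
      rw [integral_const_mul]
      have h := (integral_exp_excessLoss_le hσ hσF hf₀ (hg k) hf₀F (hgF k)).2
      refine (mul_le_mul_of_nonneg_left h (Real.exp_pos _).le).trans_eq ?_
      rw [← Real.exp_add, Real.exp_eq_one_iff]
      simp only [hr, hl]; ring
    refine (Finset.sum_le_sum fun k _ => this k).trans_eq ?_
    simp [hN]
  set G : (Fin n → (Fin d → ℝ) × ℝ) → ℝ := fun q => 2 * δ ^ 2 + 2 * (4 / n * (T₁ q + T₂ q +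
    4 * F ^ 2 * (Real.log N + N⁻¹ * T₃ q))) with hG
  have iG₀ : Integrable (fun q => T₁ q + T₂ q + 4 * F ^ 2 * (Real.log N + N⁻¹ * T₃ q)) μ :=
    (i₁.add i₂).add (((integrable_const _).add (i₃.const_mul _)).const_mul _)
  have iG : Integrable G μ := (integrable_const _).add ((iG₀.const_mul _).const_mul _)
  -- The index j of the nearby cover element varies with the sample, but the majorant `G` does not
  -- involve it, so only `G` has to be integrated. Its nonnegativity is recorded because the lower
  -- Lebesgue integral is turned into a Bochner integral below.
  have hpt : ∀ᵐ q ∂μ, eLpNorm (fhat (sample f₀ q) - f₀) 2 (cubeMeasure d) ^ 2 ≤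
      ENNReal.ofReal (G q) ∧ 0 ≤ G q := by
    filter_upwards [ae_of_ae_cubeMeasure (ae_mem_cube d)] with q hq
    obtain ⟨hmem, hmin⟩ := hfhat.2 (sample f₀ q) hq
    obtain ⟨j, hj⟩ := hcov _ hmem
    have hrj := sq_dist_le_of_isERM hn hF hf₀F (h𝓕 _ hmem) hgF hq j hj (hmin fs hfs𝓕) r
    have hle : 2 * δ ^ 2 + 2 * r j ≤ G q := by
      have := mul_le_mul_of_nonneg_left hrj zero_le_two
      exact add_le_add_right this _
    have hr0 : 0 ≤ r j := integral_nonneg fun x => sq_nonneg _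
    refine ⟨(eLpNorm_sub_sq_le_of_close
      (integrable_excessLoss (σ := σ) hf₀ (hg j) hf₀F (hgF j)).1 hj).trans
      (ENNReal.ofReal_le_ofReal hle), le_trans (by positivity) hle⟩
  calc risk σ fhat f₀ ≤ ∫⁻ q, ENNReal.ofReal (G q) ∂μ :=
        lintegral_mono_ae (hpt.mono fun q h => h.1)
    _ = ENNReal.ofReal (∫ q, G q ∂μ) :=
        (ofReal_integral_eq_lintegral_ofReal iG (hpt.mono fun q h => h.2)).symm
    _ ≤ _ := by
        refine ENNReal.ofReal_le_ofReal ?_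
        have hGi : ∫ q, G q ∂μ = 2 * δ ^ 2 + 2 * (4 / n * (∫ q, T₁ q ∂μ + ∫ q, T₂ q ∂μ +
            4 * F ^ 2 * (Real.log N + N⁻¹ * ∫ q, T₃ q ∂μ))) := by
          simp only [hG]
          have j3 : Integrable (fun q => Real.log N + N⁻¹ * T₃ q) μ :=
            (integrable_const _).add (i₃.const_mul _)
          have j12 : Integrable (fun q => T₁ q + T₂ q) μ := i₁.add i₂
          rw [integral_add (integrable_const _) ((iG₀.const_mul _).const_mul _), integral_const,
            integral_const_mul, integral_const_mul, integral_add j12 (j3.const_mul _),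
            integral_add i₁ i₂, integral_const_mul, integral_add (integrable_const _)
            (i₃.const_mul _), integral_const, integral_const_mul]
          simp
        rw [hGi, e₁]
        have h3 : N⁻¹ * ∫ q, T₃ q ∂μ ≤ 1 := by
          rw [inv_mul_le_iff₀ hN0, mul_one]; exact e₃
        have h4 := mul_le_mul_of_nonneg_left h3 (by positivity : (0:ℝ) ≤ 4 * F ^ 2)
        have h5 : 4 / (n : ℝ) * (n * (∫ x, (fs x - f₀ x) ^ 2 ∂cubeMeasure d) + ∫ q, T₂ q ∂μ +
            4 * F ^ 2 * (Real.log N + N⁻¹ * ∫ q, T₃ q ∂μ)) ≤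
            4 / n * (n * (∫ x, (fs x - f₀ x) ^ 2 ∂cubeMeasure d) +
              n * (4 * F * δ + 2 * δ * σ) + 4 * F ^ 2 * (Real.log N + 1)) :=
          mul_le_mul_of_nonneg_left (by linarith) (by positivity)
        refine (add_le_add_right (mul_le_mul_of_nonneg_left h5 zero_le_two) _).trans_eq ?_
        field_simp
        ring

/-- The risk only depends on the regression function up to null sets. -/
theorem risk_congr_ae {d n : ℕ} {σ : ℝ}
    (fhat : (Fin n → (Fin d → ℝ) × ℝ) → (Fin d → ℝ) → ℝ) {f g : (Fin d → ℝ) → ℝ}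
    (h : f =ᵐ[cubeMeasure d] g) : risk σ fhat f = risk σ fhat g := by
  refine lintegral_congr_ae ?_
  filter_upwards [ae_of_ae_cubeMeasure h] with q hq
  have hs : sample f q = sample g q := by
    funext i; simp only [sample, hq i]
  rw [hs, eLpNorm_congr_ae ((EventuallyEq.refl _ (fhat (sample g q))).sub h)]

/-! ### Clipping -/

/-- In the form max(-F, min(y, F)) the truncation is visibly continuous and 1-Lipschitz. -/
theorem sign_mul_min_abs {F : ℝ} (hF : 0 ≤ F) (y : ℝ) :
    Real.sign y * min |y| F = max (-F) (min y F) := by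
  rcases lt_trichotomy y 0 with h | h | h
  · rw [Real.sign_of_neg h, abs_of_neg h, min_eq_left (h.le.trans hF), neg_one_mul, ← max_neg_neg,
      neg_neg, max_comm]
  · subst h; simp [hF]
  · rw [Real.sign_of_pos h, abs_of_pos h, one_mul, max_eq_right]
    exact (neg_nonpos.2 hF).trans (le_min h.le hF)

theorem abs_clip_le {F : ℝ} (hF : 0 ≤ F) (y : ℝ) : |max (-F) (min y F)| ≤ F := by
  rw [abs_le]
  exact ⟨le_max_left _ _, max_le (by linarith) (min_le_right _ _)⟩

theorem abs_clip_sub_clip_le (F a b : ℝ) :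
    |max (-F) (min a F) - max (-F) (min b F)| ≤ |a - b| := by
  refine (abs_max_sub_max_le_max _ _ _ _).trans ?_
  rw [sub_self, abs_zero]
  refine max_le (abs_nonneg _) ((abs_min_sub_min_le_max _ _ _ _).trans ?_)
  simp

theorem clip_of_abs_le {F y : ℝ} (h : |y| ≤ F) : max (-F) (min y F) = y := by
  rw [min_eq_left (abs_le.1 h).2, max_eq_right (abs_le.1 h).1]

/-! ### Growth and stability of networks -/

theorem abs_relu_le {m : ℕ} (x : Fin m → ℝ) (i : Fin m) : |relu x i| ≤ |x i| := by
  rw [relu, abs_of_nonneg (le_max_right _ _)]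
  exact max_le (le_abs_self _) (abs_nonneg _)

theorem abs_relu_sub_relu_le {m : ℕ} (x y : Fin m → ℝ) (i : Fin m) :
    |relu x i - relu y i| ≤ |x i - y i| :=
  (abs_max_sub_max_le_max _ _ _ _).trans (by simp)

theorem abs_mulVec_le {m m' : ℕ} {A : Matrix (Fin m) (Fin m') ℝ} {B c : ℝ} (hA : MatBound A B)
    (hB : 0 ≤ B) {x : Fin m' → ℝ} (hx : ∀ j, |x j| ≤ c) (i : Fin m) :
    |A.mulVec x i| ≤ m' * (B * c) := by
  rw [Matrix.mulVec, dotProduct]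
  refine (Finset.abs_sum_le_sum_abs _ _).trans ?_
  refine (Finset.sum_le_card_nsmul _ _ (B * c) fun j _ => ?_).trans_eq (by simp)
  rw [abs_mul]
  exact mul_le_mul (hA i j) (hx j) (abs_nonneg _) hB

/-- Each layer multiplies the size by at most B(D + 1): D products and one shift. The first layer
obeys the same bound because d ≤ D. Inputs of any size m ≥ 1 are allowed, since the linear growth in
m is what the cutoff outside the cube relies on. -/
theorem Weights.abs_hidden_le {d D L : ℕ} (hdD : d ≤ D) {w : Weights d D} {B : ℝ} (hB : 1 ≤ B)
    (hw : w.Bounded L B) {x : Fin d → ℝ} {m : ℝ} (hm : 1 ≤ m) (hx : ∀ i, |x i| ≤ m) (k : ℕ)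
    (hk : k ≤ L - 1) (i : Fin D) : |w.hidden x k i| ≤ (B * (D + 1)) ^ (k + 1) * m := by
  have hB0 : 0 ≤ B := by linarith
  have hd : (d : ℝ) ≤ D := by exact_mod_cast hdD
  have hD0 : (0 : ℝ) ≤ D := Nat.cast_nonneg D
  have hQ : 1 ≤ B * (D + 1) := by nlinarith
  induction k generalizing i with
  | zero =>
    refine (abs_relu_le _ _).trans ?_
    rw [Pi.sub_apply]
    refine (abs_sub _ _).trans ?_
    have h1 := abs_mulVec_le hw.1 hB0 hx i
    have h2 := hw.2.1 i
    have h3 : (d : ℝ) * (B * m) ≤ D * (B * m) := mul_le_mul_of_nonneg_right hd (by positivity)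
    have h4 : B ≤ B * m := le_mul_of_one_le_right hB0 hm
    rw [zero_add, pow_one]
    nlinarith
  | succ k ih =>
    have ih := ih (by omega)
    refine (abs_relu_le _ _).trans ?_
    rw [Pi.sub_apply]
    refine (abs_sub _ _).trans ?_
    have hk' := hw.2.2.1 k (by omega)
    have h1 := abs_mulVec_le hk'.1 hB0 ih i
    have h2 := hk'.2 i
    have h3 : 1 ≤ (B * (D + 1)) ^ (k + 1) * m := one_le_mul_of_one_le_of_one_le (one_le_pow₀ hQ) hm
    have h4 := mul_le_mul_of_nonneg_left h3 hB0
    rw [pow_succ _ (k + 1)]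
    linarith

theorem Weights.abs_eval_le {d D L : ℕ} (hL : 0 < L) (hdD : d ≤ D) {w : Weights d D} {B : ℝ}
    (hB : 1 ≤ B) (hw : w.Bounded L B) {x : Fin d → ℝ} {m : ℝ} (hm : 1 ≤ m)
    (hx : ∀ i, |x i| ≤ m) : |w.eval L x| ≤ (B * (D + 1)) ^ (L + 1) * m := by
  have hB0 : 0 ≤ B := by linarith
  have h := abs_mulVec_le hw.2.2.2 hB0
    (fun i => w.abs_hidden_le hdD hB hw hm hx (L - 1) le_rfl i) 0
  rw [Nat.sub_add_cancel hL] at h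
  refine h.trans ?_
  have h1 : 0 ≤ B * ((B * (D + 1)) ^ L * m) := by positivity
  rw [pow_succ]
  linarith

/-- The weights with the entries of `w - w'`. -/
def Weights.sub {d D : ℕ} (w w' : Weights d D) : Weights d D where
  W₁ := w.W₁ - w'.W₁
  v₁ := w.v₁ - w'.v₁
  W k := w.W k - w'.W k
  v k := w.v k - w'.v k
  Wout := w.Wout - w'.Wout

/-- The splitting A x - A' x' = A'(x - x') + (A - A')x separates the propagated error from the new
one. Entries of A' are bounded by B + η, so no separate bound on A' is assumed. -/
theorem abs_mulVec_sub_mulVec_le {m m' : ℕ} {A A' : Matrix (Fin m) (Fin m') ℝ} {B η c e : ℝ}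
    (hA : MatBound A B) (hB : 0 ≤ B) (hη : 0 ≤ η) (hAA' : MatBound (A - A') η)
    {x x' : Fin m' → ℝ} (hx : ∀ j, |x j| ≤ c) (hxx' : ∀ j, |x j - x' j| ≤ e) (i : Fin m) :
    |A.mulVec x i - A'.mulVec x' i| ≤ m' * ((B + η) * e) + m' * (η * c) := by
  have h1 : A.mulVec x i - A'.mulVec x' i = A'.mulVec (x - x') i + (A - A').mulVec x i := by
    rw [Matrix.mulVec_sub, Matrix.sub_mulVec, Pi.sub_apply, Pi.sub_apply]; ring
  have hA' : MatBound A' (B + η) := fun i j => by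
    have h := abs_sub (A i j) ((A - A') i j)
    rw [Matrix.sub_apply, sub_sub_cancel] at h
    exact h.trans (add_le_add (hA i j) (hAA' i j))
  rw [h1]
  exact (abs_add_le _ _).trans (add_le_add (abs_mulVec_le hA' (by positivity) hxx' i)
    (abs_mulVec_le hAA' hη hx i))

/-- With Q = B(D + 1), each layer multiplies the incoming error by at most 2Q, as η ≤ B, and its own
perturbed parameters contribute at most Q times the same bound; 4Q covers both. -/
theorem Weights.abs_hidden_sub_le {d D L : ℕ} (hdD : d ≤ D) {w w' : Weights d D} {B η : ℝ}
    (hB : 1 ≤ B) (hη : 0 ≤ η) (hηB : η ≤ B) (hw : w.Bounded L B) (hww' : (w.sub w').Bounded L η)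
    {x : Fin d → ℝ} (hx : ∀ i, |x i| ≤ 1) (k : ℕ) (hk : k ≤ L - 1) (i : Fin D) :
    |w.hidden x k i - w'.hidden x k i| ≤ η * (4 * (B * (D + 1))) ^ (k + 1) := by
  have hB0 : 0 ≤ B := by linarith
  have hd : (d : ℝ) ≤ D := by exact_mod_cast hdD
  have hD0 : (0 : ℝ) ≤ D := Nat.cast_nonneg D
  have hQ : 1 ≤ B * (D + 1) := by nlinarith
  induction k generalizing i with
  | zero =>
    refine (abs_relu_sub_relu_le _ _ i).trans ?_
    rw [Pi.sub_apply, Pi.sub_apply, sub_sub_sub_comm]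
    refine (abs_sub _ _).trans ?_
    have h1 := abs_mulVec_sub_mulVec_le (x' := x) (e := 0) hw.1 hB0 hη hww'.1 hx (by simp) i
    have h2 : |w.v₁ i - w'.v₁ i| ≤ η := hww'.2.1 i
    have h3 : (d : ℝ) * (η * 1) ≤ D * (η * 1) := mul_le_mul_of_nonneg_right hd (by positivity)
    have h4 : η * (D + 1) ≤ η * (B * (D + 1)) := by
      refine mul_le_mul_of_nonneg_left ?_ hη
      nlinarith
    have h5 : 0 ≤ η * (B * (D + 1)) := by positivity
    rw [zero_add, pow_one]
    nlinarith
  | succ k ih =>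
    have ih := ih (by omega)
    refine (abs_relu_sub_relu_le _ _ i).trans ?_
    rw [Pi.sub_apply, Pi.sub_apply, sub_sub_sub_comm]
    refine (abs_sub _ _).trans ?_
    have hk' := hw.2.2.1 k (by omega)
    have hk'' := hww'.2.2.1 k (by omega)
    have h0 := fun j => w.abs_hidden_le hdD hB hw le_rfl hx k (by omega) j
    have h1 := abs_mulVec_sub_mulVec_le hk'.1 hB0 hη hk''.1 h0 ih i
    have h2 : |w.v k i - w'.v k i| ≤ η := hk''.2 i
    set Q := B * ((D : ℝ) + 1) with hQdef
    have hQk : 1 ≤ Q ^ (k + 1) := one_le_pow₀ hQ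
    have hle : Q ^ (k + 1) ≤ (4 * Q) ^ (k + 1) := pow_le_pow_left₀ (by positivity) (by linarith) _
    have hDQ : (D : ℝ) + 1 ≤ Q := by nlinarith
    have h3 : (D : ℝ) * ((B + η) * (η * (4 * Q) ^ (k + 1))) ≤ 2 * Q * (η * (4 * Q) ^ (k + 1)) := by
      have h5 : (D : ℝ) * (B + η) ≤ 2 * Q := by nlinarith
      calc (D : ℝ) * ((B + η) * (η * (4 * Q) ^ (k + 1)))
          = (D : ℝ) * (B + η) * (η * (4 * Q) ^ (k + 1)) := by ring
        _ ≤ _ := mul_le_mul_of_nonneg_right h5 (by positivity)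
    have h4 : (D : ℝ) * (η * (Q ^ (k + 1) * 1)) + η ≤ Q * (η * (4 * Q) ^ (k + 1)) := by
      calc (D : ℝ) * (η * (Q ^ (k + 1) * 1)) + η ≤ (D : ℝ) * (η * (Q ^ (k + 1) * 1)) +
            η * Q ^ (k + 1) := by gcongr; exact le_mul_of_one_le_right hη hQk
        _ = ((D : ℝ) + 1) * (η * Q ^ (k + 1)) := by ring
        _ ≤ Q * (η * (4 * Q) ^ (k + 1)) := by gcongr
    have h6 : 0 ≤ Q * (η * (4 * Q) ^ (k + 1)) := by positivity
    rw [pow_succ _ (k + 1)]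
    linarith

theorem Weights.abs_eval_sub_le {d D L : ℕ} (hL : 0 < L) (hdD : d ≤ D) {w w' : Weights d D}
    {B η : ℝ} (hB : 1 ≤ B) (hη : 0 ≤ η) (hηB : η ≤ B) (hw : w.Bounded L B)
    (hww' : (w.sub w').Bounded L η) {x : Fin d → ℝ} (hx : ∀ i, |x i| ≤ 1) :
    |w.eval L x - w'.eval L x| ≤ η * (4 * (B * (D + 1))) ^ (L + 1) := by
  have hB0 : 0 ≤ B := by linarith
  have hD0 : (0 : ℝ) ≤ D := Nat.cast_nonneg D
  have h := abs_mulVec_sub_mulVec_le hw.2.2.2 hB0 hη hww'.2.2.2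
    (fun i => w.abs_hidden_le hdD hB hw le_rfl hx (L - 1) le_rfl i)
    (fun i => w.abs_hidden_sub_le hdD hB hη hηB hw hww' hx (L - 1) le_rfl i) 0
  rw [Nat.sub_add_cancel hL] at h
  refine h.trans ?_
  set Q := B * ((D : ℝ) + 1) with hQ
  have hQ1 : 1 ≤ Q := by nlinarith
  have hDQ : (D : ℝ) ≤ Q := by nlinarith
  have hle : Q ^ L ≤ (4 * Q) ^ L := pow_le_pow_left₀ (by positivity) (by linarith) _
  have h3 : (D : ℝ) * ((B + η) * (η * (4 * Q) ^ L)) ≤ 2 * Q * (η * (4 * Q) ^ L) := by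
    have h5 : (D : ℝ) * (B + η) ≤ 2 * Q := by nlinarith
    calc (D : ℝ) * ((B + η) * (η * (4 * Q) ^ L)) = (D : ℝ) * (B + η) * (η * (4 * Q) ^ L) := by ring
      _ ≤ _ := mul_le_mul_of_nonneg_right h5 (by positivity)
  have h4 : (D : ℝ) * (η * (Q ^ L * 1)) ≤ Q * (η * (4 * Q) ^ L) := by
    rw [mul_one]; gcongr
  have h6 : 0 ≤ Q * (η * (4 * Q) ^ L) := by positivity
  rw [pow_succ]
  linarith

theorem Weights.continuous_hidden {d D : ℕ} (w : Weights d D) (k : ℕ) :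
    Continuous fun x => w.hidden x k := by
  induction k with
  | zero =>
    refine continuous_pi fun i => ?_
    simp only [hidden, relu, Pi.sub_apply, Matrix.mulVec, dotProduct]
    fun_prop
  | succ k ih =>
    refine continuous_pi fun i => ?_
    simp only [hidden, relu, Pi.sub_apply, Matrix.mulVec, dotProduct]
    have := fun j => (continuous_pi_iff.1 ih j)
    fun_prop

theorem Weights.continuous_eval {d D : ℕ} (w : Weights d D) (L : ℕ) : Continuous (w.eval L) := by
  have := fun j => (continuous_pi_iff.1 (w.continuous_hidden (L - 1)) j)
  unfold eval
  simp only [Matrix.mulVec, dotProduct]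
  fun_prop

/-! ### Counting nonzero entries -/

theorem nnzVec_eq_sum {m : ℕ} (v : Fin m → ℝ) : nnzVec v = ∑ i, if v i ≠ 0 then 1 else 0 := by
  rw [nnzVec, Set.ncard_eq_toFinset_card', Set.toFinset_ofPred, Finset.card_filter]

theorem nnzMat_eq_sum {m m' : ℕ} (A : Matrix (Fin m) (Fin m') ℝ) :
    nnzMat A = ∑ i, ∑ j, if A i j ≠ 0 then 1 else 0 := by
  rw [nnzMat, Set.ncard_eq_toFinset_card', Set.toFinset_ofPred, Finset.card_filter,
    Fintype.sum_prod_type]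

/-! ### A finite cover of the class of networks -/

/-- The positions of the parameters of a network with `L` hidden layers of width `D`. -/
abbrev ParamIndex (d D L : ℕ) : Type :=
  ((Fin D × Fin d) ⊕ Fin D) ⊕ ((Fin (L - 1) × ((Fin D × Fin D) ⊕ Fin D)) ⊕ (Fin 1 × Fin D))

/-- The network with given parameters. -/
def Weights.ofParams {d D L : ℕ} (c : ParamIndex d D L → ℝ) : Weights d D where
  W₁ i j := c (.inl (.inl (i, j)))
  v₁ i := c (.inl (.inr i))
  W k i j := if h : k < L - 1 then c (.inr (.inl (⟨k, h⟩, .inl (i, j)))) else 0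
  v k i := if h : k < L - 1 then c (.inr (.inl (⟨k, h⟩, .inr i))) else 0
  Wout i j := c (.inr (.inr (i, j)))

/-- The parameters of a network. -/
def Weights.params {d D : ℕ} (L : ℕ) (w : Weights d D) : ParamIndex d D L → ℝ
  | .inl (.inl (i, j)) => w.W₁ i j
  | .inl (.inr i) => w.v₁ i
  | .inr (.inl (k, .inl (i, j))) => w.W k i j
  | .inr (.inl (k, .inr i)) => w.v k i
  | .inr (.inr (i, j)) => w.Wout i j

theorem Weights.nnz_eq_card {d D : ℕ} (L : ℕ) (w : Weights d D) :
    w.nnz L = (Finset.univ.filter fun p => w.params L p ≠ 0).card := by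
  rw [Finset.card_filter]
  simp only [Fintype.sum_sum_type, Fintype.sum_prod_type, nnz, nnzMat_eq_sum, nnzVec_eq_sum, params,
    Finset.sum_range]
  rw [add_assoc]
  congr!

theorem Weights.abs_params_le {d D L : ℕ} {w : Weights d D} {B : ℝ} (hw : w.Bounded L B)
    (p : ParamIndex d D L) : |w.params L p| ≤ B := by
  rcases p with (⟨i, j⟩ | i) | ⟨k, ⟨i, j⟩ | i⟩ | ⟨i, j⟩
  · exact hw.1 i j
  · exact hw.2.1 i
  · exact (hw.2.2.1 k k.2).1 i j
  · exact (hw.2.2.1 k k.2).2 i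
  · exact hw.2.2.2 i j

theorem Weights.bounded_sub_ofParams {d D L : ℕ} {w : Weights d D} {c : ParamIndex d D L → ℝ}
    {η : ℝ} (h : ∀ p, |w.params L p - c p| ≤ η) : (w.sub (.ofParams c)).Bounded L η := by
  refine ⟨fun i j => h (.inl (.inl (i, j))), fun i => h (.inl (.inr i)), fun k hk => ?_,
    fun i j => h (.inr (.inr (i, j)))⟩
  refine ⟨fun i j => ?_, fun i => ?_⟩
  · change |w.W k i j - (if h : k < L - 1 then c (.inr (.inl (⟨k, h⟩, .inl (i, j)))) else 0)| ≤ η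
    rw [dif_pos hk]
    exact h (.inr (.inl (⟨k, hk⟩, .inl (i, j))))
  · change |w.v k i - (if h : k < L - 1 then c (.inr (.inl (⟨k, h⟩, .inr i))) else 0)| ≤ η
    rw [dif_pos hk]
    exact h (.inr (.inl (⟨k, hk⟩, .inr i)))

theorem card_paramIndex_le {d D L : ℕ} (hL : 0 < L) (hdD : d ≤ D) :
    Fintype.card (ParamIndex d D L) ≤ (L + 1) * (D + 1) ^ 2 := by
  simp only [Fintype.card_sum, Fintype.card_prod, Fintype.card_fin]
  obtain ⟨l, rfl⟩ := Nat.exists_eq_add_of_lt hL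
  have : D * d ≤ D * D := Nat.mul_le_mul_left D hdD
  simp only [zero_add, Nat.add_sub_cancel]
  nlinarith [Nat.zero_le (l * D), Nat.zero_le D, Nat.zero_le l]

/-- The vector with the entries `η (z - K)` at the positions given by a list of pairs. -/
noncomputable def sparseVector {ι : Type*} {S K : ℕ} (η : ℝ)
    (t : Fin S → ι × Fin (2 * K + 1)) (p : ι) : ℝ :=
  open Classical in
  if h : ∃ s, (t s).1 = p then η * (((t h.choose).2 : ℕ) - K : ℝ) else 0

/-- Every entry is rounded down to the grid of mesh η, and the nonzero ones are listed as pairs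
(position, level). Such lists describe a vector redundantly, but their number (|ι|(2K + 1))^S is
small enough for the entropy bound. The condition on K makes all levels lie between -K and K. -/
theorem exists_sparseVector_close {ι : Type*} [Fintype ι] [Nonempty ι] {S K : ℕ} {η B : ℝ}
    (hη : 0 < η) (hK : B / η + 1 ≤ K) (c : ι → ℝ) (hc : ∀ p, |c p| ≤ B)
    (hS : (Finset.univ.filter fun p => c p ≠ 0).card ≤ S) :
    ∃ t : Fin S → ι × Fin (2 * K + 1), ∀ p, |c p - sparseVector η t p| ≤ η := by
  classical
  set T := Finset.univ.filter fun p => c p ≠ 0 with hT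
  -- Unused slots of the list get an arbitrary position. This is harmless: the level stored with a
  -- position is always the rounding of the entry there, so repeated positions agree and any choice
  -- among them gives the same value.
  let g : Fin S → ι := fun s =>
    if h : (s : ℕ) < T.card then (T.equivFin.symm ⟨s, h⟩ : ι) else Classical.arbitrary ι
  have hg : ∀ p, c p ≠ 0 → ∃ s, g s = p := fun p hp => by
    have hpT : p ∈ T := by simp [hT, hp]
    refine ⟨⟨T.equivFin ⟨p, hpT⟩, (T.equivFin ⟨p, hpT⟩).2.trans_le hS⟩, ?_⟩
    simp [g]
  have hz : ∀ p, |((⌊c p / η⌋ : ℤ) : ℝ)| ≤ K := fun p => by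
    have h1 : |c p / η| ≤ B / η := by
      rw [abs_div, abs_of_pos hη]; exact div_le_div_of_nonneg_right (hc p) hη.le
    have h2 := Int.floor_le (c p / η)
    have h3 := Int.lt_floor_add_one (c p / η)
    rw [abs_le] at h1 ⊢
    constructor <;> linarith
  have hz1 : ∀ p, -(K : ℤ) ≤ ⌊c p / η⌋ := fun p => by
    exact_mod_cast (abs_le.1 (hz p)).1
  have hz2 : ∀ p, ⌊c p / η⌋ ≤ (K : ℤ) := fun p => by
    exact_mod_cast (abs_le.1 (hz p)).2
  refine ⟨fun s => (g s, ⟨(⌊c (g s) / η⌋ + K).toNat, ?_⟩), fun p => ?_⟩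
  · have := hz1 (g s); have := hz2 (g s); omega
  · unfold sparseVector
    split_ifs with h
    · have hs := h.choose_spec
      simp only at hs ⊢
      rw [hs]
      have h1 : (((⌊c p / η⌋ + K).toNat : ℕ) : ℝ) = (⌊c p / η⌋ : ℝ) + K := by
        have := hz1 p
        have h2 : (((⌊c p / η⌋ + K).toNat : ℕ) : ℤ) = ⌊c p / η⌋ + K := by omega
        exact_mod_cast congrArg (fun z : ℤ => (z : ℝ)) h2
      rw [h1, add_sub_cancel_right]
      have h2 := Int.floor_le (c p / η)
      have h3 := Int.lt_floor_add_one (c p / η)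
      rw [le_div_iff₀ hη] at h2
      rw [div_lt_iff₀ hη] at h3
      rw [abs_le]
      constructor <;> linarith
    · have : c p = 0 := by
        by_contra hp
        exact h (hg p hp)
      simp [this, hη.le]

/-- Rounding the parameters to mesh η = δ/(4Q)^{L+1} moves the output by at most δ on the cube
(`Weights.abs_eval_sub_le`), and clipping does not increase this. The cover elements need not belong
to the class; they only have to be measurable and bounded by F. -/
theorem exists_cover_clippedNetworks {d : ℕ} (hd : 0 < d) (s : NetSize d) {F δ : ℝ} (hF : 0 ≤ F)
    (hδ : 0 < δ) (hδ1 : δ ≤ 1) :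
    ∃ (N : ℕ) (g : Fin N → (Fin d → ℝ) → ℝ), (∀ j, Measurable (g j)) ∧ (∀ j x, |g j x| ≤ F) ∧
      (∀ f ∈ clippedNetworks s F, ∃ j, ∀ x ∈ cube d, |f x - g j x| ≤ δ) ∧
      Real.log N ≤ s.S * (Real.log (s.L + 1) + (s.L + 4) * Real.log (4 * (s.B * (s.D + 1))) -
        Real.log δ) := by
  set Q : ℝ := s.B * (s.D + 1) with hQ
  have hB := s.one_le_B
  have hD : (1 : ℝ) ≤ s.D := by exact_mod_cast (hd.trans_le s.le_D : 0 < s.D)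
  have hQB : 2 * s.B ≤ Q := by nlinarith
  have hQD : (s.D : ℝ) + 1 ≤ Q := by nlinarith
  have hQ4 : 0 < (4 * Q) ^ (s.L + 1) := by positivity
  have hQ41 : 1 ≤ (4 * Q) ^ (s.L + 1) := one_le_pow₀ (by linarith)
  set η : ℝ := δ / (4 * Q) ^ (s.L + 1) with hη
  have hη0 : 0 < η := by positivity
  have hη1 : η ≤ 1 := (div_le_one hQ4).2 (hδ1.trans hQ41)
  set K : ℕ := ⌈s.B / η⌉₊ + 1 with hK
  have hK1 : s.B / η + 1 ≤ K := by rw [hK]; push_cast; linarith [Nat.le_ceil (s.B / η)]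
  have hK2 : (K : ℝ) ≤ s.B / η + 2 := by
    rw [hK]; push_cast; linarith [Nat.ceil_lt_add_one (a := s.B / η) (by positivity)]
  have : Nonempty (ParamIndex d s.D s.L) := ⟨.inl (.inr ⟨0, hd.trans_le s.le_D⟩)⟩
  let J := Fin s.S → ParamIndex d s.D s.L × Fin (2 * K + 1)
  let e := Fintype.equivFin J
  let g : J → (Fin d → ℝ) → ℝ := fun t x =>
    max (-F) (min ((Weights.ofParams (sparseVector η t)).eval s.L x) F)
  refine ⟨Fintype.card J, fun j => g (e.symm j), fun j => ?_, fun j x => abs_clip_le hF _, ?_, ?_⟩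
  · have := (Weights.ofParams (sparseVector η (e.symm j))).continuous_eval s.L
    exact (continuous_const.max (this.min continuous_const)).measurable
  · rintro f ⟨f', ⟨w, hwB, hwS, rfl⟩, rfl⟩
    obtain ⟨t, ht⟩ := exists_sparseVector_close hη0 hK1 (w.params s.L)
      (Weights.abs_params_le hwB) ((w.nnz_eq_card s.L).symm.le.trans hwS)
    refine ⟨e t, fun x hx => ?_⟩
    simp only [Equiv.symm_apply_apply, g]
    rw [sign_mul_min_abs hF]
    refine (abs_clip_sub_clip_le _ _ _).trans ?_
    have hx' : ∀ i, |x i| ≤ 1 := fun i => by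
      rw [abs_of_nonneg (hx.1 i)]; exact hx.2 i
    refine (Weights.abs_eval_sub_le s.L_pos s.le_D hB hη0.le (hη1.trans hB) hwB
      (Weights.bounded_sub_ofParams ht) hx').trans_eq ?_
    rw [hη, div_mul_cancel₀ _ hQ4.ne']
  · have hcard : (Fintype.card J : ℝ) =
        ((Fintype.card (ParamIndex d s.D s.L) : ℝ) * (2 * K + 1)) ^ s.S := by
      simp only [J, Fintype.card_fun, Fintype.card_prod, Fintype.card_fin]
      push_cast; ring
    rw [hcard, Real.log_pow]
    refine mul_le_mul_of_nonneg_left ?_ (Nat.cast_nonneg _)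
    have h1 : (Fintype.card (ParamIndex d s.D s.L) : ℝ) ≤ (s.L + 1) * Q ^ 2 := by
      have : (Fintype.card (ParamIndex d s.D s.L) : ℝ) ≤ (s.L + 1) * (s.D + 1) ^ 2 := by
        exact_mod_cast card_paramIndex_le s.L_pos s.le_D
      refine this.trans ?_
      gcongr
    -- Since 2B ≤ Q, the main term 2B/η takes up only one quarter of the bound; the remaining
    -- 3Q(4Q)^{L+1}/δ absorbs the additive constant 5.
    have h2 : (2 * K + 1 : ℝ) ≤ (4 * Q) ^ (s.L + 2) / δ := by
      have h3 : s.B / η = s.B * (4 * Q) ^ (s.L + 1) / δ := by rw [hη]; field_simp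
      have h4 : (2 * K + 1 : ℝ) ≤ 2 * (s.B * (4 * Q) ^ (s.L + 1) / δ) + 5 := by
        rw [← h3]; linarith
      refine h4.trans ?_
      rw [le_div_iff₀ hδ, add_mul, mul_assoc, div_mul_cancel₀ _ hδ.ne', pow_succ _ (s.L + 1)]
      nlinarith
    have hP : 0 < (Fintype.card (ParamIndex d s.D s.L) : ℝ) := by
      exact_mod_cast Fintype.card_pos
    have h5 : (Fintype.card (ParamIndex d s.D s.L) : ℝ) * (2 * K + 1) ≤
        (s.L + 1) * (4 * Q) ^ (s.L + 4) / δ := by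
      calc (Fintype.card (ParamIndex d s.D s.L) : ℝ) * (2 * K + 1)
          ≤ ((s.L + 1) * Q ^ 2) * ((4 * Q) ^ (s.L + 2) / δ) := by gcongr
        _ ≤ ((s.L + 1) * (4 * Q) ^ 2) * ((4 * Q) ^ (s.L + 2) / δ) := by
            gcongr; linarith
        _ = _ := by ring
    have hQ0 : 0 < 4 * Q := by linarith
    have h6 := Real.log_le_log (by positivity) h5
    have h7 : Real.log ((s.L + 1) * (4 * Q) ^ (s.L + 4) / δ) =
        Real.log (s.L + 1) + (s.L + 4) * Real.log (4 * Q) - Real.log δ := by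
      rw [Real.log_div (by positivity) hδ.ne', Real.log_mul (by positivity) (by positivity),
        Real.log_pow]
      push_cast; ring
    exact h6.trans_eq h7

/-! ### Building networks layer by layer -/

/-- The parameters of the hidden layers up to number `k + 1` are at most `B`. -/
def Weights.HiddenBounded {d D : ℕ} (w : Weights d D) (k : ℕ) (B : ℝ) : Prop :=
  MatBound w.W₁ B ∧ VecBound w.v₁ B ∧ ∀ j < k, MatBound (w.W j) B ∧ VecBound (w.v j) B

/-- The number of nonzero parameters of the hidden layers up to number `k + 1`. -/
noncomputable def Weights.hiddenNnz {d D : ℕ} (w : Weights d D) (k : ℕ) : ℕ :=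
  nnzMat w.W₁ + nnzVec w.v₁ + ∑ j ∈ Finset.range k, (nnzMat (w.W j) + nnzVec (w.v j))

/-- The functions `h · i` are computed by distinct neurons of the hidden layer number `k + 1` of a
network of width `D`, with at most `S` nonzero parameters up to that layer, all at most `B`. -/
def HiddenLayer {d : ℕ} {ι : Type*} (h : (Fin d → ℝ) → ι → ℝ) (k S D : ℕ) (B : ℝ) : Prop :=
  ∃ (w : Weights d D) (e : ι → Fin D), Function.Injective e ∧ w.HiddenBounded k B ∧
    w.hiddenNnz k ≤ S ∧ ∀ x i, w.hidden x k (e i) = h x i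

/-- The function `f` is computed by a network with `L` hidden layers of width `D`, with at most `S`
nonzero parameters, all at most `B`. -/
def IsNet {d : ℕ} (f : (Fin d → ℝ) → ℝ) (L S D : ℕ) (B : ℝ) : Prop :=
  ∃ w : Weights d D, w.Bounded L B ∧ w.nnz L ≤ S ∧ f = w.eval L

/-! ### Sparsity under matrix operations -/

theorem nnzMat_le {m m' : ℕ} (A : Matrix (Fin m) (Fin m') ℝ) : nnzMat A ≤ m * m' := by
  rw [nnzMat]
  refine (Set.ncard_le_card _).trans_eq ?_
  simp [Nat.card_eq_fintype_card]

theorem nnzVec_le {m : ℕ} (v : Fin m → ℝ) : nnzVec v ≤ m := by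
  rw [nnzVec]
  refine (Set.ncard_le_card _).trans_eq ?_
  simp [Nat.card_eq_fintype_card]

theorem nnzVec_zero {m : ℕ} : nnzVec (0 : Fin m → ℝ) = 0 := by simp [nnzVec]

theorem nnzMat_zero {m m' : ℕ} : nnzMat (0 : Matrix (Fin m) (Fin m') ℝ) = 0 := by simp [nnzMat]

theorem nnzMat_diagonal_le {m : ℕ} (v : Fin m → ℝ) : nnzMat (Matrix.diagonal v) ≤ m := by
  have h : {q : Fin m × Fin m | Matrix.diagonal v q.1 q.2 ≠ 0} ⊆
      Set.range fun i : Fin m => (i, i) := by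
    rintro ⟨i, j⟩ hij
    refine ⟨i, ?_⟩
    by_contra hne
    exact hij (Matrix.diagonal_apply_ne _ fun e : i = j => hne (by subst e; rfl))
  refine (Set.ncard_le_ncard h (Set.toFinite _)).trans ?_
  rw [← Set.image_univ]
  exact (Set.ncard_image_le (Set.toFinite _)).trans (by simp [Set.ncard_univ])

/-- A zero row of A stays zero in A T, and a nonzero row of A T has only d entries. An affine change
of the input thus costs a factor depending on d alone, not on the width. -/
theorem nnzMat_mul_le {m d : ℕ} (A : Matrix (Fin m) (Fin d) ℝ) (T : Matrix (Fin d) (Fin d) ℝ) :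
    nnzMat (A * T) ≤ d * nnzMat A := by
  classical
  rw [nnzMat_eq_sum, nnzMat_eq_sum, Finset.mul_sum]
  refine Finset.sum_le_sum fun i _ => ?_
  by_cases h : ∃ j, A i j ≠ 0
  · obtain ⟨j, hj⟩ := h
    calc ∑ k, (if (A * T) i k ≠ 0 then 1 else 0) ≤ ∑ _k : Fin d, 1 :=
          Finset.sum_le_sum fun k _ => by split_ifs <;> omega
      _ = d * 1 := by simp
      _ ≤ d * ∑ k, (if A i k ≠ 0 then 1 else 0) := by
          refine Nat.mul_le_mul_left _ ?_
          have := Finset.single_le_sum (f := fun k => if A i k ≠ 0 then 1 else 0)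
            (fun _ _ => Nat.zero_le _) (Finset.mem_univ j)
          simpa [hj] using this
  · push Not at h
    have h0 : ∀ k, (A * T) i k = 0 := fun k => by
      rw [Matrix.mul_apply]; exact Finset.sum_eq_zero fun j _ => by rw [h j, zero_mul]
    simp [h0]

/-- A new nonzero shift can only appear in a nonzero row of A. -/
theorem nnzVec_add_mulVec_le {m d : ℕ} (v : Fin m → ℝ) (A : Matrix (Fin m) (Fin d) ℝ)
    (u : Fin d → ℝ) : nnzVec (v + A.mulVec u) ≤ nnzVec v + nnzMat A := by
  classical
  rw [nnzVec_eq_sum, nnzVec_eq_sum, nnzMat_eq_sum, ← Finset.sum_add_distrib]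
  refine Finset.sum_le_sum fun i _ => ?_
  by_cases h : ∃ j, A i j ≠ 0
  · obtain ⟨j, hj⟩ := h
    have := Finset.single_le_sum (f := fun k => if A i k ≠ 0 then 1 else 0)
      (fun _ _ => Nat.zero_le _) (Finset.mem_univ j)
    simp only [hj, ne_eq, not_false_eq_true, if_true] at this
    refine le_trans ?_ (this.trans (Nat.le_add_left _ _))
    split_ifs <;> omega
  · push Not at h
    have h0 : A.mulVec u i = 0 := by
      rw [Matrix.mulVec, dotProduct]; exact Finset.sum_eq_zero fun j _ => by rw [h j, zero_mul]
    simp [h0, h]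

/-- The network with the input transformed by `x ↦ T x - u`. -/
noncomputable def Weights.precomp {d D : ℕ} (w : Weights d D) (T : Matrix (Fin d) (Fin d) ℝ)
    (u : Fin d → ℝ) : Weights d D :=
  { w with W₁ := w.W₁ * T, v₁ := w.v₁ + w.W₁.mulVec u }

theorem Weights.hidden_precomp {d D : ℕ} (w : Weights d D) (T : Matrix (Fin d) (Fin d) ℝ)
    (u x : Fin d → ℝ) (k : ℕ) : (w.precomp T u).hidden x k = w.hidden (T.mulVec x - u) k := by
  induction k with
  | zero =>
    simp only [hidden, precomp]
    rw [Matrix.mulVec_sub, Matrix.mulVec_mulVec, sub_sub, add_comm w.v₁]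
  | succ k ih => simp only [hidden, ih]; rfl

/-- Only the first layer changes: `W₁` becomes W₁ T and the shift gains W₁ u. The entries of the
former are at most dBτ, those of the latter at most B + dBτ, whence (d + 1)Bτ; the sparsity factor d
+ 2 is generous. -/
theorem hiddenLayer_precomp {d D k : ℕ} {w : Weights d D} {B τ B' : ℝ} (hB : 0 ≤ B)
    (hw : w.HiddenBounded k B) {T : Matrix (Fin d) (Fin d) ℝ} {u : Fin d → ℝ} (hτ : 1 ≤ τ)
    (hT : MatBound T τ) (hu : VecBound u τ) (hB' : (d + 1) * B * τ ≤ B') :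
    HiddenLayer (fun x => w.hidden (T.mulVec x - u) k) k ((d + 2) * w.hiddenNnz k) D B' := by
  have hBτ : B ≤ B * τ := le_mul_of_one_le_right hB hτ
  have hd : (0 : ℝ) ≤ d := Nat.cast_nonneg d
  have hBτd : 0 ≤ d * (B * τ) := by positivity
  refine ⟨w.precomp T u, id, Function.injective_id, ⟨fun i j => ?_, fun i => ?_, fun j hj => ?_⟩,
    ?_, fun x i => by rw [Weights.hidden_precomp]; rfl⟩
  · change |(w.W₁ * T) i j| ≤ B'
    rw [Matrix.mul_apply]
    refine (Finset.abs_sum_le_sum_abs _ _).trans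
      ((Finset.sum_le_card_nsmul _ _ (B * τ) fun k _ => ?_).trans ?_)
    · rw [abs_mul]; exact mul_le_mul (hw.1 i k) (hT k j) (abs_nonneg _) hB
    · simp only [Finset.card_univ, Fintype.card_fin, nsmul_eq_mul]; linarith
  · refine (abs_add_le _ _).trans ?_
    have h1 := hw.2.1 i
    have h2 := abs_mulVec_le hw.1 hB hu i
    linarith
  · have h := hw.2.2 j hj
    exact ⟨fun a b => (h.1 a b).trans (by linarith), fun a => (h.2 a).trans (by linarith)⟩
  · have h1 := nnzMat_mul_le w.W₁ T
    have h2 := nnzVec_add_mulVec_le w.v₁ w.W₁ u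
    simp only [Weights.hiddenNnz, Weights.precomp]
    set R := ∑ j ∈ Finset.range k, (nnzMat (w.W j) + nnzVec (w.v j))
    have h3 : (d + 2) * (nnzMat w.W₁ + nnzVec w.v₁ + R) = d * nnzMat w.W₁ + 2 * nnzMat w.W₁ +
      (d * nnzVec w.v₁ + 2 * nnzVec w.v₁) + (d * R + 2 * R) := by ring
    omega

/-- A network whose neurons are rescaled by `b` from each layer to the next. -/
theorem hiddenLayer_chain {d m : ℕ} {V : Matrix (Fin m) (Fin d) ℝ} {v : Fin m → ℝ} {b B : ℝ}
    (hb : 0 ≤ b) (hbB : b ≤ B) (hV : MatBound V B) (hv : VecBound v B) (k : ℕ) :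
    HiddenLayer (fun x i => b ^ k * max (V.mulVec x i - v i) 0) k (m * d + m + k * m) m B := by
  -- After the first layer all values are nonnegative, so the ReLU is inert and the diagonal layers
  -- multiply by b each time. The amplification b^k is exponential in the depth although no weight
  -- of these layers exceeds b.
  let w : Weights d m := ⟨V, v, fun _ => Matrix.diagonal fun _ => b, fun _ => 0, 0⟩
  have hB : 0 ≤ B := hb.trans hbB
  refine ⟨w, id, Function.injective_id, ⟨hV, hv, fun j _ => ⟨fun a c => ?_, fun a => ?_⟩⟩, ?_,
    fun x i => ?_⟩
  · simp only [w, Matrix.diagonal_apply]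
    split_ifs
    · rwa [abs_of_nonneg hb]
    · rwa [abs_zero]
  · simpa [w] using hB
  · simp only [Weights.hiddenNnz, w, nnzVec_zero, add_zero, Finset.sum_const, Finset.card_range,
      smul_eq_mul]
    have h1 := nnzMat_le V
    have h2 := nnzVec_le v
    have h3 := Nat.mul_le_mul_left k (nnzMat_diagonal_le fun _ : Fin m => b)
    omega
  · have : ∀ i, w.hidden x k i = b ^ k * max (V.mulVec x i - v i) 0 := by
      induction k with
      | zero => intro i; simp [Weights.hidden, relu, w]
      | succ k ih =>
        intro i
        simp only [Weights.hidden, relu, w, Matrix.mulVec_diagonal, Pi.sub_apply, Pi.zero_apply,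
          sub_zero]
        rw [ih i, max_eq_left (by positivity), pow_succ]
        ring
    exact this i

/-- Two networks side by side; the outputs are added. -/
noncomputable def Weights.par {d D D' : ℕ} (w : Weights d D) (w' : Weights d D') :
    Weights d (D + D') where
  W₁ := Matrix.of fun i j => Fin.append (fun i => w.W₁ i j) (fun i => w'.W₁ i j) i
  v₁ := Fin.append w.v₁ w'.v₁
  W k := Matrix.of (Fin.append (fun i => Fin.append (w.W k i) 0) (fun i => Fin.append 0 (w'.W k i)))
  v k := Fin.append (w.v k) (w'.v k)
  Wout := Matrix.of fun i => Fin.append (w.Wout i) (w'.Wout i)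

theorem Weights.hidden_par {d D D' : ℕ} (w : Weights d D) (w' : Weights d D') (x : Fin d → ℝ)
    (k : ℕ) : (w.par w').hidden x k = Fin.append (w.hidden x k) (w'.hidden x k) := by
  induction k with
  | zero =>
    funext i
    refine Fin.addCases (fun i => ?_) (fun i => ?_) i <;>
      simp [hidden, par, relu, Matrix.mulVec, dotProduct]
  | succ k ih =>
    funext i
    refine Fin.addCases (fun i => ?_) (fun i => ?_) i <;>
      simp only [hidden, ih] <;>
      simp [par, relu, Matrix.mulVec, dotProduct, Fin.sum_univ_add]

theorem Weights.eval_par {d D D' : ℕ} (w : Weights d D) (w' : Weights d D') (L : ℕ) :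
    (w.par w').eval L = w.eval L + w'.eval L := by
  funext x
  simp only [eval, hidden_par, Pi.add_apply]
  simp [par, Matrix.mulVec, dotProduct, Fin.sum_univ_add]

theorem Weights.par_matBound {d D D' : ℕ} {w : Weights d D} {w' : Weights d D'} {B : ℝ} :
    (MatBound w.W₁ B → MatBound w'.W₁ B → MatBound (w.par w').W₁ B) ∧
    (VecBound w.v₁ B → VecBound w'.v₁ B → VecBound (w.par w').v₁ B) ∧
    (∀ k, 0 ≤ B → MatBound (w.W k) B → MatBound (w'.W k) B → MatBound ((w.par w').W k) B) ∧
    (∀ k, VecBound (w.v k) B → VecBound (w'.v k) B → VecBound ((w.par w').v k) B) ∧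
    (MatBound w.Wout B → MatBound w'.Wout B → MatBound (w.par w').Wout B) := by
  refine ⟨fun h h' i j => ?_, fun h h' i => ?_, fun k h0 h h' i j => ?_, fun k h h' i => ?_,
    fun h h' i j => ?_⟩
  · refine Fin.addCases (fun i => ?_) (fun i => ?_) i
    · simpa [par] using h i j
    · simpa [par] using h' i j
  · refine Fin.addCases (fun i => ?_) (fun i => ?_) i
    · simpa [par] using h i
    · simpa [par] using h' i
  · refine Fin.addCases (fun i => ?_) (fun i => ?_) i <;>
      refine Fin.addCases (fun j => ?_) (fun j => ?_) j
    · simpa [par] using h i j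
    · simpa [par] using h0
    · simpa [par] using h0
    · simpa [par] using h' i j
  · refine Fin.addCases (fun i => ?_) (fun i => ?_) i
    · simpa [par] using h i
    · simpa [par] using h' i
  · refine Fin.addCases (fun j => ?_) (fun j => ?_) j
    · simpa [par] using h i j
    · simpa [par] using h' i j

theorem Weights.nnz_par {d D D' : ℕ} (w : Weights d D) (w' : Weights d D') :
    nnzMat (w.par w').W₁ = nnzMat w.W₁ + nnzMat w'.W₁ ∧
    nnzVec (w.par w').v₁ = nnzVec w.v₁ + nnzVec w'.v₁ ∧
    (∀ k, nnzMat ((w.par w').W k) = nnzMat (w.W k) + nnzMat (w'.W k)) ∧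
    (∀ k, nnzVec ((w.par w').v k) = nnzVec (w.v k) + nnzVec (w'.v k)) ∧
    nnzMat (w.par w').Wout = nnzMat w.Wout + nnzMat w'.Wout := by
  refine ⟨?_, ?_, fun k => ?_, fun k => ?_, ?_⟩ <;>
    simp [nnzMat_eq_sum, nnzVec_eq_sum, Fin.sum_univ_add, par]

theorem Weights.hiddenNnz_par {d D D' : ℕ} (w : Weights d D) (w' : Weights d D') (k : ℕ) :
    (w.par w').hiddenNnz k = w.hiddenNnz k + w'.hiddenNnz k := by
  obtain ⟨h1, h2, h3, h4, -⟩ := w.nnz_par w'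
  simp only [hiddenNnz, h1, h2, h3, h4, Finset.sum_add_distrib]
  ring

theorem Weights.nnz_eq_hiddenNnz {d D : ℕ} (w : Weights d D) (L : ℕ) :
    w.nnz L = w.hiddenNnz (L - 1) + nnzMat w.Wout := rfl

theorem HiddenLayer.par {d k S S' D D' : ℕ} {B : ℝ} {ι ι' : Type*} (hB : 0 ≤ B)
    {h : (Fin d → ℝ) → ι → ℝ} {h' : (Fin d → ℝ) → ι' → ℝ} (H : HiddenLayer h k S D B)
    (H' : HiddenLayer h' k S' D' B) :
    HiddenLayer (fun x => Sum.elim (h x) (h' x)) k (S + S') (D + D') B := by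
  obtain ⟨w, e, he, hw, hS, hx⟩ := H
  obtain ⟨w', e', he', hw', hS', hx'⟩ := H'
  obtain ⟨b1, b2, b3, b4, -⟩ := Weights.par_matBound (w := w) (w' := w') (B := B)
  refine ⟨w.par w', Sum.elim (fun i => Fin.castAdd D' (e i)) (fun i => Fin.natAdd D (e' i)), ?_,
    ⟨b1 hw.1 hw'.1, b2 hw.2.1 hw'.2.1, fun j hj => ⟨b3 j hB (hw.2.2 j hj).1 (hw'.2.2 j hj).1,
      b4 j (hw.2.2 j hj).2 (hw'.2.2 j hj).2⟩⟩, ?_, ?_⟩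
  · refine Function.Injective.sumElim ((Fin.castAdd_injective _ _).comp he)
      ((Fin.natAdd_injective _ _).comp he') fun a b hab => ?_
    have := congrArg Fin.val hab
    simp only [Fin.val_castAdd, Fin.val_natAdd] at this
    have := (e a).2
    omega
  · rw [Weights.hiddenNnz_par]; omega
  · rintro x (i | i)
    · simp [Weights.hidden_par, hx]
    · simp [Weights.hidden_par, hx']

theorem IsNet.add {d L S S' D D' : ℕ} {B : ℝ} (hB : 0 ≤ B) {f f' : (Fin d → ℝ) → ℝ}
    (H : IsNet f L S D B) (H' : IsNet f' L S' D' B) :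
    IsNet (f + f') L (S + S') (D + D') B := by
  obtain ⟨w, hw, hS, rfl⟩ := H
  obtain ⟨w', hw', hS', rfl⟩ := H'
  obtain ⟨b1, b2, b3, b4, b5⟩ := Weights.par_matBound (w := w) (w' := w') (B := B)
  refine ⟨w.par w', ⟨b1 hw.1 hw'.1, b2 hw.2.1 hw'.2.1, fun j hj =>
    ⟨b3 j hB (hw.2.2.1 j hj).1 (hw'.2.2.1 j hj).1, b4 j (hw.2.2.1 j hj).2 (hw'.2.2.1 j hj).2⟩,
    b5 hw.2.2.2 hw'.2.2.2⟩, ?_, (Weights.eval_par _ _ _).symm⟩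
  rw [Weights.nnz_eq_hiddenNnz, Weights.hiddenNnz_par, (w.nnz_par w').2.2.2.2]
  rw [Weights.nnz_eq_hiddenNnz] at hS hS'
  omega

theorem isNet_zero {d : ℕ} (L D : ℕ) {B : ℝ} (hB : 0 ≤ B) :
    IsNet (0 : (Fin d → ℝ) → ℝ) L 0 D B := by
  refine ⟨⟨0, 0, fun _ => 0, fun _ => 0, 0⟩, ⟨fun _ _ => by simpa using hB, fun _ => by
    simpa using hB, fun _ _ => ⟨fun _ _ => by simpa using hB, fun _ => by simpa using hB⟩,
    fun _ _ => by simpa using hB⟩, ?_, ?_⟩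
  · simp [Weights.nnz, nnzMat_zero, nnzVec_zero]
  · funext x; simp [Weights.eval]

theorem isNet_sum {d L S D : ℕ} {B : ℝ} (hB : 0 ≤ B) {ι : Type*} (T : Finset ι)
    {f : ι → (Fin d → ℝ) → ℝ} (h : ∀ i ∈ T, IsNet (f i) L S D B) :
    IsNet (∑ i ∈ T, f i) L (T.card * S) (T.card * D) B := by
  classical
  induction T using Finset.induction_on with
  | empty => simpa using isNet_zero L 0 hB
  | insert a T ha ih =>
    rw [Finset.sum_insert ha, Finset.card_insert_of_notMem ha, add_mul, one_mul, add_mul, one_mul,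
      add_comm _ S, add_comm _ D]
    exact (h a (Finset.mem_insert_self _ _)).add hB
      (ih fun i hi => h i (Finset.mem_insert_of_mem hi))

theorem IsNet.mono {d L S S' D : ℕ} {B : ℝ} {f : (Fin d → ℝ) → ℝ} (H : IsNet f L S D B)
    (hS : S ≤ S') : IsNet f L S' D B := by
  obtain ⟨w, hw, hwS, rfl⟩ := H
  exact ⟨w, hw, hwS.trans hS, rfl⟩

/-- Depth and weight bound have to match, but a network of smaller width is completed by a zero
network placed beside it. -/
theorem IsNet.mem_networks {d S D : ℕ} {s : NetSize d} {f : (Fin d → ℝ) → ℝ}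
    (H : IsNet f s.L S D s.B) (hS : S ≤ s.S) (hD : D ≤ s.D) : f ∈ networks s := by
  have hB : 0 ≤ s.B := by linarith [s.one_le_B]
  have h := H.add hB (isNet_zero s.L (s.D - D) hB)
  rw [add_zero, add_zero, Nat.add_sub_cancel' hD] at h
  obtain ⟨w, hw, hwS, hf⟩ := h
  exact ⟨w, hw, hwS.trans hS, hf⟩

theorem abs_extend_le {α β : Type*} {e : α → β} (he : Function.Injective e) {f : α → ℝ} {B : ℝ}
    (hB : 0 ≤ B) (hf : ∀ a, |f a| ≤ B) (b : β) : |Function.extend e f 0 b| ≤ B := by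
  by_cases h : ∃ a, e a = b
  · obtain ⟨a, rfl⟩ := h
    rw [he.extend_apply]; exact hf a
  · rw [Function.extend_apply' _ _ _ h]; simpa using hB

theorem sum_extend_mul {α β : Type*} [Fintype α] [Fintype β] {e : α → β}
    (he : Function.Injective e) (f : α → ℝ) (y : β → ℝ) :
    ∑ b, Function.extend e f 0 b * y b = ∑ a, f a * y (e a) := by
  refine (Fintype.sum_of_injective e he _ _ (fun b hb => ?_) fun a => ?_).symm
  · rw [Function.extend_apply' _ _ _ (by simpa using hb)]; simp
  · rw [he.extend_apply]

/-- One more layer on top of a hidden layer. -/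
theorem HiddenLayer.step {d k S D : ℕ} {B : ℝ} {ι κ : Type*} [Fintype ι] [Fintype κ] (hB : 0 ≤ B)
    {h : (Fin d → ℝ) → ι → ℝ} (H : HiddenLayer h k S D B) (V : κ → ι → ℝ)
    (hV : ∀ a i, |V a i| ≤ B) (hκ : Fintype.card κ ≤ D) :
    HiddenLayer (fun x a => max (∑ i, V a i * h x i) 0) (k + 1)
      (S + Fintype.card κ * Fintype.card ι) D B := by
  obtain ⟨w, e, he, hw, hS, hx⟩ := H
  obtain ⟨e', he'⟩ : ∃ e' : κ → Fin D, Function.Injective e' := by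
    obtain ⟨f⟩ := Function.Embedding.nonempty_of_card_le (α := κ) (β := Fin D) (by simpa using hκ)
    exact ⟨f, f.injective⟩
  -- The matrix `V` is placed at the rows `e'` and columns `e` and is zero elsewhere, so idle
  -- neurons add nothing to the sparsity.
  set M : Matrix (Fin D) (Fin D) ℝ :=
    Matrix.of fun a b => Function.extend e' (fun p => Function.extend e (V p) 0 b) 0 a with hM
  set w' : Weights d D :=
    { w with W := Function.update w.W k M, v := Function.update w.v k 0 } with hw'
  have hW : ∀ j < k, w'.W j = w.W j ∧ w'.v j = w.v j := fun j hj => by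
    simp [hw', Function.update_of_ne hj.ne]
  have hhid : ∀ x j, j ≤ k → w'.hidden x j = w.hidden x j := fun x j hj => by
    induction j with
    | zero => rfl
    | succ j ih => simp only [Weights.hidden, ih (by omega), hW j (by omega)]
  have hMb : ∀ a b, |M a b| ≤ B := fun a b =>
    abs_extend_le he' hB (fun p => abs_extend_le he hB (hV p) b) a
  refine ⟨w', e', he', ⟨hw.1, hw.2.1, fun j hj => ?_⟩, ?_, fun x a => ?_⟩
  · rcases Nat.lt_succ_iff_lt_or_eq.1 hj with hj | rfl
    · rw [(hW j hj).1, (hW j hj).2]; exact hw.2.2 j hj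
    · simp only [hw', Function.update_self]
      exact ⟨hMb, fun a => by simpa using hB⟩
  · have h1 : w'.hiddenNnz (k + 1) = w.hiddenNnz k + (nnzMat M + nnzVec (0 : Fin D → ℝ)) := by
      simp only [Weights.hiddenNnz, Finset.sum_range_succ]
      rw [Finset.sum_congr rfl fun j hj => by
        rw [(hW j (Finset.mem_range.1 hj)).1, (hW j (Finset.mem_range.1 hj)).2]]
      simp only [hw', Function.update_self]
      ring
    have h2 : nnzMat M ≤ Fintype.card κ * Fintype.card ι := by
      have h3 : {q : Fin D × Fin D | M q.1 q.2 ≠ 0} ⊆ Set.range (Prod.map e' e) := by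
        rintro ⟨a, b⟩ hab
        by_contra hne
        refine hab ?_
        simp only [hM, Matrix.of_apply]
        by_cases ha : ∃ p, e' p = a
        · obtain ⟨p, rfl⟩ := ha
          rw [he'.extend_apply, Function.extend_apply']
          · rfl
          · rintro ⟨i, rfl⟩; exact hne ⟨(p, i), rfl⟩
        · rw [Function.extend_apply' _ _ _ ha]; rfl
      refine (Set.ncard_le_ncard h3 (Set.toFinite _)).trans ?_
      rw [← Set.image_univ]
      refine (Set.ncard_image_le (Set.toFinite _)).trans ?_
      simp [Set.ncard_univ, Nat.card_eq_fintype_card]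
    rw [h1, nnzVec_zero]; omega
  · simp only [Weights.hidden, relu, hhid x k le_rfl, Pi.sub_apply]
    simp only [hw', Function.update_self, Pi.zero_apply, sub_zero, Matrix.mulVec, dotProduct, hM,
      Matrix.of_apply, he'.extend_apply, sum_extend_mul he, hx]

/-- Nonnegative hidden units can be passed on unchanged. -/
theorem HiddenLayer.pad {d k S D : ℕ} {B : ℝ} {ι : Type*} [Fintype ι] (hB : 1 ≤ B)
    {h : (Fin d → ℝ) → ι → ℝ} (H : HiddenLayer h k S D B) (hh : ∀ x i, 0 ≤ h x i)
    (hι : Fintype.card ι ≤ D) (r : ℕ) :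
    HiddenLayer h (k + r) (S + r * (Fintype.card ι * Fintype.card ι)) D B := by
  classical
  induction r with
  | zero => simpa using H
  | succ r ih =>
    have h1 := ih.step (by linarith) (fun a i => if a = i then 1 else 0)
      (fun a i => by split_ifs <;> simp <;> linarith) hι
    simp only [ite_mul, one_mul, zero_mul, Finset.sum_ite_eq, Finset.mem_univ, if_true,
      max_eq_left (hh _ _)] at h1
    rw [add_mul, one_mul, ← add_assoc, ← add_assoc]
    exact h1

theorem HiddenLayer.isNet {d k S D : ℕ} {B : ℝ} {ι : Type*} [Fintype ι] (hB : 0 ≤ B)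
    {h : (Fin d → ℝ) → ι → ℝ} (H : HiddenLayer h k S D B) (c : ι → ℝ) (hc : ∀ i, |c i| ≤ B) :
    IsNet (fun x => ∑ i, c i * h x i) (k + 1) (S + Fintype.card ι) D B := by
  obtain ⟨w, e, he, hw, hS, hx⟩ := H
  set M : Matrix (Fin 1) (Fin D) ℝ := Matrix.of fun _ => Function.extend e c 0 with hM
  set w' : Weights d D := { w with Wout := M } with hw'
  have hhid : ∀ x j, w'.hidden x j = w.hidden x j := fun x j => by
    induction j with
    | zero => rfl
    | succ j ih => simp only [Weights.hidden, ih]; rfl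
  refine ⟨w', ⟨hw.1, hw.2.1, hw.2.2, fun i j => abs_extend_le he hB hc j⟩, ?_, ?_⟩
  · have h1 : nnzMat M ≤ Fintype.card ι := by
      have h3 : {q : Fin 1 × Fin D | M q.1 q.2 ≠ 0} ⊆ Set.range fun i => ((0 : Fin 1), e i) := by
        rintro ⟨a, b⟩ hab
        by_contra hne
        refine hab ?_
        simp only [hM, Matrix.of_apply]
        rw [Function.extend_apply']
        · rfl
        · rintro ⟨i, rfl⟩
          exact hne ⟨i, by rw [Subsingleton.elim a 0]⟩
      refine (Set.ncard_le_ncard h3 (Set.toFinite _)).trans ?_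
      rw [← Set.image_univ]
      refine (Set.ncard_image_le (Set.toFinite _)).trans ?_
      simp [Set.ncard_univ, Nat.card_eq_fintype_card]
    have h2 : w'.nnz (k + 1) = w.hiddenNnz k + nnzMat M := rfl
    omega
  · funext x
    simp only [Weights.eval, Nat.add_sub_cancel, hhid]
    simp only [hw', hM, Matrix.mulVec, dotProduct, Matrix.of_apply, sum_extend_mul he, hx]

/-! ### Cutting a network off outside the cube -/

/-- A penalty that vanishes on `[η, 1 - η]^d` and is at least `η max(1, ‖y‖)` outside the cube. -/
def penalty {d : ℕ} (η : ℝ) (y : Fin d → ℝ) : ℝ :=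
  ∑ i, (max (η - y i) 0 + max (y i - (1 - η)) 0)

/-- The soft thresholding of `g` at the level `M · penalty η`. -/
def cutoff {d : ℕ} (g : (Fin d → ℝ) → ℝ) (M η : ℝ) (y : Fin d → ℝ) : ℝ :=
  max (g y - M * penalty η y) 0 - max (-g y - M * penalty η y) 0

theorem penalty_nonneg {d : ℕ} (η : ℝ) (y : Fin d → ℝ) : 0 ≤ penalty η y :=
  Finset.sum_nonneg fun _ _ => add_nonneg (le_max_right _ _) (le_max_right _ _)

theorem le_penalty {d : ℕ} (η : ℝ) (y : Fin d → ℝ) (i : Fin d) :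
    η - y i ≤ penalty η y ∧ y i - (1 - η) ≤ penalty η y := by
  have h := Finset.single_le_sum (f := fun i => max (η - y i) 0 + max (y i - (1 - η)) 0)
    (fun _ _ => add_nonneg (le_max_right _ _) (le_max_right _ _)) (Finset.mem_univ i)
  refine ⟨le_trans ?_ h, le_trans ?_ h⟩
  · linarith [le_max_left (η - y i) 0, le_max_right (y i - (1 - η)) 0]
  · linarith [le_max_right (η - y i) 0, le_max_left (y i - (1 - η)) 0]

theorem cutoff_eq_of_forall {d : ℕ} {g : (Fin d → ℝ) → ℝ} {M η : ℝ} {y : Fin d → ℝ}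
    (hy : ∀ i, η ≤ y i ∧ y i ≤ 1 - η) : cutoff g M η y = g y := by
  have h : penalty η y = 0 := Finset.sum_eq_zero fun i _ => by
    rw [max_eq_right (by linarith [(hy i).1]), max_eq_right (by linarith [(hy i).2]), add_zero]
  rw [cutoff, h, mul_zero, sub_zero, sub_zero]
  rcases le_total 0 (g y) with h | h
  · rw [max_eq_left h, max_eq_right (by linarith), sub_zero]
  · rw [max_eq_right h, max_eq_left (by linarith)]; ring

theorem cutoff_eq_zero {d : ℕ} {g : (Fin d → ℝ) → ℝ} {M η : ℝ} {y : Fin d → ℝ}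
    (h : |g y| ≤ M * penalty η y) : cutoff g M η y = 0 := by
  rw [abs_le] at h
  rw [cutoff, max_eq_right (by linarith), max_eq_right (by linarith), sub_zero]

/-- Soft thresholding moves a value towards zero without crossing it. -/
theorem abs_cutoff_sub_le {d : ℕ} {g : (Fin d → ℝ) → ℝ} {M η : ℝ} (hM : 0 ≤ M) (y : Fin d → ℝ) :
    |cutoff g M η y - g y| ≤ |g y| := by
  have h : 0 ≤ M * penalty η y := mul_nonneg hM (penalty_nonneg η y)
  rw [cutoff]
  rcases le_total 0 (g y) with h0 | h0
  · rw [max_eq_right (a := -g y - M * penalty η y) (by linarith), sub_zero,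
      abs_of_nonneg h0, abs_le]
    constructor
    · linarith [le_max_right (g y - M * penalty η y) 0]
    · linarith [max_le (by linarith : g y - M * penalty η y ≤ g y) h0]
  · rw [max_eq_right (a := g y - M * penalty η y) (by linarith), abs_of_nonpos h0, abs_le]
    constructor
    · linarith [max_le (by linarith : -g y - M * penalty η y ≤ -g y) (by linarith : 0 ≤ -g y)]
    · linarith [le_max_right (-g y - M * penalty η y) 0]

/-- Outside the cube the penalty dominates functions of linear growth. -/
theorem cutoff_eq_zero_of_notMem {d : ℕ} {g : (Fin d → ℝ) → ℝ} {M η G : ℝ} (hM : 0 ≤ M)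
    (hη1 : η ≤ 1) (hMG : G ≤ M * η)
    (hg : ∀ (y : Fin d → ℝ) (m : ℝ), 1 ≤ m → (∀ i, |y i| ≤ m) → |g y| ≤ G * m)
    {y : Fin d → ℝ} (hy : y ∉ cube d) : cutoff g M η y = 0 := by
  refine cutoff_eq_zero ?_
  have key : ∀ m, 1 ≤ m → (∀ i, |y i| ≤ m) → η * m ≤ penalty η y →
      |g y| ≤ M * penalty η y := fun m hm hym hp => by
    have hm0 : 0 ≤ m := by linarith
    calc |g y| ≤ G * m := hg y m hm hym
      _ ≤ M * η * m := mul_le_mul_of_nonneg_right hMG hm0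
      _ = M * (η * m) := by ring
      _ ≤ _ := mul_le_mul_of_nonneg_left hp hM
  -- If all coordinates are at most 1 in absolute value, a point outside the cube has a negative
  -- coordinate and the penalty is at least η. Otherwise m is the largest |y i| > 1, where the
  -- penalty is at least m - 1 + η ≥ η m because η ≤ 1.
  by_cases hy1 : ∀ i, |y i| ≤ 1
  · refine key 1 le_rfl hy1 ?_
    obtain ⟨i, hi⟩ : ∃ i, y i < 0 := by
      by_contra! hcon
      exact hy ⟨fun i => hcon i, fun i => (le_abs_self _).trans (hy1 i)⟩
    linarith [(le_penalty η y i).1]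
  · push Not at hy1
    obtain ⟨i₀, hi₀⟩ := hy1
    obtain ⟨i, -, hi⟩ := Finset.exists_max_image Finset.univ (fun i => |y i|)
      ⟨i₀, Finset.mem_univ _⟩
    have h1 : 1 < |y i| := hi₀.trans_le (hi i₀ (Finset.mem_univ _))
    refine key |y i| h1.le (fun j => hi j (Finset.mem_univ _)) ?_
    obtain ⟨p1, p2⟩ := le_penalty η y i
    rcases abs_cases (y i) with ⟨e, _⟩ | ⟨e, _⟩ <;> rw [e] at h1 ⊢
    · nlinarith
    · nlinarith

/-- The cut-off network, precomposed with an affine map, is a network. -/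
theorem isNet_cutoff {d : ℕ} (hd : 0 < d) {s : NetSize d} {g : (Fin d → ℝ) → ℝ}
    (hg : g ∈ networks s) {T : Matrix (Fin d) (Fin d) ℝ} {u : Fin d → ℝ} {τ b c η B : ℝ}
    (hτ : 1 ≤ τ) (hT : MatBound T τ) (hu : VecBound u τ) (hB : (d + 1) * s.B * τ ≤ B)
    (hb : 0 ≤ b) (hbB : b ≤ B) (hc : |c| ≤ B) (hη : 0 ≤ η) (hη1 : η ≤ 1) (r : ℕ) :
    IsNet (fun x => c * cutoff g (b ^ s.L) η (T.mulVec x - u)) (s.L + r + 1)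
      ((d + 2) * s.S + 2 * (d * d + d + s.L * d) + 2 * (s.D + 2 * d) + 4 * r + 2)
      (s.D + (d + d)) B := by
  obtain ⟨w, hwB, hwS, rfl⟩ := hg
  have hsB := s.one_le_B
  have hd1 : (1 : ℝ) ≤ d := by exact_mod_cast hd
  have hBτ : 1 ≤ s.B * τ := one_le_mul_of_one_le_of_one_le hsB hτ
  have hττ : τ ≤ s.B * τ := le_mul_of_one_le_left (by linarith) hsB
  have hBτ' : s.B ≤ s.B * τ := le_mul_of_one_le_right (by linarith) hτ
  -- Here d ≥ 1 is used. The room of 2Bτ is needed for the shifts η + u i and u i + (1 - η) of the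
  -- penalty units, which are at most 1 + τ.
  have hBB : s.B * τ + s.B * τ ≤ B := by nlinarith
  have hB0 : 0 ≤ B := by linarith
  obtain ⟨l, hl⟩ : ∃ l, s.L = l + 1 := ⟨s.L - 1, (Nat.sub_add_cancel s.L_pos).symm⟩
  rw [hl] at hwB hwS ⊢
  have hnnz : w.nnz (l + 1) = w.hiddenNnz l + nnzMat w.Wout := rfl
  have H1 : HiddenLayer (fun x => w.hidden (T.mulVec x - u) l) l ((d + 2) * w.hiddenNnz l) s.D B :=
    hiddenLayer_precomp (by linarith) ⟨hwB.1, hwB.2.1, hwB.2.2.1⟩ hτ hT hu hB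
  have H2 := hiddenLayer_chain (V := -T) (v := fun i => -(η + u i)) hb hbB
    (fun i j => by rw [Matrix.neg_apply, abs_neg]; exact (hT i j).trans (by linarith))
    (fun i => by
      have := abs_le.1 (hu i)
      rw [abs_neg, abs_le]; constructor <;> linarith) l
  have H3 := hiddenLayer_chain (V := T) (v := fun i => u i + (1 - η)) hb hbB
    (fun i j => (hT i j).trans (by linarith))
    (fun i => by
      have := abs_le.1 (hu i)
      rw [abs_le]; constructor <;> linarith) l
  -- One further layer forms both ± g minus the penalty and takes positive parts. Its weight -b
  -- supplies the last factor b, turning the b^l of the chains into b^L with L = l + 1. The two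
  -- nonnegative outputs are then passed on through r layers to reach a prescribed depth, and
  -- subtracted with weights c and -c.
  let V : Bool → Fin s.D ⊕ (Fin d ⊕ Fin d) → ℝ := fun a =>
    Sum.elim (fun j => (if a then 1 else -1) * w.Wout 0 j) fun _ => -b
  have hV : ∀ a i, |V a i| ≤ B := by
    rintro a (j | j)
    · simp only [V, Sum.elim_inl, abs_mul]
      have : |if a then (1 : ℝ) else -1| = 1 := by split_ifs <;> simp
      rw [this, one_mul]
      exact (hwB.2.2.2 0 j).trans (by linarith)
    · simpa [V, abs_of_nonneg hb] using hbB
  have hcard : Fintype.card Bool ≤ s.D + (d + d) := by rw [Fintype.card_bool]; omega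
  have H := (((H1.par hB0 (H2.par hB0 H3)).step hB0 V hV hcard).pad (by linarith)
    (fun _ _ => le_max_right _ _) hcard r).isNet hB0 (fun a => if a then c else -c)
    (fun a => by split_ifs <;> simpa using hc)
  have hS : (d + 2) * w.hiddenNnz l + (d * d + d + l * d + (d * d + d + l * d)) +
      Fintype.card Bool * Fintype.card (Fin s.D ⊕ (Fin d ⊕ Fin d)) +
      r * (Fintype.card Bool * Fintype.card Bool) + Fintype.card Bool ≤
      (d + 2) * s.S + 2 * (d * d + d + (l + 1) * d) + 2 * (s.D + 2 * d) + 4 * r + 2 := by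
    simp only [Fintype.card_bool, Fintype.card_sum, Fintype.card_fin]
    have h1 : (d + 2) * w.hiddenNnz l ≤ (d + 2) * s.S := Nat.mul_le_mul_left _ (by omega)
    have h2 : (l + 1) * d = l * d + d := by ring
    omega
  have H' := H.mono hS
  convert H' using 1
  funext x
  have hpen : ∀ y : Fin d → ℝ, b ^ (l + 1) * penalty η y =
      ∑ i, b * (b ^ l * max (η - y i) 0) + ∑ i, b * (b ^ l * max (y i - (1 - η)) 0) := fun y => by
    rw [penalty, Finset.mul_sum, ← Finset.sum_add_distrib]
    exact Finset.sum_congr rfl fun i _ => by ring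
  have he : ∀ y, w.eval (l + 1) y = ∑ j, w.Wout 0 j * w.hidden y l j := fun y => rfl
  rw [cutoff, hpen, he]
  have e1 : ∀ i, (-T).mulVec x i - -(η + u i) = η - (T.mulVec x - u) i := fun i => by
    rw [Matrix.neg_mulVec, Pi.neg_apply, Pi.sub_apply]; ring
  have e2 : ∀ i, T.mulVec x i - (u i + (1 - η)) = (T.mulVec x - u) i - (1 - η) := fun i => by
    rw [Pi.sub_apply]; ring
  simp only [Fintype.sum_bool, V, Fintype.sum_sum_type, Sum.elim_inl, Sum.elim_inr, if_true,
    Bool.false_eq_true, if_false, e1, e2, one_mul, neg_mul, Finset.sum_neg_distrib]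
  ring_nf

/-! ### Affine changes of variables -/

/-- The substitution has Jacobian |det T|, hence the factor |det T|^{-1/2} in L². Invertibility also
makes almost everywhere strong measurability survive the composition. -/
theorem eLpNorm_comp_affine {d : ℕ} {T : Matrix (Fin d) (Fin d) ℝ} (hT : T.det ≠ 0)
    (u : Fin d → ℝ) {f : (Fin d → ℝ) → ℝ} (hf : AEStronglyMeasurable f volume) :
    AEStronglyMeasurable (fun x => f (T.mulVec x - u)) volume ∧
    eLpNorm (fun x => f (T.mulVec x - u)) 2 volume =
      ENNReal.ofReal |T.det|⁻¹ ^ (1 / 2 : ℝ) * eLpNorm f 2 volume := by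
  have hmap := Real.map_matrix_volume_pi_eq_smul_volume_pi hT
  have hsub := measurePreserving_sub_right (volume : Measure (Fin d → ℝ)) u
  have hm : Measurable (Matrix.toLin' T) :=
    (Matrix.toLin' T).continuous_of_finiteDimensional.measurable
  set g : (Fin d → ℝ) → ℝ := f ∘ fun x => x - u with hg
  have hgm : AEStronglyMeasurable g volume := hf.comp_measurePreserving hsub
  have hgm' : AEStronglyMeasurable g (Measure.map (Matrix.toLin' T) volume) := by
    rw [hmap]; exact hgm.smul_measure _
  have he : (fun x => f (T.mulVec x - u)) = g ∘ Matrix.toLin' T := by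
    funext x; simp [hg]
  rw [he]
  refine ⟨hgm'.comp_measurable hm, ?_⟩
  rw [← eLpNorm_map_measure hgm' hm.aemeasurable, hmap,
    eLpNorm_smul_measure_of_ne_top (by norm_num), hg, eLpNorm_comp_measurePreserving hf hsub,
    smul_eq_mul, abs_inv]
  norm_num

theorem eLpNorm_cube_eq {d : ℕ} {f : (Fin d → ℝ) → ℝ} (hf : ∀ x, x ∉ cube d → f x = 0) :
    eLpNorm f 2 (cubeMeasure d) = eLpNorm f 2 volume :=
  eLpNorm_restrict_eq_of_support_subset fun x hx => by
    by_contra h; exact hx (hf x h)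

theorem aestronglyMeasurable_of_cube {d : ℕ} {f : (Fin d → ℝ) → ℝ}
    (hf : ∀ x, x ∉ cube d → f x = 0) (hm : AEStronglyMeasurable f (cubeMeasure d)) :
    AEStronglyMeasurable f volume := by
  have h : (cube d).indicator f = f := by
    rw [Set.indicator_eq_self]
    intro x hx
    by_contra h; exact hx (hf x h)
  rw [← h]
  exact (aestronglyMeasurable_indicator_iff measurableSet_Icc).2 hm

/-! ### Orthonormality of the tensor wavelets -/

theorem quasiMeasurePreserving_dilation {a : ℝ} (ha : a ≠ 0) (b : ℝ) :
    Measure.QuasiMeasurePreserving (fun x : ℝ => a * x - b) volume volume := by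
  have h1 : Measure.QuasiMeasurePreserving (fun x : ℝ => a * x) volume volume :=
    ⟨measurable_const_mul a, by
      rw [Real.map_volume_mul_left ha]; exact Measure.smul_absolutelyContinuous⟩
  exact (measurePreserving_sub_right volume b).quasiMeasurePreserving.comp h1

theorem IsWavelet₁.dilate_eq_zero {φ : ℝ → ℝ} (hφ : IsWavelet₁ φ) (I : DyadicIndex) {x : ℝ}
    (hx : x ∉ Set.Icc (0 : ℝ) 1) : dilate φ I x = 0 := by
  rw [dilate, hφ.eq_zero, mul_zero]
  rintro ⟨h1, h2⟩
  have h3 : ((I.2 : ℕ) : ℝ) + 1 ≤ 2 ^ I.1 := by exact_mod_cast I.2.2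
  have h4 : (0 : ℝ) < 2 ^ I.1 := by positivity
  have h5 : (0 : ℝ) ≤ (I.2 : ℕ) := Nat.cast_nonneg _
  refine hx ⟨?_, ?_⟩
  · by_contra! h
    nlinarith
  · by_contra! h
    nlinarith

theorem IsWavelet₁.memLp_dilate {φ : ℝ → ℝ} (hφ : IsWavelet₁ φ) (I : DyadicIndex) :
    MemLp (dilate φ I) 2 volume ∧ ∫ x in Set.Icc (0 : ℝ) 1, dilate φ I x ^ 2 = 1 := by
  have h2 : (2 : ℝ) ^ I.1 ≠ 0 := by positivity
  have hm : AEStronglyMeasurable (dilate φ I) volume :=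
    (hφ.memLp.aestronglyMeasurable.comp_quasiMeasurePreserving
      (quasiMeasurePreserving_dilation h2 _)).const_mul _
  have hc : ((2 : ℝ) ^ ((I.1 : ℝ) / 2)) ^ 2 = 2 ^ I.1 := by
    rw [← Real.rpow_natCast, ← Real.rpow_mul (by norm_num)]
    push_cast
    rw [div_mul_cancel₀ _ two_ne_zero, Real.rpow_natCast]
  have hsq : (fun x => dilate φ I x ^ 2) =
      fun x => 2 ^ I.1 * (fun y => φ (y - (I.2 : ℕ)) ^ 2) (2 ^ I.1 * x) := by
    funext x; simp only [dilate, mul_pow, hc]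
  have hint : Integrable (fun x => φ x ^ 2) volume := hφ.memLp.integrable_sq
  have hint' : Integrable (fun y => φ (y - (I.2 : ℕ)) ^ 2) volume := hint.comp_sub_right _
  have hi : Integrable (fun x => dilate φ I x ^ 2) volume := by
    rw [hsq]; exact (hint'.comp_mul_left' h2).const_mul _
  refine ⟨(memLp_two_iff_integrable_sq hm).2 hi, ?_⟩
  rw [setIntegral_eq_integral_of_forall_compl_eq_zero fun x hx => by
    rw [hφ.dilate_eq_zero I hx]; ring]
  rw [hsq, integral_const_mul,
    Measure.integral_comp_mul_left (fun y => φ (y - (I.2 : ℕ)) ^ 2), abs_of_pos (by positivity),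
    smul_eq_mul, mul_inv_cancel_left₀ h2, integral_sub_right_eq_self (fun y => φ y ^ 2)]
  rw [← hφ.norm_one, setIntegral_eq_integral_of_forall_compl_eq_zero fun x hx => by
    rw [hφ.eq_zero x hx]; ring]

theorem IsTensor.tensorDilate_eq_zero {d : ℕ} {ψ : (Fin d → ℝ) → ℝ} {w : Fin d → ℝ → ℝ}
    (h : IsTensor ψ w) (I : Fin d → DyadicIndex) {x : Fin d → ℝ} (hx : x ∉ cube d) :
    tensorDilate w I x = 0 := by
  obtain ⟨i, hi⟩ : ∃ i, x i ∉ Set.Icc (0 : ℝ) 1 := by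
    by_contra! hcon
    exact hx ⟨fun i => (hcon i).1, fun i => (hcon i).2⟩
  exact Finset.prod_eq_zero (Finset.mem_univ i) ((h.1 i).dilate_eq_zero _ hi)

theorem IsTensor.integral_tensorDilate {d : ℕ} {ψ : (Fin d → ℝ) → ℝ} {w : Fin d → ℝ → ℝ}
    (h : IsTensor ψ w) (I J : Fin d → DyadicIndex) [Decidable (I = J)] :
    ∫ x, tensorDilate w I x * tensorDilate w J x ∂cubeMeasure d = if I = J then 1 else 0 := by
  simp only [tensorDilate, ← Finset.prod_mul_distrib]
  rw [cubeMeasure_eq_pi,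
    integral_fintype_prod_eq_prod (fun i t => dilate (w i) (I i) t * dilate (w i) (J i) t)]
  split_ifs with hIJ
  · subst hIJ
    refine Finset.prod_eq_one fun i _ => ?_
    refine Eq.trans ?_ ((h.1 i).memLp_dilate (I i)).2
    exact integral_congr_ae (ae_of_all _ fun x => (sq (dilate (w i) (I i) x)).symm)
  · obtain ⟨i, hi⟩ := Function.ne_iff.1 hIJ
    exact Finset.prod_eq_zero (Finset.mem_univ i) ((h.1 i).orthogonal _ _ hi)

theorem IsTensor.memLp_tensorDilate {d : ℕ} {ψ : (Fin d → ℝ) → ℝ} {w : Fin d → ℝ → ℝ}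
    (h : IsTensor ψ w) (I : Fin d → DyadicIndex) : MemLp (tensorDilate w I) 2 (cubeMeasure d) := by
  have hm : AEStronglyMeasurable (tensorDilate w I) (cubeMeasure d) := by
    refine Finset.aestronglyMeasurable_fun_prod _ fun i _ => ?_
    rw [cubeMeasure_eq_pi]
    have h1 := (((h.1 i).memLp_dilate (I i)).1.aestronglyMeasurable).restrict (s := Set.Icc 0 1)
    exact h1.comp_measurePreserving (measurePreserving_eval
      (fun _ : Fin d => (volume : Measure ℝ).restrict (Set.Icc 0 1)) i)
  rw [memLp_two_iff_integrable_sq hm, cubeMeasure_eq_pi]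
  simp only [tensorDilate, ← Finset.prod_pow]
  exact Integrable.fintype_prod (f := fun i t => dilate (w i) (I i) t ^ 2) fun i =>
    ((h.1 i).memLp_dilate (I i)).1.integrable_sq.restrict

/-- Parseval's identity for finite sums, from expanding the square and orthonormality. -/
theorem IsTensor.eLpNorm_sum_sq {d : ℕ} {ψ : (Fin d → ℝ) → ℝ} {w : Fin d → ℝ → ℝ}
    (h : IsTensor ψ w) (T : Finset (Fin d → DyadicIndex)) (a : (Fin d → DyadicIndex) → ℝ) :
    eLpNorm (fun x => ∑ I ∈ T, a I * tensorDilate w I x) 2 (cubeMeasure d) ^ 2 =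
      ENNReal.ofReal (∑ I ∈ T, a I ^ 2) := by
  classical
  have hL : MemLp (fun x => ∑ I ∈ T, a I * tensorDilate w I x) 2 (cubeMeasure d) :=
    memLp_finsetSum _ fun I _ => (h.memLp_tensorDilate I).const_mul _
  rw [sq_eLpNorm_two, ← ofReal_integral_eq_lintegral_ofReal hL.integrable_sq
    (ae_of_all _ fun x => sq_nonneg _)]
  congr 1
  have hi : ∀ I J, Integrable (fun x => a I * a J * (tensorDilate w I x * tensorDilate w J x))
      (cubeMeasure d) := fun I J =>
    ((h.memLp_tensorDilate I).integrable_mul (h.memLp_tensorDilate J)).const_mul _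
  have he : ∀ x, (∑ I ∈ T, a I * tensorDilate w I x) ^ 2 =
      ∑ I ∈ T, ∑ J ∈ T, a I * a J * (tensorDilate w I x * tensorDilate w J x) := fun x => by
    rw [sq, Finset.sum_mul_sum]
    exact Finset.sum_congr rfl fun I _ => Finset.sum_congr rfl fun J _ => by ring
  simp_rw [he]
  rw [integral_finsetSum _ fun I _ => integrable_finsetSum _ fun J _ => hi I J]
  refine Finset.sum_congr rfl fun I hI => ?_
  rw [integral_finsetSum _ fun J _ => hi I J]
  simp_rw [integral_const_mul, h.integral_tensorDilate]
  simp [hI, sq]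

/-- Dilates of a tensor wavelet are affine images of it. -/
theorem IsTensor.tensorDilate_eq {d : ℕ} {ψ : (Fin d → ℝ) → ℝ} {w : Fin d → ℝ → ℝ}
    (h : IsTensor ψ w) (I : Fin d → DyadicIndex) (x : Fin d → ℝ) :
    tensorDilate w I x = (∏ i, (2 : ℝ) ^ (((I i).1 : ℝ) / 2)) *
      ψ ((Matrix.diagonal fun i => (2 : ℝ) ^ (I i).1).mulVec x - fun i => (((I i).2 : ℕ) : ℝ)) := by
  rw [h.2, tensorDilate]
  simp only [dilate, Finset.prod_mul_distrib, Pi.sub_apply, Matrix.mulVec_diagonal]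

/-- Truncating a wavelet series costs the `ℓ²` norm of the omitted coefficients. -/
theorem IsTensor.eLpNorm_sub_sum_sq_le {d : ℕ} {ψ : (Fin d → ℝ) → ℝ} {w : Fin d → ℝ → ℝ}
    (h : IsTensor ψ w) {f : (Fin d → ℝ) → ℝ} (hf : MemLp f 2 (cubeMeasure d))
    {a : (Fin d → DyadicIndex) → ℝ}
    (hlim : Tendsto (fun T : Finset (Fin d → DyadicIndex) =>
      eLpNorm (fun x => f x - ∑ I ∈ T, a I * tensorDilate w I x) 2 (cubeMeasure d)) atTop (𝓝 0))
    (A : Finset (Fin d → DyadicIndex)) :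
    eLpNorm (fun x => f x - ∑ I ∈ A, a I * tensorDilate w I x) 2 (cubeMeasure d) ^ 2 ≤
      ∑' I : {I // I ∉ A}, ENNReal.ofReal (a I ^ 2) := by
  classical
  set R := ∑' I : {I // I ∉ A}, ENNReal.ofReal (a I ^ 2) with hR
  have hsum : ∀ T : Finset (Fin d → DyadicIndex),
      MemLp (fun x => ∑ I ∈ T, a I * tensorDilate w I x) 2 (cubeMeasure d) := fun T =>
    memLp_finsetSum _ fun I _ => (h.memLp_tensorDilate I).const_mul _
  -- For T ⊇ A, the triangle inequality separates the error of the sum over T, which tends to zero,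
  -- from the block over T \ A, whose norm is at most that of the omitted coefficients.
  have hpart : ∀ T : Finset (Fin d → DyadicIndex), A ⊆ T →
      eLpNorm (fun x => f x - ∑ I ∈ A, a I * tensorDilate w I x) 2 (cubeMeasure d) ≤
      eLpNorm (fun x => f x - ∑ I ∈ T, a I * tensorDilate w I x) 2 (cubeMeasure d) +
        R ^ (1 / 2 : ℝ) := fun T hT => by
    have he : (fun x => f x - ∑ I ∈ A, a I * tensorDilate w I x) =
        (fun x => f x - ∑ I ∈ T, a I * tensorDilate w I x) +
          fun x => ∑ I ∈ T \ A, a I * tensorDilate w I x := by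
      funext x
      simp only [Pi.add_apply]
      rw [← Finset.sum_sdiff hT]; ring
    rw [he]
    refine (eLpNorm_add_le (hf.sub (hsum T)).aestronglyMeasurable
      (hsum _).aestronglyMeasurable (by norm_num)).trans (add_le_add_right ?_ _)
    have h1 : eLpNorm (fun x => ∑ I ∈ T \ A, a I * tensorDilate w I x) 2 (cubeMeasure d) ^ 2 ≤
        R := by
      rw [h.eLpNorm_sum_sq, ENNReal.ofReal_sum_of_nonneg fun _ _ => sq_nonneg _, hR]
      have h2 : ∑ I ∈ T \ A, ENNReal.ofReal (a I ^ 2) = ∑ I ∈ (T \ A).subtype (· ∉ A),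
          ENNReal.ofReal (a (I : Fin d → DyadicIndex) ^ 2) := by
        rw [Finset.sum_subtype_of_mem (fun I => ENNReal.ofReal (a I ^ 2))
          fun I hI => (Finset.mem_sdiff.1 hI).2]
      rw [h2]
      exact ENNReal.sum_le_tsum _
    rw [one_div, ENNReal.le_rpow_inv_iff (by norm_num)]
    exact_mod_cast h1
  have hlim' : Tendsto (fun T : Finset (Fin d → DyadicIndex) =>
      eLpNorm (fun x => f x - ∑ I ∈ T, a I * tensorDilate w I x) 2 (cubeMeasure d) +
        R ^ (1 / 2 : ℝ)) atTop (𝓝 (R ^ (1 / 2 : ℝ))) := by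
    simpa using hlim.add_const (R ^ (1 / 2 : ℝ))
  have hle := ge_of_tendsto hlim' ((eventually_ge_atTop A).mono hpart)
  rw [one_div, ENNReal.le_rpow_inv_iff (by norm_num)] at hle
  exact_mod_cast hle

/-! ### Sparse approximation of families in weak `ℓ^p` -/

/-- If more than i terms exceed t, then no threshold below t leaves at most i terms above it, so the
(i + 1)-th largest term is at least t and (i + 1)^{1/p} t ≤ C. -/
theorem succ_le_of_weakNorm_le {ι : Type*} {p C : ℝ} (hp : 0 < p) {a : ι → ℝ}
    (h : weakNorm p a ≤ ENNReal.ofReal C) {t : ℝ} (ht : 0 < t) {i : ℕ}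
    (hi : (i : ℕ∞) < {j | t < |a j|}.encard) : (i : ℝ) + 1 ≤ (C / t) ^ p := by
  have h1 : ENNReal.ofReal t ≤ rearrangement a i := by
    refine le_iInf fun ⟨t', ht'⟩ => ?_
    rw [ENNReal.ofReal, ENNReal.coe_le_coe]
    by_contra! hlt
    refine absurd (hi.trans_le ((Set.encard_le_encard fun j hj => ?_).trans ht')) (lt_irrefl _)
    refine hlt.trans ?_
    rw [Set.mem_ofPred_eq] at hj
    rw [Real.toNNReal_lt_iff_lt_coe ht.le]
    simpa using hj
  have h2 : ENNReal.ofReal (((i : ℝ) + 1) ^ (1 / p) * t) ≤ ENNReal.ofReal C := by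
    refine le_trans ?_ ((le_iSup (fun i : ℕ => ((i : ℝ≥0∞) + 1) ^ (1 / p) * rearrangement a i)
      i).trans h)
    rw [ENNReal.ofReal_mul (by positivity), ← ENNReal.ofReal_rpow_of_nonneg (by positivity)
      (by positivity), ENNReal.ofReal_add (by positivity) zero_le_one, ENNReal.ofReal_natCast,
      ENNReal.ofReal_one]
    gcongr
  have hpos : 0 < ((i : ℝ) + 1) ^ (1 / p) * t := by positivity
  have h3 : ((i : ℝ) + 1) ^ (1 / p) * t ≤ C := by
    rcases ENNReal.ofReal_le_ofReal_iff'.1 h2 with h | h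
    · exact h
    · linarith
  rw [← le_div_iff₀ ht] at h3
  calc (i : ℝ) + 1 = (((i : ℝ) + 1) ^ (1 / p)) ^ p := by
        rw [← Real.rpow_mul (by positivity), one_div_mul_cancel hp.ne', Real.rpow_one]
    _ ≤ _ := Real.rpow_le_rpow (by positivity) h3 hp.le

theorem finite_of_weakNorm_le {ι : Type*} {p C : ℝ} (hp : 0 < p) (hC : 0 ≤ C) {a : ι → ℝ}
    (h : weakNorm p a ≤ ENNReal.ofReal C) {t : ℝ} (ht : 0 < t) :
    {j | t < |a j|}.Finite ∧ ({j | t < |a j|}.ncard : ℝ) ≤ (C / t) ^ p := by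
  have hfin : {j | t < |a j|}.Finite := by
    by_contra hinf
    have htop := Set.encard_eq_top_iff.2 hinf
    obtain ⟨i, hi⟩ := exists_nat_gt ((C / t) ^ p)
    have := succ_le_of_weakNorm_le hp h ht (i := i) (by rw [htop]; exact ENat.natCast_lt_top i)
    linarith
  refine ⟨hfin, ?_⟩
  rcases Nat.eq_zero_or_pos ({j | t < |a j|}.ncard) with h0 | h0
  · rw [h0]; simp; positivity
  · obtain ⟨i, hi⟩ : ∃ i, {j | t < |a j|}.ncard = i + 1 := ⟨_, (Nat.sub_add_cancel h0).symm⟩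
    have h1 := succ_le_of_weakNorm_le hp h ht (i := i) (by
      rw [← hfin.cast_ncard_eq, hi]
      exact_mod_cast Nat.lt_succ_self i)
    rw [hi]; exact_mod_cast h1

theorem abs_le_of_weakNorm_le {ι : Type*} {p C : ℝ} (hp : 0 < p) (hC : 0 < C) {a : ι → ℝ}
    (h : weakNorm p a ≤ ENNReal.ofReal C) (j : ι) : |a j| ≤ C := by
  by_contra! hlt
  set t := |a j| with htdef
  -- The counting lemma asks for strict exceedance, so the level is taken midway between C and |a
  -- j|; one term above it gives 1 ≤ (C/level)^p < 1.
  have h1 := succ_le_of_weakNorm_le hp h (t := (C + t) / 2) (by linarith) (i := 0) (by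
    rw [Nat.cast_zero, Set.encard_pos]
    exact ⟨j, by rw [Set.mem_ofPred_eq]; linarith⟩)
  have h2 : (C / ((C + t) / 2)) ^ p < 1 :=
    Real.rpow_lt_one (by positivity) ((div_lt_one (by linarith)).2 (by linarith)) hp
  norm_num at h1
  linarith

/-- Dyadic slicing: the terms with t/2^{k+1} < |a j| ≤ t/2^k number at most (2^{k+1}C/t)^p and have
squares at most (t/2^k)². The resulting geometric series has ratio 2^{p-2}, which is where p < 2 is
used. -/
theorem tsum_sq_le_of_weakNorm_le {ι : Type*} {p C : ℝ} (hp : 0 < p) (hp2 : p < 2) (hC : 0 ≤ C)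
    {a : ι → ℝ} (h : weakNorm p a ≤ ENNReal.ofReal C) {t : ℝ} (ht : 0 < t) :
    ∑' j : {j | |a j| ≤ t}, ENNReal.ofReal (a j ^ 2) ≤
      ENNReal.ofReal ((2 * C) ^ p / (1 - 2 ^ (p - 2)) * t ^ (2 - p)) := by
  have hq0 : (0 : ℝ) < 2 ^ (p - 2) := by positivity
  have hq1 : (2 : ℝ) ^ (p - 2) < 1 :=
    Real.rpow_lt_one_of_one_lt_of_neg (by norm_num) (by linarith)
  set s : ℕ → ℝ := fun k => t / 2 ^ (k + 1) with hs
  have hs0 : ∀ k, 0 < s k := fun k => by positivity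
  have hpt : ∀ j : {j | |a j| ≤ t}, ENNReal.ofReal (a j ^ 2) ≤
      ∑' k : ℕ, ENNReal.ofReal ((2 * s k) ^ 2) * Set.indicator {j | s k < |a j|} 1 (j : ι) := by
    rintro ⟨j, hj⟩
    rw [Set.mem_ofPred_eq] at hj
    rcases eq_or_ne (a j) 0 with h0 | h0
    · simp [h0]
    · have hex : ∃ k, s k < |a j| := by
        obtain ⟨k, hk⟩ := exists_nat_gt (t / |a j|)
        refine ⟨k, ?_⟩
        rw [hs, div_lt_iff₀ (by positivity)]
        rw [div_lt_iff₀ (abs_pos.2 h0)] at hk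
        have h2 : (k : ℝ) ≤ 2 ^ (k + 1) := by
          have : k < 2 ^ k := Nat.lt_two_pow_self
          have h3 : (k : ℝ) < 2 ^ k := by exact_mod_cast this
          rw [pow_succ]; linarith [pow_pos (two_pos (α := ℝ)) k]
        nlinarith [abs_pos.2 h0]
      classical
      set k := Nat.find hex with hk
      have hk1 : s k < |a j| := Nat.find_spec hex
      have hk2 : |a j| ≤ 2 * s k := by
        rcases Nat.eq_zero_or_pos k with h1 | h1
        · rw [h1, hs]; simp only [zero_add, pow_one]; linarith
        · have h2 := Nat.find_min hex (m := k - 1) (by omega)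
          push Not at h2
          have h3 : 2 * s k = s (k - 1) := by
            obtain ⟨l, hl⟩ : ∃ l, k = l + 1 := ⟨k - 1, by omega⟩
            rw [hl]; simp only [hs, Nat.add_sub_cancel]; rw [pow_succ 2 (l + 1)]; field_simp
          rw [h3]; exact h2
      refine le_trans ?_ (ENNReal.le_tsum k)
      have h4 : j ∈ {j | s k < |a j|} := hk1
      simp only [Set.indicator_of_mem h4, Pi.one_apply, mul_one]
      refine ENNReal.ofReal_le_ofReal ?_
      rw [← sq_abs]
      exact pow_le_pow_left₀ (abs_nonneg _) hk2 2
  refine (ENNReal.tsum_le_tsum hpt).trans ?_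
  rw [ENNReal.tsum_comm]
  have hk : ∀ k, ∑' j : {j | |a j| ≤ t}, ENNReal.ofReal ((2 * s k) ^ 2) *
      Set.indicator {j | s k < |a j|} (1 : ι → ℝ≥0∞) (j : ι) ≤
      ENNReal.ofReal ((2 * C) ^ p * t ^ (2 - p) * (2 ^ (p - 2)) ^ k) := fun k => by
    obtain ⟨hf, hn⟩ := finite_of_weakNorm_le hp hC h (hs0 k)
    have h1 : ∑' j : {j | |a j| ≤ t}, Set.indicator {j | s k < |a j|} (1 : ι → ℝ≥0∞) (j : ι) ≤
        ENNReal.ofReal ((C / s k) ^ p) := by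
      refine (ENNReal.tsum_comp_le_tsum_of_injective Subtype.val_injective _).trans ?_
      rw [← tsum_subtype]
      have h2 := ENNReal.tsum_set_one {j | s k < |a j|}
      simp only [Pi.one_apply]
      rw [h2, ← hf.cast_ncard_eq]
      have h3 := ENNReal.ofReal_le_ofReal hn
      rw [ENNReal.ofReal_natCast] at h3
      exact_mod_cast h3
    rw [ENNReal.tsum_mul_left]
    refine (mul_le_mul_right h1 _).trans ?_
    rw [← ENNReal.ofReal_mul (sq_nonneg _)]
    refine ENNReal.ofReal_le_ofReal (le_of_eq ?_)
    have e1 : (2 * s k) = t * ((2 : ℝ) ^ k)⁻¹ := by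
      simp only [hs]; rw [pow_succ]; field_simp
    have e2 : C / s k = (2 * C) * 2 ^ k / t := by
      simp only [hs]; rw [pow_succ]; field_simp
    have e3 : t ^ (2 - p) = t ^ 2 / t ^ p := by
      rw [Real.rpow_sub ht, Real.rpow_two]
    have e4 : ((2 : ℝ) ^ (p - 2)) ^ k = ((2 : ℝ) ^ k) ^ p / ((2 : ℝ) ^ k) ^ 2 := by
      rw [← Real.rpow_natCast _ k, ← Real.rpow_natCast _ k, ← Real.rpow_mul (by norm_num),
        ← Real.rpow_mul (by norm_num), ← Real.rpow_two, ← Real.rpow_mul (by norm_num),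
        ← Real.rpow_sub (by norm_num)]
      congr 1; ring
    rw [e1, e2, e3, e4, Real.div_rpow (by positivity) ht.le, Real.mul_rpow (by positivity)
      (by positivity)]
    field_simp
  refine (ENNReal.tsum_le_tsum hk).trans ?_
  rw [← ENNReal.ofReal_tsum_of_nonneg (fun k => by positivity)
    ((summable_geometric_of_lt_one hq0.le hq1).mul_left _), tsum_mul_left,
    tsum_geometric_of_lt_one hq0.le hq1]
  refine ENNReal.ofReal_le_ofReal (le_of_eq ?_)
  rw [div_eq_mul_inv]; ring

/-- Sparse approximation of the functions of the class `𝒥^p_ψ(C₁, C₂, β)`. -/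
theorem exists_sparse_approx {d : ℕ} {ψ f : (Fin d → ℝ) → ℝ} {p C₁ C₂ β : ℝ} (hp : 0 < p)
    (hp2 : p < 2) (hC₁ : 0 < C₁) (hf : f ∈ classJ ψ p C₁ C₂ β) (m : ℕ) {t : ℝ} (ht : 0 < t) :
    ∃ (w : Fin d → ℝ → ℝ) (a : (Fin d → DyadicIndex) → ℝ) (A : Finset (Fin d → DyadicIndex)),
      IsTensor ψ w ∧ (A.card : ℝ) ≤ (C₁ / t) ^ p ∧
      (∀ I ∈ A, |a I| ≤ C₁ ∧ ∀ i, (I i).1 < m) ∧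
      eLpNorm (fun x => f x - ∑ I ∈ A, a I * tensorDilate w I x) 2 (cubeMeasure d) ^ 2 ≤
        ENNReal.ofReal (C₂ * 2 ^ (-β * m)) +
          ENNReal.ofReal ((2 * C₁) ^ p / (1 - 2 ^ (p - 2)) * t ^ (2 - p)) := by
  obtain ⟨-, hfL, w, hw, a, hweak, htail, hlim⟩ := hf
  obtain ⟨hfin, hcard⟩ := finite_of_weakNorm_le hp hC₁.le hweak ht
  -- The kept indices have a coefficient above t and all scales below m. An omitted index therefore
  -- lies in the scale tail or has a coefficient at most t, and the two error terms correspond to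
  -- these cases.
  have hfin' : {I | t < |a I| ∧ ∀ i, (I i).1 < m}.Finite := hfin.subset fun I hI => hI.1
  refine ⟨w, a, hfin'.toFinset, hw, ?_, fun I hI => ?_, ?_⟩
  · refine le_trans ?_ hcard
    rw [← Set.ncard_eq_toFinset_card _ hfin']
    have hsub : {I | t < |a I| ∧ ∀ i, (I i).1 < m} ⊆ {I | t < |a I|} := fun I hI => hI.1
    exact_mod_cast Set.ncard_le_ncard hsub hfin
  · rw [Set.Finite.mem_toFinset] at hI
    exact ⟨abs_le_of_weakNorm_le hp hC₁ hweak I, hI.2⟩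
  · refine (hw.eLpNorm_sub_sum_sq_le hfL hlim _).trans ?_
    have hsub : {I | I ∉ hfin'.toFinset} ⊆ tailIndices d m ∪ {I | |a I| ≤ t} := fun I hI => by
      rw [Set.mem_ofPred_eq, Set.Finite.mem_toFinset, Set.mem_ofPred_eq, not_and_or] at hI
      rcases hI with hI | hI
      · exact Or.inr (not_lt.1 hI)
      · push Not at hI; exact Or.inl hI
    refine (ENNReal.tsum_mono_subtype (fun I => ENNReal.ofReal (a I ^ 2)) hsub).trans ?_
    refine (ENNReal.tsum_union_le (fun I => ENNReal.ofReal (a I ^ 2)) _ _).trans ?_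
    exact add_le_add (htail m) (tsum_sq_le_of_weakNorm_le hp hp2 hC₁.le hweak ht)

theorem IsTensor.eq_zero {d : ℕ} {ψ : (Fin d → ℝ) → ℝ} {w : Fin d → ℝ → ℝ} (h : IsTensor ψ w)
    {x : Fin d → ℝ} (hx : x ∉ cube d) : ψ x = 0 := by
  obtain ⟨i, hi⟩ : ∃ i, x i ∉ Set.Icc (0 : ℝ) 1 := by
    by_contra! hcon
    exact hx ⟨fun i => (hcon i).1, fun i => (hcon i).2⟩
  rw [h.2]
  exact Finset.prod_eq_zero (Finset.mem_univ i) ((h.1 i).eq_zero _ hi)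

/-! ### Approximation of wavelets on the whole space -/

theorem cubeMeasure_boundary_le {d : ℕ} {η : ℝ} (hη : 0 ≤ η) :
    cubeMeasure d {y | ¬∀ i, η ≤ y i ∧ y i ≤ 1 - η} ≤ ENNReal.ofReal (2 * d * η) := by
  have hsub : {y : Fin d → ℝ | ¬∀ i, η ≤ y i ∧ y i ≤ 1 - η} ⊆
      ⋃ i, (Function.eval i ⁻¹' (Set.Iio η ∪ Set.Ioi (1 - η))) := fun y hy => by
    rw [Set.mem_ofPred_eq] at hy
    push Not at hy
    obtain ⟨i, hi⟩ := hy
    refine Set.mem_iUnion.2 ⟨i, ?_⟩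
    by_cases h : y i < η
    · exact Or.inl h
    · exact Or.inr (hi (not_lt.1 h))
  refine (measure_mono hsub).trans ((measure_iUnion_fintype_le _ _).trans ?_)
  have h1 : ∀ i : Fin d, cubeMeasure d (Function.eval i ⁻¹' (Set.Iio η ∪ Set.Ioi (1 - η))) ≤
      ENNReal.ofReal (2 * η) := fun i => by
    rw [cubeMeasure_eq_pi, (measurePreserving_eval
      (fun _ : Fin d => (volume : Measure ℝ).restrict (Set.Icc 0 1)) i).measure_preimage
      (measurableSet_Iio.union measurableSet_Ioi).nullMeasurableSet]
    refine (measure_union_le _ _).trans ?_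
    rw [Measure.restrict_apply measurableSet_Iio, Measure.restrict_apply measurableSet_Ioi, two_mul,
      ENNReal.ofReal_add hη hη]
    refine add_le_add ?_ ?_
    · refine (measure_mono (t := Set.Icc 0 η) fun x hx => ⟨hx.2.1, hx.1.le⟩).trans ?_
      rw [Real.volume_Icc, sub_zero]
    · refine (measure_mono (t := Set.Icc (1 - η) 1) fun x hx =>
        ⟨(Set.mem_Ioi.1 hx.1).le, hx.2.2⟩).trans ?_
      rw [Real.volume_Icc, sub_sub_cancel]
  refine (Finset.sum_le_sum fun i _ => h1 i).trans ?_
  rw [Finset.sum_const, Finset.card_univ, Fintype.card_fin, nsmul_eq_mul,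
    ← ENNReal.ofReal_natCast, ← ENNReal.ofReal_mul (Nat.cast_nonneg _)]
  exact ENNReal.ofReal_le_ofReal (by linarith)

theorem eLpNorm_two_le_of_sq_le {Ω : Type*} [MeasurableSpace Ω] {μ : Measure Ω} {f : Ω → ℝ}
    {c : ℝ} (hc : 0 ≤ c) (h : eLpNorm f 2 μ ^ 2 ≤ ENNReal.ofReal (c ^ 2)) :
    eLpNorm f 2 μ ≤ ENNReal.ofReal c := by
  rw [ENNReal.ofReal_pow hc] at h
  exact (ENNReal.pow_le_pow_left_iff two_ne_zero).1 h

theorem continuous_penalty {d : ℕ} (η : ℝ) : Continuous (penalty η : (Fin d → ℝ) → ℝ) := by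
  unfold penalty; fun_prop

theorem continuous_cutoff {d : ℕ} {g : (Fin d → ℝ) → ℝ} (hg : Continuous g) (M η : ℝ) :
    Continuous (cutoff g M η) := by
  have := continuous_penalty (d := d) η
  unfold cutoff; fun_prop

theorem continuous_of_mem_networks {d : ℕ} {s : NetSize d} {g : (Fin d → ℝ) → ℝ}
    (hg : g ∈ networks s) : Continuous g := by
  obtain ⟨w, -, -, rfl⟩ := hg
  exact w.continuous_eval _

/-- Let G = Q^{L+1} bound g on the cube. Inside the cube the cutoff changes g only in a boundary
layer of measure at most 2dη, by at most G, so η = ε²/(2dG²) makes this L² error at most ε. Outside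
the cube it vanishes once the amplified penalty satisfies M η ≥ G. Since M = b^L grows exponentially
with the depth just as G does, a base b polynomial in Q and 1/ε is enough. -/
theorem eLpNorm_cutoff_sub_le {d : ℕ} (hd : 0 < d) {s : NetSize d} {g ψ : (Fin d → ℝ) → ℝ}
    (hg : g ∈ networks s) (hψ : ∀ x, x ∉ cube d → ψ x = 0)
    (hψm : AEStronglyMeasurable ψ (cubeMeasure d)) {ε Q b : ℝ} (hε : 0 < ε) (hε1 : ε ≤ 1)
    (hgψ : eLpNorm (g - ψ) 2 (cubeMeasure d) ≤ ENNReal.ofReal ε) (hQ : s.B * (s.D + 1) ≤ Q)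
    (hb : 2 * d * Q ^ 6 / ε ^ 2 ≤ b) :
    ∃ η : ℝ, 0 ≤ η ∧ η ≤ 1 ∧
      eLpNorm (cutoff g (b ^ s.L) η - ψ) 2 volume ≤ ENNReal.ofReal (2 * ε) := by
  have hd1 : (1 : ℝ) ≤ d := by exact_mod_cast hd
  have hQ1 : 1 ≤ Q := by
    refine le_trans ?_ hQ
    have : (0 : ℝ) ≤ s.D := Nat.cast_nonneg _
    exact one_le_mul_of_one_le_of_one_le s.one_le_B (by linarith)
  set G : ℝ := Q ^ (s.L + 1) with hG
  have hG1 : 1 ≤ G := one_le_pow₀ hQ1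
  have hgG : ∀ (y : Fin d → ℝ) (m : ℝ), 1 ≤ m → (∀ i, |y i| ≤ m) → |g y| ≤ G * m := by
    obtain ⟨w, hw, -, rfl⟩ := hg
    intro y m hm hy
    refine (w.abs_eval_le s.L_pos s.le_D s.one_le_B hw hm hy).trans ?_
    have : 0 ≤ s.B * ((s.D : ℝ) + 1) := mul_nonneg (by linarith [s.one_le_B]) (by positivity)
    rw [hG]; gcongr
  set η : ℝ := ε ^ 2 / (2 * d * G ^ 2) with hη
  have hη0 : 0 < η := by positivity
  have hη1 : η ≤ 1 := by
    rw [hη, div_le_one (by positivity)]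
    have h1 : ε ^ 2 ≤ 1 := pow_le_one₀ hε.le hε1
    have h2 : 1 ≤ G ^ 2 := one_le_pow₀ hG1
    nlinarith
  have hb0 : 0 ≤ b := le_trans (by positivity) hb
  set M := b ^ s.L with hM
  have hM0 : 0 ≤ M := pow_nonneg hb0 _
  have hMG : G ≤ M * η := by
    -- The requirement M ≥ G/η is M ≥ G³ · 2d/ε². As L + 1 ≤ 2L, G³ ≤ Q^{6L}, which explains the
    -- sixth power of Q in the bound on b.
    have h1 : G ^ 3 * (2 * d / ε ^ 2) ≤ M := by
      have hx1 : 1 ≤ 2 * d / ε ^ 2 := by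
        rw [one_le_div (by positivity)]
        have h1 : ε ^ 2 ≤ 1 := pow_le_one₀ hε.le hε1
        linarith
      calc G ^ 3 * (2 * d / ε ^ 2) ≤ (Q ^ 6) ^ s.L * (2 * d / ε ^ 2) ^ s.L := by
            refine mul_le_mul ?_ (le_self_pow₀ hx1 s.L_pos.ne') (by positivity) (by positivity)
            rw [hG, ← pow_mul, ← pow_mul]
            exact pow_le_pow_right₀ hQ1 (by have := s.L_pos; omega)
        _ = (2 * d * Q ^ 6 / ε ^ 2) ^ s.L := by rw [← mul_pow]; congr 1; ring
        _ ≤ M := pow_le_pow_left₀ (by positivity) hb _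
    calc G = G ^ 3 * (2 * d / ε ^ 2) * η := by rw [hη]; field_simp
      _ ≤ M * η := mul_le_mul_of_nonneg_right h1 hη0.le
  refine ⟨η, hη0.le, hη1, ?_⟩
  have hgc := continuous_of_mem_networks hg
  have hhc := continuous_cutoff hgc M η
  have hzero : ∀ y, y ∉ cube d → (cutoff g M η - ψ) y = 0 := fun y hy => by
    rw [Pi.sub_apply, cutoff_eq_zero_of_notMem hM0 hη1 hMG hgG hy, hψ y hy, sub_zero]
  rw [← eLpNorm_cube_eq hzero, show cutoff g M η - ψ = (cutoff g M η - g) + (g - ψ) by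
    rw [sub_add_sub_cancel], two_mul, ENNReal.ofReal_add hε.le hε.le]
  refine (eLpNorm_add_le (hhc.sub hgc).aestronglyMeasurable
    (hgc.aestronglyMeasurable.sub hψm) (by norm_num)).trans (add_le_add ?_ hgψ)
  refine eLpNorm_two_le_of_sq_le hε.le ?_
  rw [sq_eLpNorm_two]
  set E : Set (Fin d → ℝ) := {y | ¬∀ i, η ≤ y i ∧ y i ≤ 1 - η} with hE
  have hEm : MeasurableSet E := by
    have h1 : MeasurableSet {y : Fin d → ℝ | ∀ i, η ≤ y i ∧ y i ≤ 1 - η} := by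
      have : {y : Fin d → ℝ | ∀ i, η ≤ y i ∧ y i ≤ 1 - η} =
          Set.Icc (fun _ => η) (fun _ => 1 - η) := by
        ext y; simp [Pi.le_def, forall_and]
      rw [this]; exact measurableSet_Icc
    exact h1.compl
  calc ∫⁻ y, ENNReal.ofReal ((cutoff g M η - g) y ^ 2) ∂cubeMeasure d
      ≤ ∫⁻ y, E.indicator (fun _ => ENNReal.ofReal (G ^ 2)) y ∂cubeMeasure d := by
        refine lintegral_mono_ae ?_
        filter_upwards [ae_mem_cube d] with y hy
        by_cases hyE : y ∈ E
        · rw [Set.indicator_of_mem hyE]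
          refine ENNReal.ofReal_le_ofReal ?_
          rw [← sq_abs, Pi.sub_apply]
          refine pow_le_pow_left₀ (abs_nonneg _) ((abs_cutoff_sub_le hM0 y).trans ?_) 2
          refine (hgG y 1 le_rfl fun i => ?_).trans_eq (mul_one _)
          rw [abs_of_nonneg (hy.1 i)]; exact hy.2 i
        · have h1 : ∀ i, η ≤ y i ∧ y i ≤ 1 - η := by simpa [hE] using hyE
          rw [Pi.sub_apply, cutoff_eq_of_forall h1]; simp
    _ = ENNReal.ofReal (G ^ 2) * cubeMeasure d E := lintegral_indicator_const hEm _
    _ ≤ ENNReal.ofReal (G ^ 2) * ENNReal.ofReal (2 * d * η) := by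
        gcongr; exact cubeMeasure_boundary_le hη0.le
    _ = ENNReal.ofReal (ε ^ 2) := by
        rw [← ENNReal.ofReal_mul (sq_nonneg _)]
        congr 1
        rw [hη]; field_simp

/-! ### Approximation of the classes by networks -/

/-- The factor c is |det T|^{1/2}, so dilation is an isometry of L² of the whole space. The norm
over the cube would not do: the dilated error also picks up values of h - ψ outside the cube. -/
theorem eLpNorm_dilate_sub {d : ℕ} {ψ h : (Fin d → ℝ) → ℝ} {w : Fin d → ℝ → ℝ}
    (hw : IsTensor ψ w) (hm : AEStronglyMeasurable (h - ψ) volume) (I : Fin d → DyadicIndex) :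
    AEStronglyMeasurable (fun x => tensorDilate w I x - (∏ i, (2 : ℝ) ^ (((I i).1 : ℝ) / 2)) *
      h ((Matrix.diagonal fun i => (2 : ℝ) ^ (I i).1).mulVec x - fun i => (((I i).2 : ℕ) : ℝ)))
      volume ∧
    eLpNorm (fun x => tensorDilate w I x - (∏ i, (2 : ℝ) ^ (((I i).1 : ℝ) / 2)) *
      h ((Matrix.diagonal fun i => (2 : ℝ) ^ (I i).1).mulVec x - fun i => (((I i).2 : ℕ) : ℝ))) 2
      volume = eLpNorm (h - ψ) 2 volume := by
  set c : ℝ := ∏ i, (2 : ℝ) ^ (((I i).1 : ℝ) / 2) with hc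
  set T : Matrix (Fin d) (Fin d) ℝ := Matrix.diagonal fun i => (2 : ℝ) ^ (I i).1 with hT
  have hc0 : 0 < c := Finset.prod_pos fun i _ => by positivity
  have hdet : T.det = c ^ 2 := by
    rw [hT, Matrix.det_diagonal, hc, ← Finset.prod_pow]
    refine Finset.prod_congr rfl fun i _ => ?_
    rw [← Real.rpow_natCast (2 ^ _) 2, ← Real.rpow_mul (by norm_num)]
    push_cast
    rw [div_mul_cancel₀ _ two_ne_zero, Real.rpow_natCast]
  have hdet0 : T.det ≠ 0 := by rw [hdet]; positivity
  obtain ⟨h1, h2⟩ := eLpNorm_comp_affine hdet0 (fun i => (((I i).2 : ℕ) : ℝ)) hm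
  have he : (fun x => tensorDilate w I x - c * h (T.mulVec x - fun i => (((I i).2 : ℕ) : ℝ))) =
      (-c) • fun x => (h - ψ) (T.mulVec x - fun i => (((I i).2 : ℕ) : ℝ)) := by
    funext x
    rw [hw.tensorDilate_eq I x]
    simp only [Pi.smul_apply, Pi.sub_apply, smul_eq_mul]
    ring
  rw [he]
  refine ⟨h1.const_smul _, ?_⟩
  rw [eLpNorm_const_smul, h2, ← mul_assoc]
  have h3 : ‖-c‖ₑ * ENNReal.ofReal |T.det|⁻¹ ^ (1 / 2 : ℝ) = 1 := by
    rw [enorm_neg, Real.enorm_eq_ofReal hc0.le, hdet, abs_of_pos (by positivity),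
      ENNReal.ofReal_rpow_of_nonneg (by positivity) (by norm_num),
      ← ENNReal.ofReal_mul hc0.le, ← Real.sqrt_eq_rpow, Real.sqrt_inv, Real.sqrt_sq hc0.le,
      mul_inv_cancel₀ hc0.ne', ENNReal.ofReal_one]
  rw [h3, one_mul]

theorem IsNet.mono_width {d L S D D' : ℕ} {B : ℝ} (hB : 0 ≤ B) {f : (Fin d → ℝ) → ℝ}
    (H : IsNet f L S D B) (hD : D ≤ D') : IsNet f L S D' B := by
  have h := H.add hB (isNet_zero L (D' - D) hB)
  rwa [add_zero, add_zero, Nat.add_sub_cancel' hD] at h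

/-- The kept coefficients, at most N in number, are multiplied by dilates of one cut-off network,
each with error 2ε. Error and measurability are stated on the whole space, and the network property
for φ composed with any bounded affine map, because the class 𝒦 composes with such maps; both affine
maps are merged into the first layer. -/
theorem exists_net_approx_classJ {d : ℕ} (hd : 0 < d) {ψ f : (Fin d → ℝ) → ℝ}
    {p C₁ C₂ C₃ β : ℝ} (hp : 0 < p) (hp2 : p < 2) (hC₁ : 0 < C₁) (hC₂ : 0 ≤ C₂)
    (hC₃ : 0 < C₃) (hf : f ∈ classJ ψ p C₁ C₂ β) (m : ℕ) {t : ℝ} (ht : 0 < t)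
    {N l : ℕ} (hN : (C₁ / t) ^ p < N + 1) {ε Bg Q b B : ℝ} (hε : 0 < ε) (hε1 : ε ≤ 1)
    {s : NetSize d} {g : (Fin d → ℝ) → ℝ} (hg : g ∈ networks s)
    (hgψ : eLpNorm (g - ψ) 2 (cubeMeasure d) ≤ ENNReal.ofReal ε)
    (hψm : AEStronglyMeasurable ψ (cubeMeasure d))
    (hsL : s.L ≤ l) (hsS : s.S ≤ l) (hsD : s.D ≤ l) (hsB : s.B ≤ Bg)
    (hQ : Bg * (l + 1) ≤ Q) (hb : 2 * d * Q ^ 6 / ε ^ 2 ≤ b) (hbB : b ≤ B)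
    (hB : (d + 1) * Bg * (2 ^ m * (C₃ + 1)) ≤ B) (hB' : C₁ * 2 ^ (m * d) ≤ B) :
    ∃ φ : (Fin d → ℝ) → ℝ, AEStronglyMeasurable (f - φ) volume ∧
      eLpNorm (f - φ) 2 volume ≤ ENNReal.ofReal (C₂ * 2 ^ (-β * m) +
        (2 * C₁) ^ p / (1 - 2 ^ (p - 2)) * t ^ (2 - p)) ^ (1 / 2 : ℝ) +
          ENNReal.ofReal (N * (C₁ * (2 * ε))) ∧
      ∀ (A : Matrix (Fin d) (Fin d) ℝ) (v : Fin d → ℝ), MatBound A C₃ → VecBound v C₃ →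
        IsNet (fun x => φ (A.mulVec x - v)) (l + 1)
          (N * ((d + 2) * l + 2 * (d * d + d + l * d) + 2 * (l + 2 * d) + 4 * l + 2))
          (N * (l + 2 * d)) B := by
  obtain ⟨w, a, Λ, hw, hcard, hΛ, happ⟩ := exists_sparse_approx hp hp2 hC₁ hf m ht
  have hcardN : Λ.card ≤ N := by
    have : (Λ.card : ℝ) < N + 1 := hcard.trans_lt hN
    exact Nat.lt_succ_iff.1 (by exact_mod_cast this)
  have hBg1 : 1 ≤ Bg := s.one_le_B.trans hsB
  have hQs : s.B * (s.D + 1) ≤ Q := by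
    refine le_trans ?_ hQ
    have : (s.D : ℝ) ≤ l := by exact_mod_cast hsD
    gcongr
  have hQ1 : 0 ≤ Q := le_trans (by positivity) hQ
  have hb0 : 0 ≤ b := le_trans (by positivity) hb
  have hψ0 : ∀ x, x ∉ cube d → ψ x = 0 := fun x hx => hw.eq_zero hx
  obtain ⟨η, hη0, hη1, hcut⟩ := eLpNorm_cutoff_sub_le hd hg hψ0 hψm hε hε1 hgψ hQs hb
  set h := cutoff g (b ^ s.L) η with hh
  have hhc : Continuous h := continuous_cutoff (continuous_of_mem_networks hg) _ _
  have hψv : AEStronglyMeasurable ψ volume := aestronglyMeasurable_of_cube hψ0 hψm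
  have hhψ : AEStronglyMeasurable (h - ψ) volume := hhc.aestronglyMeasurable.sub hψv
  set c : (Fin d → DyadicIndex) → ℝ := fun I => ∏ i, (2 : ℝ) ^ (((I i).1 : ℝ) / 2) with hc
  set T : (Fin d → DyadicIndex) → Matrix (Fin d) (Fin d) ℝ :=
    fun I => Matrix.diagonal fun i => (2 : ℝ) ^ (I i).1 with hT
  set u : (Fin d → DyadicIndex) → Fin d → ℝ := fun I i => (((I i).2 : ℕ) : ℝ) with hu
  refine ⟨fun x => ∑ I ∈ Λ, a I * (c I * h ((T I).mulVec x - u I)), ?_⟩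
  have hsplit : (f - fun x => ∑ I ∈ Λ, a I * (c I * h ((T I).mulVec x - u I))) =
      (fun x => f x - ∑ I ∈ Λ, a I * tensorDilate w I x) +
      ∑ I ∈ Λ, a I • fun x => tensorDilate w I x - c I * h ((T I).mulVec x - u I) := by
    funext x
    simp only [Pi.sub_apply, Pi.add_apply, Finset.sum_apply, Pi.smul_apply, smul_eq_mul, mul_sub,
      Finset.sum_sub_distrib]
    ring
  have hz1 : ∀ x, x ∉ cube d → f x - ∑ I ∈ Λ, a I * tensorDilate w I x = 0 := fun x hx => by
    rw [hf.1 x hx, zero_sub, neg_eq_zero]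
    exact Finset.sum_eq_zero fun I _ => by rw [hw.tensorDilate_eq_zero I hx, mul_zero]
  have hm1 : AEStronglyMeasurable (fun x => f x - ∑ I ∈ Λ, a I * tensorDilate w I x) volume :=
    aestronglyMeasurable_of_cube hz1 (hf.2.1.sub (memLp_finsetSum _ fun I _ =>
      (hw.memLp_tensorDilate I).const_mul _)).aestronglyMeasurable
  have hI := fun I => eLpNorm_dilate_sub hw hhψ I
  have hm2 : ∀ I ∈ Λ, AEStronglyMeasurable
      (a I • fun x => tensorDilate w I x - c I * h ((T I).mulVec x - u I)) volume :=
    fun I _ => (hI I).1.const_smul _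
  have hm2' := Finset.aestronglyMeasurable_sum Λ hm2
  rw [hsplit]
  refine ⟨hm1.add hm2', (eLpNorm_add_le hm1 hm2' (by norm_num)).trans (add_le_add ?_ ?_), ?_⟩
  · rw [← eLpNorm_cube_eq hz1, one_div, ENNReal.le_rpow_inv_iff (by norm_num)]
    refine le_trans ?_ (happ.trans ?_)
    · exact_mod_cast le_rfl
    · have h2 : (2 : ℝ) ^ (p - 2) < 1 :=
        Real.rpow_lt_one_of_one_lt_of_neg (by norm_num) (by linarith)
      have h3 : 0 < 1 - (2 : ℝ) ^ (p - 2) := by linarith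
      rw [ENNReal.ofReal_add (by positivity) (by positivity)]
  · refine (eLpNorm_sum_le hm2 (by norm_num)).trans ?_
    have h1 : ∀ I ∈ Λ, eLpNorm (a I • fun x => tensorDilate w I x -
        c I * h ((T I).mulVec x - u I)) 2 volume ≤ ENNReal.ofReal (C₁ * (2 * ε)) := fun I hIΛ => by
      rw [eLpNorm_const_smul, (hI I).2, ENNReal.ofReal_mul hC₁.le, Real.enorm_eq_ofReal_abs]
      exact mul_le_mul' (ENNReal.ofReal_le_ofReal (hΛ I hIΛ).1) hcut
    refine (Finset.sum_le_card_nsmul _ _ _ h1).trans ?_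
    rw [nsmul_eq_mul, ENNReal.ofReal_mul (Nat.cast_nonneg _), ENNReal.ofReal_natCast]
    gcongr
  · intro A v hA hv
    have hB0 : 0 ≤ B := hb0.trans hbB
    have hτ : (1 : ℝ) ≤ 2 ^ m * (C₃ + 1) :=
      one_le_mul_of_one_le_of_one_le (one_le_pow₀ (by norm_num)) (by linarith)
    have hterm : ∀ I ∈ Λ, IsNet (fun x => (a I * c I) * h ((T I * A).mulVec x -
        ((T I).mulVec v + u I))) (l + 1)
        ((d + 2) * l + 2 * (d * d + d + l * d) + 2 * (l + 2 * d) + 4 * l + 2) (l + 2 * d) B := by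
      intro I hIΛ
      have hk := (hΛ I hIΛ).2
      have hpow : ∀ i, (2 : ℝ) ^ (I i).1 ≤ 2 ^ m := fun i =>
        pow_le_pow_right₀ (by norm_num) (hk i).le
      have hcI : |a I * c I| ≤ B := by
        rw [abs_mul]
        have h1 : |c I| ≤ 2 ^ (m * d) := by
          rw [hc, abs_of_nonneg (Finset.prod_nonneg fun i _ => by positivity)]
          calc ∏ i, (2 : ℝ) ^ (((I i).1 : ℝ) / 2) ≤ ∏ _i : Fin d, (2 : ℝ) ^ m :=
                Finset.prod_le_prod (fun i _ => by positivity) fun i _ => by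
                  rw [← Real.rpow_natCast 2 m]
                  refine Real.rpow_le_rpow_of_exponent_le (by norm_num) ?_
                  have h1 : ((I i).1 : ℝ) ≤ m := by exact_mod_cast (hk i).le
                  have h2 : (0 : ℝ) ≤ (I i).1 := Nat.cast_nonneg _
                  linarith
            _ = _ := by rw [Finset.prod_const, Finset.card_univ, Fintype.card_fin, ← pow_mul]
        exact (mul_le_mul (hΛ I hIΛ).1 h1 (abs_nonneg _) hC₁.le).trans hB'
      have hTA : MatBound (T I * A) (2 ^ m * (C₃ + 1)) := fun i j => by
        rw [hT, Matrix.diagonal_mul, abs_mul, abs_of_pos (by positivity)]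
        exact mul_le_mul (hpow i) ((hA i j).trans (by linarith)) (abs_nonneg _) (by positivity)
      -- The scaled shift is at most 2^m C₃ and the translation ℓ at most 2^m, which is why C₃ + 1
      -- appears in the weight bound.
      have hTv : VecBound ((T I).mulVec v + u I) (2 ^ m * (C₃ + 1)) := fun i => by
        rw [Pi.add_apply, hT, Matrix.mulVec_diagonal]
        refine (abs_add_le _ _).trans ?_
        rw [abs_mul, abs_of_pos (by positivity), hu, Nat.abs_cast, mul_add, mul_one]
        refine add_le_add (mul_le_mul (hpow i) (hv i) (abs_nonneg _) (by positivity)) ?_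
        refine le_trans ?_ (hpow i)
        exact_mod_cast (I i).2.2.le
      have hBs : (d + 1) * s.B * (2 ^ m * (C₃ + 1)) ≤ B := by
        refine le_trans ?_ hB
        gcongr
      have hnet := isNet_cutoff hd hg hτ hTA hTv hBs hb0 hbB hcI hη0 hη1 (l - s.L)
      rw [Nat.add_sub_cancel' hsL] at hnet
      refine (hnet.mono ?_).mono_width hB0 (by omega)
      have e1 : (d + 2) * s.S ≤ (d + 2) * l := Nat.mul_le_mul_left _ hsS
      have e2 : s.L * d ≤ l * d := Nat.mul_le_mul_right _ hsL
      omega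
    have hsum := isNet_sum hB0 Λ hterm
    have hfun : (fun x => ∑ I ∈ Λ, a I * (c I * h ((T I).mulVec (A.mulVec x - v) - u I))) =
        ∑ I ∈ Λ, fun x => (a I * c I) * h ((T I * A).mulVec x - ((T I).mulVec v + u I)) := by
      funext x
      rw [Finset.sum_apply]
      refine Finset.sum_congr rfl fun I _ => ?_
      rw [Matrix.mulVec_sub, Matrix.mulVec_mulVec, sub_sub, mul_assoc]
    rw [hfun]
    exact (hsum.mono (Nat.mul_le_mul_right _ hcardN)).mono_width hB0
      (Nat.mul_le_mul_right _ hcardN)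

/-- The error of a summand on the cube is at most its error on the whole space, which is that for
f_j times |det A_j|^{-1/2} ≤ C₃^{1/2}. The networks have a common depth, so they are simply placed
side by side. The wavelets of Ψ may have different approximating networks, under common size bounds.
-/
theorem exists_net_approx_classK {d : ℕ} (hd : 0 < d) {Ψ : Set ((Fin d → ℝ) → ℝ)}
    {f : (Fin d → ℝ) → ℝ} {p C₁ C₂ C₃ β : ℝ} (hp : 0 < p) (hp2 : p < 2) (hC₁ : 0 < C₁)
    (hC₂ : 0 ≤ C₂) (hC₃ : 0 < C₃) {ns : ℕ} (hf : f ∈ classK Ψ p ns C₁ C₂ C₃ β) (m : ℕ) {t : ℝ}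
    (ht : 0 < t) {N l : ℕ} (hN : (C₁ / t) ^ p < N + 1) {ε Bg Q b B : ℝ} (hε : 0 < ε) (hε1 : ε ≤ 1)
    (hΨ : ∀ ψ ∈ Ψ, AEStronglyMeasurable ψ (cubeMeasure d) ∧ ∃ s : NetSize d,
      (s.L ≤ l ∧ s.S ≤ l ∧ s.D ≤ l ∧ s.B ≤ Bg) ∧
      ∃ g ∈ networks s, eLpNorm (g - ψ) 2 (cubeMeasure d) ≤ ENNReal.ofReal ε)
    (hQ : Bg * (l + 1) ≤ Q) (hb : 2 * d * Q ^ 6 / ε ^ 2 ≤ b) (hbB : b ≤ B) (hB0 : 0 ≤ B)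
    (hB : (d + 1) * Bg * (2 ^ m * (C₃ + 1)) ≤ B) (hB' : C₁ * 2 ^ (m * d) ≤ B) :
    AEStronglyMeasurable f (cubeMeasure d) ∧ ∃ φ : (Fin d → ℝ) → ℝ,
      eLpNorm (f - φ) 2 (cubeMeasure d) ≤ ns * (ENNReal.ofReal C₃ ^ (1 / 2 : ℝ) *
        (ENNReal.ofReal (C₂ * 2 ^ (-β * m) +
          (2 * C₁) ^ p / (1 - 2 ^ (p - 2)) * t ^ (2 - p)) ^ (1 / 2 : ℝ) +
          ENNReal.ofReal (N * (C₁ * (2 * ε))))) ∧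
      IsNet φ (l + 1)
        (ns * (N * ((d + 2) * l + 2 * (d * d + d + l * d) + 2 * (l + 2 * d) + 4 * l + 2)))
        (ns * (N * (l + 2 * d))) B := by
  obtain ⟨A, v, ψ, fs, hA, hfs, rfl⟩ := hf
  have hj : ∀ j, ∃ φ : (Fin d → ℝ) → ℝ, AEStronglyMeasurable (fs j - φ) volume ∧
      eLpNorm (fs j - φ) 2 volume ≤ ENNReal.ofReal (C₂ * 2 ^ (-β * m) +
        (2 * C₁) ^ p / (1 - 2 ^ (p - 2)) * t ^ (2 - p)) ^ (1 / 2 : ℝ) +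
          ENNReal.ofReal (N * (C₁ * (2 * ε))) ∧
      ∀ (A : Matrix (Fin d) (Fin d) ℝ) (v : Fin d → ℝ), MatBound A C₃ → VecBound v C₃ →
        IsNet (fun x => φ (A.mulVec x - v)) (l + 1)
          (N * ((d + 2) * l + 2 * (d * d + d + l * d) + 2 * (l + 2 * d) + 4 * l + 2))
          (N * (l + 2 * d)) B := fun j => by
    obtain ⟨hm, s, ⟨h1, h2, h3, h4⟩, g, hg, hgψ⟩ := hΨ _ (hfs j).1
    exact exists_net_approx_classJ hd hp hp2 hC₁ hC₂ hC₃ (hfs j).2 m ht hN hε hε1 hg hgψ hm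
      h1 h2 h3 h4 hQ hb hbB hB hB'
  choose φ hφm hφ hφnet using hj
  have hfm : ∀ j, AEStronglyMeasurable (fun x => fs j ((A j).mulVec x - v j)) volume := fun j =>
    (eLpNorm_comp_affine (hA j).1 (v j) (aestronglyMeasurable_of_cube (hfs j).2.1
      (hfs j).2.2.1.aestronglyMeasurable)).1
  refine ⟨(Finset.aestronglyMeasurable_fun_sum _ fun j _ => hfm j).restrict,
    ∑ j, fun x => φ j ((A j).mulVec x - v j), ?_, ?_⟩
  · have he : ((fun x => ∑ j, fs j ((A j).mulVec x - v j)) -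
        ∑ j, fun x => φ j ((A j).mulVec x - v j)) =
        ∑ j, fun x => (fs j - φ j) ((A j).mulVec x - v j) := by
      funext x
      simp only [Pi.sub_apply, Finset.sum_apply, Finset.sum_sub_distrib]
    have hcomp := fun j => eLpNorm_comp_affine (hA j).1 (v j) (hφm j)
    rw [he]
    refine (eLpNorm_mono_measure _ Measure.restrict_le_self).trans
      ((eLpNorm_sum_le (fun j _ => (hcomp j).1) (by norm_num)).trans ?_)
    refine (Finset.sum_le_card_nsmul _ _ _ fun j _ => ?_).trans_eq (by
      rw [Finset.card_univ, Fintype.card_fin, nsmul_eq_mul])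
    rw [(hcomp j).2]
    exact mul_le_mul' (ENNReal.rpow_le_rpow (ENNReal.ofReal_le_ofReal (hA j).2.1) (by norm_num))
      (hφ j)
  · have := isNet_sum hB0 Finset.univ fun j _ => hφnet j (A j) (v j) (hA j).2.2.1 (hA j).2.2.2
    rwa [Finset.card_univ, Fintype.card_fin] at this

/-! ### Risk bound for a given approximation error -/

/-- The oracle inequality with cover radius 1/n. The target is first replaced by a measurable
version bounded everywhere by F, which leaves the risk unchanged. Truncating φ at F does not
increase its distance to a target bounded by F, so the competitor belongs to the truncated class. -/
theorem risk_le_of_approx {d n : ℕ} (hd : 0 < d) (hn : 0 < n) {σ F E : ℝ} (hσ : 0 < σ)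
    (hσF : σ ≤ F) (hE : 0 ≤ E) {s : NetSize d} {f φ : (Fin d → ℝ) → ℝ}
    (hf : AEStronglyMeasurable f (cubeMeasure d))
    (hfF : eLpNorm f ∞ (cubeMeasure d) ≤ ENNReal.ofReal F) (hφ : φ ∈ networks s)
    (hE' : eLpNorm (f - φ) 2 (cubeMeasure d) ≤ ENNReal.ofReal E)
    {fhat : (Fin n → (Fin d → ℝ) × ℝ) → (Fin d → ℝ) → ℝ}
    (hfhat : IsERM (clippedNetworks s F) fhat) :
    risk σ fhat f ≤ ENNReal.ofReal (2 * (1 / n) ^ 2 + 8 * (E ^ 2 +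
      (4 * F * (1 / n) + 2 * (1 / n) * σ) + 4 * F ^ 2 * (s.S * (Real.log (s.L + 1) + (s.L + 4) *
        Real.log (4 * (s.B * (s.D + 1))) + Real.log n) + 1) / n)) := by
  have hF : 0 < F := hσ.trans_le hσF
  have hn' : (0 : ℝ) < n := by exact_mod_cast hn
  have hn1 : (1 : ℝ) ≤ n := by exact_mod_cast hn
  have hδ1 : 1 / (n : ℝ) ≤ 1 := (div_le_one hn').2 hn1
  obtain ⟨N, g, hg, hgF, hcov, hlog⟩ :=
    exists_cover_clippedNetworks hd s hF.le (one_div_pos.2 hn') hδ1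
  rw [one_div, Real.log_inv, sub_neg_eq_add] at hlog
  have hfae : ∀ᵐ x ∂cubeMeasure d, |f x| ≤ F := by
    have h1 := ae_le_eLpNormEssSup (f := f) (μ := cubeMeasure d)
    filter_upwards [h1] with x hx
    rw [eLpNorm_exponent_top] at hfF
    have h2 := hx.trans hfF
    rw [Real.enorm_eq_ofReal_abs] at h2
    exact (ENNReal.ofReal_le_ofReal_iff hF.le).1 h2
  set f₀ : (Fin d → ℝ) → ℝ := fun x => max (-F) (min (hf.mk f x) F) with hf₀
  have hf₀m : Measurable f₀ :=
    measurable_const.max (hf.stronglyMeasurable_mk.measurable.min measurable_const)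
  have hff₀ : f =ᵐ[cubeMeasure d] f₀ := by
    filter_upwards [hfae, hf.ae_eq_mk] with x h1 h2
    rw [hf₀]
    simp only
    rw [← h2, clip_of_abs_le h1]
  have hf₀F : ∀ x, |f₀ x| ≤ F := fun x => abs_clip_le hF.le _
  set fs : (Fin d → ℝ) → ℝ := fun x => Real.sign (φ x) * min |φ x| F with hfs
  have hfs' : fs = fun x => max (-F) (min (φ x) F) := by
    funext x; exact sign_mul_min_abs hF.le _
  have hφc := continuous_of_mem_networks hφ
  have hfsm : Measurable fs := by
    rw [hfs']; exact (continuous_const.max (hφc.min continuous_const)).measurable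
  have h𝓕 : ∀ h ∈ clippedNetworks s F, ∀ x, |h x| ≤ F := by
    rintro h ⟨h', -, rfl⟩ x
    simp only
    rw [sign_mul_min_abs hF.le]; exact abs_clip_le hF.le _
  have hfs𝓕 : fs ∈ clippedNetworks s F := ⟨φ, hφ, rfl⟩
  rw [risk_congr_ae fhat hff₀]
  refine (risk_le_of_cover hn hσ hσF (one_div_pos.2 hn').le h𝓕 g hg hgF hcov hf₀m hf₀F hfsm hfs𝓕
    hfhat).trans (ENNReal.ofReal_le_ofReal ?_)
  have hint : ∫ x, (fs x - f₀ x) ^ 2 ∂cubeMeasure d ≤ E ^ 2 := by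
    have hi := (integrable_excessLoss (σ := σ) hf₀m hfsm hf₀F (h𝓕 _ hfs𝓕)).1
    rw [← ENNReal.ofReal_le_ofReal_iff (sq_nonneg E), ofReal_integral_eq_lintegral_ofReal hi
      (ae_of_all _ fun x => sq_nonneg _), ENNReal.ofReal_pow hE]
    have h1 := sq_eLpNorm_two (μ := cubeMeasure d) (fs - f₀)
    simp only [Pi.sub_apply] at h1
    rw [← h1]
    refine pow_le_pow_left₀ zero_le (le_trans ?_ hE') 2
    refine eLpNorm_mono_ae ?_
    filter_upwards [hff₀, hfae] with x hx hxF
    rw [Pi.sub_apply, Pi.sub_apply, ← hx, Real.norm_eq_abs, Real.norm_eq_abs, hfs',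
      abs_sub_comm (f x)]
    have h2 := abs_clip_sub_clip_le F (φ x) (f x)
    rwa [clip_of_abs_le hxF] at h2
  rw [Fintype.card_fin]
  gcongr

/-! ### Growth rates -/

/-- Sequences that grow at most polynomially. -/
def PolyGrowth (u : ℕ → ℝ) : Prop := ∃ k : ℕ, ∀ n : ℕ, 2 ≤ n → u n ≤ (n : ℝ) ^ k

theorem polyGrowth_const (c : ℝ) : PolyGrowth fun _ => c := by
  obtain ⟨k, hk⟩ := pow_unbounded_of_one_lt c (by norm_num : (1 : ℝ) < 2)
  exact ⟨k, fun n hn => hk.le.trans (pow_le_pow_left₀ (by norm_num) (by exact_mod_cast hn) k)⟩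

theorem PolyGrowth.mono {u v : ℕ → ℝ} (hv : PolyGrowth v) (h : ∀ n, 2 ≤ n → u n ≤ v n) :
    PolyGrowth u := by
  obtain ⟨k, hk⟩ := hv
  exact ⟨k, fun n hn => (h n hn).trans (hk n hn)⟩

theorem PolyGrowth.add {u v : ℕ → ℝ} (hu : PolyGrowth u) (hv : PolyGrowth v) :
    PolyGrowth fun n => u n + v n := by
  obtain ⟨k, hk⟩ := hu
  obtain ⟨l, hl⟩ := hv
  -- The additional power absorbs the factor 2, as n ≥ 2.
  refine ⟨k + l + 1, fun n hn => ?_⟩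
  have h2 : (2 : ℝ) ≤ n := by exact_mod_cast hn
  have h1 : (n : ℝ) ^ k ≤ n ^ (k + l) := pow_le_pow_right₀ (by linarith) (by omega)
  have h3 : (n : ℝ) ^ l ≤ n ^ (k + l) := pow_le_pow_right₀ (by linarith) (by omega)
  rw [pow_succ]
  nlinarith [hk n hn, hl n hn, pow_nonneg (by linarith : (0 : ℝ) ≤ n) (k + l)]

theorem PolyGrowth.mul {u v : ℕ → ℝ} (hu : PolyGrowth u) (hv : PolyGrowth v)
    (hv0 : ∀ n, 0 ≤ v n) : PolyGrowth fun n => u n * v n := by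
  obtain ⟨k, hk⟩ := hu
  obtain ⟨l, hl⟩ := hv
  refine ⟨k + l, fun n hn => ?_⟩
  rw [pow_add]
  exact mul_le_mul (hk n hn) (hl n hn) (hv0 n) (by positivity)

theorem PolyGrowth.pow {u : ℕ → ℝ} (hu : PolyGrowth u) (hu0 : ∀ n, 0 ≤ u n) (k : ℕ) :
    PolyGrowth fun n => u n ^ k := by
  induction k with
  | zero => simpa using polyGrowth_const 1
  | succ k ih => simpa only [pow_succ] using ih.mul hu hu0

theorem polyGrowth_rpow (x : ℝ) : PolyGrowth fun n => (n : ℝ) ^ x := by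
  refine ⟨⌈x⌉₊, fun n hn => ?_⟩
  have h2 : (1 : ℝ) ≤ n := by exact_mod_cast (by omega : 1 ≤ n)
  rw [← Real.rpow_natCast]
  exact Real.rpow_le_rpow_of_exponent_le h2 (Nat.le_ceil x)

theorem polyGrowth_id : PolyGrowth fun n => (n : ℝ) := ⟨1, fun n _ => by simp⟩

theorem polyGrowth_log : PolyGrowth fun n => Real.log n :=
  polyGrowth_id.mono fun n _ => (Real.log_le_self (Nat.cast_nonneg n))

/-- Sequences that grow at most logarithmically. -/
def LogGrowth (u : ℕ → ℝ) : Prop := ∃ c : ℝ, 0 ≤ c ∧ ∀ n : ℕ, 2 ≤ n → u n ≤ c * Real.log n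

/-- Weights and width enter the entropy only through a logarithm, so any polynomial growth of them
is good enough and no degree has to be tracked. -/
theorem PolyGrowth.log {u : ℕ → ℝ} (hu : PolyGrowth u) (hu0 : ∀ n, 0 < u n) :
    LogGrowth fun n => Real.log (u n) := by
  obtain ⟨k, hk⟩ := hu
  refine ⟨k, Nat.cast_nonneg k, fun n hn => ?_⟩
  rw [← Real.log_pow]
  exact Real.log_le_log (hu0 n) (hk n hn)

theorem logGrowth_const (c : ℝ) : LogGrowth fun _ => c := by
  refine ⟨|c| / Real.log 2, div_nonneg (abs_nonneg _) (Real.log_nonneg (by norm_num)),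
    fun n hn => ?_⟩
  have h2 : 0 < Real.log 2 := Real.log_pos (by norm_num)
  have h1 : Real.log 2 ≤ Real.log n := Real.log_le_log (by norm_num) (by exact_mod_cast hn)
  rw [div_mul_eq_mul_div, le_div_iff₀ h2]
  have h3 := mul_le_mul_of_nonneg_left h1 (abs_nonneg c)
  have h4 := mul_le_mul_of_nonneg_right (le_abs_self c) h2.le
  linarith

theorem logGrowth_mul_log (c : ℝ) : LogGrowth fun n => c * Real.log n :=
  ⟨|c|, abs_nonneg c, fun n _ => mul_le_mul_of_nonneg_right (le_abs_self c)
    (Real.log_natCast_nonneg n)⟩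

theorem LogGrowth.add {u v : ℕ → ℝ} (hu : LogGrowth u) (hv : LogGrowth v) :
    LogGrowth fun n => u n + v n := by
  obtain ⟨c, hc0, hc⟩ := hu
  obtain ⟨c', hc0', hc'⟩ := hv
  exact ⟨c + c', by positivity, fun n hn => by
    rw [add_mul]; exact add_le_add (hc n hn) (hc' n hn)⟩

theorem LogGrowth.const_mul {u : ℕ → ℝ} (hu : LogGrowth u) {a : ℝ} (ha : 0 ≤ a) :
    LogGrowth fun n => a * u n := by
  obtain ⟨c, hc0, hc⟩ := hu
  exact ⟨a * c, by positivity, fun n hn => by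
    rw [mul_assoc]; exact mul_le_mul_of_nonneg_left (hc n hn) ha⟩

theorem LogGrowth.mono {u v : ℕ → ℝ} (hv : LogGrowth v) (h : ∀ n, 2 ≤ n → u n ≤ v n) :
    LogGrowth u := by
  obtain ⟨k, hk0, hk⟩ := hv
  exact ⟨k, hk0, fun n hn => (h n hn).trans (hk n hn)⟩

/-! ### Network sizes -/

/-- The bound on the sizes of the networks that approximate the wavelet up to `n⁻²`. -/
noncomputable def waveletSize (C₁' : ℝ) (n : ℕ) : ℕ := ⌊2 * C₁' * Real.log n⌋₊

/-- The bound on the weights of the networks that approximate the wavelet up to `n⁻²`. -/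
noncomputable def waveletWeight (C₂' : ℝ) (n : ℕ) : ℝ := 1 + C₂' * (n : ℝ) ^ 2

/-- The number of terms of the wavelet series that are approximated. -/
noncomputable def termCount (p : ℝ) (n : ℕ) : ℕ := ⌊(n : ℝ) ^ (p / 2)⌋₊ + 1

/-- The level at which the wavelet series is truncated. -/
noncomputable def truncLevel (β : ℝ) (n : ℕ) : ℕ := ⌈Real.logb 2 n / β⌉₊

/-- The number of parameters used for one term of the wavelet series. -/
def termSparsity (d l : ℕ) : ℕ :=
  (d + 2) * l + 2 * (d * d + d + l * d) + 2 * (l + 2 * d) + 4 * l + 2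

/-- The factor by which the penalty is amplified in each layer. -/
noncomputable def penaltyWeight (d : ℕ) (C₁' C₂' : ℝ) (n : ℕ) : ℝ :=
  2 * d * (waveletWeight C₂' n * (waveletSize C₁' n + 1)) ^ 6 / (1 / (n : ℝ) ^ 2) ^ 2

/-- The bound on the weights of the networks. -/
noncomputable def weightBound (d : ℕ) (C₁' C₂' C₁ C₃ β : ℝ) (n : ℕ) : ℝ :=
  1 + (d + 1) * waveletWeight C₂' n * (2 ^ truncLevel β n * (C₃ + 1)) + penaltyWeight d C₁' C₂' n +
    C₁ * 2 ^ (truncLevel β n * d)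

theorem one_le_waveletWeight {C₂' : ℝ} (hC₂' : 0 < C₂') (n : ℕ) : 1 ≤ waveletWeight C₂' n := by
  unfold waveletWeight
  have : 0 ≤ C₂' * (n : ℝ) ^ 2 := by positivity
  linarith

theorem penaltyWeight_nonneg {d : ℕ} {C₁' C₂' : ℝ} (hC₂' : 0 < C₂') (n : ℕ) :
    0 ≤ penaltyWeight d C₁' C₂' n := by
  have := one_le_waveletWeight hC₂' n
  unfold penaltyWeight
  positivity

theorem le_weightBound {d : ℕ} {C₁' C₂' C₁ C₃ β : ℝ} (hC₂' : 0 < C₂') (hC₁ : 0 < C₁)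
    (hC₃ : 0 < C₃) (n : ℕ) :
    1 ≤ weightBound d C₁' C₂' C₁ C₃ β n ∧
    (d + 1) * waveletWeight C₂' n * (2 ^ truncLevel β n * (C₃ + 1)) ≤
      weightBound d C₁' C₂' C₁ C₃ β n ∧
    penaltyWeight d C₁' C₂' n ≤ weightBound d C₁' C₂' C₁ C₃ β n ∧
    C₁ * 2 ^ (truncLevel β n * d) ≤ weightBound d C₁' C₂' C₁ C₃ β n := by
  have h1 := one_le_waveletWeight hC₂' n
  have h2 := penaltyWeight_nonneg (d := d) (C₁' := C₁') hC₂' n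
  have h3 : 0 ≤ (d + 1) * waveletWeight C₂' n * (2 ^ truncLevel β n * (C₃ + 1)) := by positivity
  have h4 : 0 ≤ C₁ * (2 : ℝ) ^ (truncLevel β n * d) := by positivity
  unfold weightBound
  refine ⟨?_, ?_, ?_, ?_⟩ <;> linarith

/-- The sizes of the networks over which the empirical risk is minimized. -/
noncomputable def netSize {d ns : ℕ} (hns : 0 < ns) (C₁' C₂' C₁ C₃ p β : ℝ)
    (hC₂' : 0 < C₂') (hC₁ : 0 < C₁) (hC₃ : 0 < C₃) (n : ℕ) : NetSize d where
  L := waveletSize C₁' n + 1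
  S := ns * (termCount p n * termSparsity d (waveletSize C₁' n))
  D := ns * (termCount p n * (waveletSize C₁' n + 2 * d))
  B := weightBound d C₁' C₂' C₁ C₃ β n
  L_pos := Nat.succ_pos _
  S_pos := Nat.mul_pos hns (Nat.mul_pos (Nat.succ_pos _) (Nat.succ_pos _))
  le_D := by
    have h1 : 1 * (1 * (waveletSize C₁' n + 2 * d)) ≤
        ns * (termCount p n * (waveletSize C₁' n + 2 * d)) :=
      Nat.mul_le_mul hns (Nat.mul_le_mul_right _ (Nat.succ_pos _))
    omega
  one_le_B := (le_weightBound hC₂' hC₁ hC₃ n).1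

theorem waveletSize_le {C₁' : ℝ} (hC₁' : 0 < C₁') (n : ℕ) :
    (waveletSize C₁' n : ℝ) ≤ 2 * C₁' * Real.log n :=
  Nat.floor_le (mul_nonneg (by positivity) (Real.log_natCast_nonneg n))

theorem termCount_le (p : ℝ) (hp : 0 < p) {n : ℕ} (hn : 2 ≤ n) :
    (termCount p n : ℝ) ≤ 2 * (n : ℝ) ^ (p / 2) := by
  have hn1 : (1 : ℝ) ≤ n := by exact_mod_cast (by omega : 1 ≤ n)
  have h1 : 1 ≤ (n : ℝ) ^ (p / 2) := Real.one_le_rpow hn1 (by positivity)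
  have h2 := Nat.floor_le (a := (n : ℝ) ^ (p / 2)) (by positivity)
  unfold termCount
  push_cast
  linarith

theorem le_truncLevel {β : ℝ} (hβ : 0 < β) {n : ℕ} (hn : 2 ≤ n) :
    (2 : ℝ) ^ (-β * (truncLevel β n : ℝ)) ≤ (n : ℝ)⁻¹ := by
  have hn0 : (0 : ℝ) < n := by exact_mod_cast (by omega : 0 < n)
  have h1 := Nat.le_ceil (Real.logb 2 n / β)
  rw [div_le_iff₀ hβ] at h1
  have h2 : -β * (truncLevel β n : ℝ) ≤ -Real.logb 2 n := by
    unfold truncLevel; linarith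
  refine (Real.rpow_le_rpow_of_exponent_le (by norm_num) h2).trans_eq ?_
  rw [Real.rpow_neg (by norm_num), Real.rpow_logb (by norm_num) (by norm_num) hn0]

theorem polyGrowth_two_pow_truncLevel {β : ℝ} (hβ : 0 < β) :
    PolyGrowth fun n => (2 : ℝ) ^ truncLevel β n := by
  refine ((polyGrowth_rpow (1 / β)).mul (polyGrowth_const 2) fun _ => by norm_num).mono
    fun n hn => ?_
  have hn0 : (1 : ℝ) < n := by exact_mod_cast (by omega : 1 < n)
  have h0 : 0 ≤ Real.logb 2 n / β := div_nonneg (Real.logb_nonneg (by norm_num) hn0.le) hβ.le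
  have h1 := (Nat.ceil_lt_add_one h0).le
  rw [← Real.rpow_natCast]
  refine (Real.rpow_le_rpow_of_exponent_le (by norm_num) h1).trans_eq ?_
  rw [Real.rpow_add (by norm_num), Real.rpow_one, div_eq_mul_one_div, Real.rpow_mul (by norm_num),
    Real.rpow_logb (by norm_num) (by norm_num) (by linarith)]

theorem polyGrowth_waveletSize {C₁' : ℝ} (hC₁' : 0 < C₁') :
    PolyGrowth fun n => (waveletSize C₁' n : ℝ) :=
  (((polyGrowth_const (2 * C₁')).mul polyGrowth_log fun n => Real.log_natCast_nonneg n)).mono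
    fun n _ => waveletSize_le hC₁' n

theorem polyGrowth_weightBound (d : ℕ) {C₁' C₂' C₁ C₃ β : ℝ} (hC₁' : 0 < C₁') (hC₂' : 0 < C₂')
    (hC₃ : 0 < C₃) (hβ : 0 < β) :
    PolyGrowth fun n => weightBound d C₁' C₂' C₁ C₃ β n := by
  have hw : PolyGrowth fun n => waveletWeight C₂' n :=
    (polyGrowth_const 1).add ((polyGrowth_const C₂').mul
      (polyGrowth_id.pow (fun n => Nat.cast_nonneg n) 2) fun n => by positivity)
  have hw0 := fun n => (zero_le_one.trans (one_le_waveletWeight hC₂' n) : (0 : ℝ) ≤ _)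
  have hm := polyGrowth_two_pow_truncLevel hβ
  have hl : PolyGrowth fun n => (waveletSize C₁' n : ℝ) + 1 :=
    (polyGrowth_waveletSize hC₁').add (polyGrowth_const 1)
  have hb : PolyGrowth fun n => penaltyWeight d C₁' C₂' n := by
    refine (((polyGrowth_const (2 * d)).mul ((hw.mul hl fun n => by positivity).pow
      (fun n => mul_nonneg (hw0 n) (by positivity)) 6) fun n => ?_).mul
      (polyGrowth_id.pow (fun n => Nat.cast_nonneg n) 4) fun n => by positivity).mono
      fun n hn => ?_
    · have := hw0 n; positivity
    · have hn0 : (0 : ℝ) < n := by exact_mod_cast (by omega : 0 < n)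
      unfold penaltyWeight
      refine le_of_eq ?_
      field_simp
  unfold weightBound
  refine (((polyGrowth_const 1).add (((polyGrowth_const (d + 1)).mul hw hw0).mul
    (hm.mul (polyGrowth_const (C₃ + 1)) fun n => by positivity) fun n => by positivity)).add
    hb).add ((polyGrowth_const C₁).mul ?_ fun n => by positivity)
  simpa only [pow_mul] using hm.pow (fun n => by positivity) d

/-! ### The rate of convergence -/

/-- All terms are multiples of F² n^{-(1-p/2)}, the entropy term with an additional (log n)³;
elsewhere this factor is inserted at the cost of 1/(log 2)³. The constants are 82 = 2 + 8(4 + 2 + 4)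
and 32 = 8 · 4. -/
theorem rate_bound {n F σ E Ca S A Λ cT p : ℝ} (hn : 2 ≤ n) (hp : 0 < p) (hF : 1 ≤ F)
    (hσF : σ ≤ F) (hΛ : Λ = Real.log 2)
    (hE : E ^ 2 ≤ Ca ^ 2 * n ^ (-(1 - p / 2)))
    (hSA : S * A ≤ cT * n ^ (p / 2) * Real.log n ^ 3) :
    2 * (1 / n) ^ 2 + 8 * (E ^ 2 + (4 * F * (1 / n) + 2 * (1 / n) * σ) +
      4 * F ^ 2 * (S * A + 1) / n) ≤
    ((82 + 8 * Ca ^ 2) / Λ ^ 3 + 32 * cT) * F ^ 2 * n ^ (-(1 - p / 2)) * Real.log n ^ 3 := by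
  have hn0 : 0 < n := by linarith
  set q := n ^ (-(1 - p / 2)) with hq
  set g := Real.log n ^ 3 with hg
  have hΛ0 : 0 < Λ := by rw [hΛ]; exact Real.log_pos (by norm_num)
  have hq0 : 0 < q := by positivity
  have hqn : n ^ (p / 2) / n = q := by
    rw [hq, neg_sub, Real.rpow_sub hn0, Real.rpow_one]
  have hnq : 1 / n ≤ q := by
    rw [← hqn]
    exact div_le_div_of_nonneg_right (Real.one_le_rpow (by linarith) (by positivity)) hn0.le
  have hg1 : 1 ≤ g / Λ ^ 3 := by
    rw [one_le_div (by positivity), hg, hΛ]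
    exact pow_le_pow_left₀ (Real.log_nonneg (by norm_num)) (Real.log_le_log (by norm_num) hn) 3
  have hF2 : 1 ≤ F ^ 2 := one_le_pow₀ hF
  have hFF : F ≤ F ^ 2 := by nlinarith
  have hn1 : 0 ≤ 1 / n := by positivity
  have hFq : F * (1 / n) ≤ F ^ 2 * q := mul_le_mul hFF hnq hn1 (by positivity)
  have e1 : (1 / n) ^ 2 ≤ F ^ 2 * q := by
    have h1 : 1 / n ≤ 1 := (div_le_one hn0).2 (by linarith)
    have h2 : (1 / n) ^ 2 ≤ 1 / n := by nlinarith
    nlinarith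
  have e2 : E ^ 2 ≤ Ca ^ 2 * (F ^ 2 * q) := by
    refine hE.trans (mul_le_mul_of_nonneg_left ?_ (sq_nonneg _))
    nlinarith
  have e3 : σ * (1 / n) ≤ F ^ 2 * q :=
    (mul_le_mul_of_nonneg_right hσF hn1).trans hFq
  have e4 : 4 * F ^ 2 * (S * A + 1) / n ≤ 4 * (cT * (F ^ 2 * q * g)) + 4 * (F ^ 2 * q) := by
    have h1 : (S * A + 1) / n ≤ cT * q * g + q := by
      rw [add_div]
      refine add_le_add ?_ hnq
      refine (div_le_div_of_nonneg_right hSA hn0.le).trans_eq ?_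
      rw [← hqn]; ring
    calc 4 * F ^ 2 * (S * A + 1) / n = 4 * F ^ 2 * ((S * A + 1) / n) := by ring
      _ ≤ 4 * F ^ 2 * (cT * q * g + q) := mul_le_mul_of_nonneg_left h1 (by positivity)
      _ = _ := by ring
  have hFq0 : 0 ≤ F ^ 2 * q := by positivity
  have e5 : (82 + 8 * Ca ^ 2) * (F ^ 2 * q) ≤ (82 + 8 * Ca ^ 2) * (F ^ 2 * q) * (g / Λ ^ 3) :=
    le_mul_of_one_le_right (by positivity) hg1
  calc _ ≤ (82 + 8 * Ca ^ 2) * (F ^ 2 * q) + 32 * (cT * (F ^ 2 * q * g)) := by nlinarith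
    _ ≤ (82 + 8 * Ca ^ 2) * (F ^ 2 * q) * (g / Λ ^ 3) + 32 * (cT * (F ^ 2 * q * g)) := by linarith
    _ = _ := by ring

/-- The level t = C₁ n^{-1/2} gives t^{2-p} = C₁^{2-p} n^{-(1-p/2)}, and the scale tail is at most
of order 1/n, which is smaller. About n^{p/2} networks of accuracy n^{-2} contribute n^{p/2-2},
which is below n^{-(1-p/2)/2} because p < 2. -/
theorem approx_error_le {C₁ C₂ C₃ p β K : ℝ} {ns : ℕ} (hp : 0 < p) (hp2 : p < 2) (hC₁ : 0 < C₁)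
    (hC₂ : 0 < C₂) (hC₃ : 0 < C₃) (hβ : 0 < β) (hK : 0 ≤ K) {n : ℕ} (hn : 2 ≤ n) :
    (ns : ℝ≥0∞) * (ENNReal.ofReal C₃ ^ (1 / 2 : ℝ) *
      (ENNReal.ofReal (C₂ * 2 ^ (-β * (truncLevel β n : ℝ)) +
        K * (C₁ * (n : ℝ) ^ (-(1 / 2) : ℝ)) ^ (2 - p)) ^ (1 / 2 : ℝ) +
        ENNReal.ofReal (termCount p n * (C₁ * (2 * (1 / (n : ℝ) ^ 2)))))) ≤
    ENNReal.ofReal (ns * (Real.sqrt C₃ * (Real.sqrt (C₂ + K * C₁ ^ (2 - p)) + 4 * C₁)) *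
      Real.sqrt ((n : ℝ) ^ (-(1 - p / 2)))) := by
  have hn0 : (0 : ℝ) < n := by exact_mod_cast (by omega : 0 < n)
  have hn1 : (1 : ℝ) ≤ n := by exact_mod_cast (by omega : 1 ≤ n)
  set q := (n : ℝ) ^ (-(1 - p / 2)) with hq
  have hq0 : 0 ≤ q := by positivity
  have hX : C₂ * 2 ^ (-β * (truncLevel β n : ℝ)) +
      K * (C₁ * (n : ℝ) ^ (-(1 / 2) : ℝ)) ^ (2 - p) ≤ (C₂ + K * C₁ ^ (2 - p)) * q := by
    have h1 : (n : ℝ)⁻¹ ≤ q := by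
      rw [← Real.rpow_neg_one]
      exact Real.rpow_le_rpow_of_exponent_le hn1 (by linarith)
    have h2 : (C₁ * (n : ℝ) ^ (-(1 / 2) : ℝ)) ^ (2 - p) = C₁ ^ (2 - p) * q := by
      rw [Real.mul_rpow hC₁.le (by positivity), ← Real.rpow_mul hn0.le]
      congr 2; ring
    rw [h2, add_mul, mul_assoc]
    gcongr
    exact (le_truncLevel hβ hn).trans h1
  have hY : termCount p n * (C₁ * (2 * (1 / (n : ℝ) ^ 2))) ≤ 4 * C₁ * Real.sqrt q := by
    have h1 := termCount_le p hp hn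
    have h2 : (n : ℝ) ^ (p / 2) * (1 / (n : ℝ) ^ 2) ≤ Real.sqrt q := by
      rw [one_div, ← Real.rpow_natCast, ← Real.rpow_neg hn0.le, ← Real.rpow_add hn0, hq,
        Real.sqrt_eq_rpow, ← Real.rpow_mul hn0.le]
      refine Real.rpow_le_rpow_of_exponent_le hn1 ?_
      push_cast
      linarith
    calc termCount p n * (C₁ * (2 * (1 / (n : ℝ) ^ 2)))
        ≤ (2 * (n : ℝ) ^ (p / 2)) * (C₁ * (2 * (1 / (n : ℝ) ^ 2))) := by gcongr
      _ = 4 * C₁ * ((n : ℝ) ^ (p / 2) * (1 / (n : ℝ) ^ 2)) := by ring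
      _ ≤ _ := by gcongr
  have hX' : ENNReal.ofReal (C₂ * 2 ^ (-β * (truncLevel β n : ℝ)) +
      K * (C₁ * (n : ℝ) ^ (-(1 / 2) : ℝ)) ^ (2 - p)) ^ (1 / 2 : ℝ) ≤
      ENNReal.ofReal (Real.sqrt (C₂ + K * C₁ ^ (2 - p)) * Real.sqrt q) := by
    rw [← Real.sqrt_mul (by positivity), Real.sqrt_eq_rpow,
      ← ENNReal.ofReal_rpow_of_nonneg (by positivity) (by norm_num)]
    exact ENNReal.rpow_le_rpow (ENNReal.ofReal_le_ofReal hX) (by norm_num)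
  calc _ ≤ (ns : ℝ≥0∞) * (ENNReal.ofReal C₃ ^ (1 / 2 : ℝ) *
        (ENNReal.ofReal (Real.sqrt (C₂ + K * C₁ ^ (2 - p)) * Real.sqrt q) +
          ENNReal.ofReal (4 * C₁ * Real.sqrt q))) := by gcongr
    _ = _ := by
        rw [ENNReal.ofReal_rpow_of_nonneg hC₃.le (by norm_num), ← Real.sqrt_eq_rpow,
          ← ENNReal.ofReal_add (by positivity) (by positivity),
          ← ENNReal.ofReal_mul (Real.sqrt_nonneg _), ← ENNReal.ofReal_natCast,
          ← ENNReal.ofReal_mul (Nat.cast_nonneg _)]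
        congr 1; ring

theorem logGrowth_waveletSize {C₁' : ℝ} (hC₁' : 0 < C₁') :
    LogGrowth fun n => (waveletSize C₁' n : ℝ) :=
  (logGrowth_mul_log (2 * C₁')).mono fun n _ => waveletSize_le hC₁' n

/-- The factor n^{p/2} counts the terms of the series. The three logarithms come from the parameters
per term, the depth, and the logarithm of weights and width. -/
theorem exists_complexity_bound (d : ℕ) {ns : ℕ} (hns : 0 < ns) {C₁' C₂' C₁ C₃ p β : ℝ}
    (hC₁' : 0 < C₁') (hC₂' : 0 < C₂') (hC₁ : 0 < C₁) (hC₃ : 0 < C₃) (hp : 0 < p) (hβ : 0 < β) :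
    ∃ cT : ℝ, 0 ≤ cT ∧ ∀ n : ℕ, 2 ≤ n → ∀ s : NetSize d,
      s = netSize hns C₁' C₂' C₁ C₃ p β hC₂' hC₁ hC₃ n →
      s.S * (Real.log (s.L + 1) + (s.L + 4) * Real.log (4 * (s.B * (s.D + 1))) + Real.log n) ≤
        cT * (n : ℝ) ^ (p / 2) * Real.log n ^ 3 := by
  have hl := logGrowth_waveletSize hC₁'
  obtain ⟨cL, hcL0, hcL⟩ : LogGrowth fun n => (waveletSize C₁' n : ℝ) + 5 :=
    hl.add (logGrowth_const 5)
  obtain ⟨cS, hcS0, hcS⟩ : LogGrowth fun n => (termSparsity d (waveletSize C₁' n) : ℝ) := by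
    refine ((hl.const_mul (by positivity : (0 : ℝ) ≤ 3 * d + 8)).add
      (logGrowth_const (2 * (d * d) + 6 * d + 2))).mono fun n _ => ?_
    unfold termSparsity
    push_cast
    exact le_of_eq (by ring)
  have hN : PolyGrowth fun n => (termCount p n : ℝ) :=
    ((polyGrowth_const 2).mul (polyGrowth_rpow (p / 2)) fun n => by positivity).mono
      fun n hn => termCount_le p hp hn
  have hB0 := fun n => (zero_lt_one.trans_le (le_weightBound (d := d) (C₁' := C₁') (β := β) hC₂'
    hC₁ hC₃ n).1 : (0 : ℝ) < _)
  obtain ⟨cB, hcB0, hcB⟩ : LogGrowth fun n => Real.log (4 * (weightBound d C₁' C₂' C₁ C₃ β n *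
      (ns * (termCount p n * (waveletSize C₁' n + 2 * d)) + 1))) := by
    refine PolyGrowth.log ((polyGrowth_const 4).mul
      ((polyGrowth_weightBound d hC₁' hC₂' hC₃ hβ).mul (((polyGrowth_const ns).mul (hN.mul
        ((polyGrowth_waveletSize hC₁').add (polyGrowth_const (2 * d))) fun n => by positivity)
        fun n => by positivity).add (polyGrowth_const 1)) fun n => by positivity) fun n => ?_)
      fun n => ?_
    · have := hB0 n; positivity
    · have := hB0 n; positivity
  have hΛ : 0 < Real.log 2 := Real.log_pos (by norm_num)
  refine ⟨ns * 2 * cS * ((cL + 1) / Real.log 2 + cL * cB), by positivity, ?_⟩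
  rintro n hn s rfl
  have hlg : Real.log 2 ≤ Real.log n := Real.log_le_log (by norm_num) (by exact_mod_cast hn)
  have hlg0 : 0 < Real.log n := hΛ.trans_le hlg
  simp only [netSize]
  push_cast
  have h1 : Real.log ((waveletSize C₁' n : ℝ) + 1 + 1) ≤ cL * Real.log n := by
    have := Real.log_le_sub_one_of_pos (x := (waveletSize C₁' n : ℝ) + 1 + 1) (by positivity)
    have := hcL n hn
    linarith
  have h2 : (waveletSize C₁' n : ℝ) + 1 + 4 ≤ cL * Real.log n := by
    have := hcL n hn; linarith
  have h3 : (cL + 1) * Real.log n ≤ (cL + 1) / Real.log 2 * Real.log n ^ 2 := by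
    rw [div_mul_eq_mul_div, le_div_iff₀ hΛ, sq, mul_assoc]
    gcongr
  have hA : Real.log ((waveletSize C₁' n : ℝ) + 1 + 1) + ((waveletSize C₁' n : ℝ) + 1 + 4) *
      Real.log (4 * (weightBound d C₁' C₂' C₁ C₃ β n *
        (ns * (termCount p n * (waveletSize C₁' n + 2 * d)) + 1))) + Real.log n ≤
      ((cL + 1) / Real.log 2 + cL * cB) * Real.log n ^ 2 := by
    have h4 : ((waveletSize C₁' n : ℝ) + 1 + 4) *
      Real.log (4 * (weightBound d C₁' C₂' C₁ C₃ β n *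
        (ns * (termCount p n * (waveletSize C₁' n + 2 * d)) + 1))) ≤
        (waveletSize C₁' n + 1 + 4) * (cB * Real.log n) :=
      mul_le_mul_of_nonneg_left (hcB n hn) (by positivity)
    have h5 : ((waveletSize C₁' n : ℝ) + 1 + 4) * (cB * Real.log n) ≤
        (cL * Real.log n) * (cB * Real.log n) :=
      mul_le_mul_of_nonneg_right h2 (by positivity)
    nlinarith
  have hS : (ns : ℝ) * (termCount p n * termSparsity d (waveletSize C₁' n)) ≤
      ns * ((2 * (n : ℝ) ^ (p / 2)) * (cS * Real.log n)) := by
    have := termCount_le p hp hn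
    have := hcS n hn
    gcongr
  calc _ ≤ (ns : ℝ) * (termCount p n * termSparsity d (waveletSize C₁' n)) *
        (((cL + 1) / Real.log 2 + cL * cB) * Real.log n ^ 2) :=
      mul_le_mul_of_nonneg_left hA (by positivity)
    _ ≤ ns * ((2 * (n : ℝ) ^ (p / 2)) * (cS * Real.log n)) *
        (((cL + 1) / Real.log 2 + cL * cB) * Real.log n ^ 2) :=
      mul_le_mul_of_nonneg_right hS (by positivity)
    _ = _ := by ring

/-- Empirical risk minimization over sparse networks attains the rate `n^{-(1 - p/2)} (log n)³` over
the classes `𝒦^p_Ψ`. -/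
theorem exists_risk_classK_le {d : ℕ} (hd : 0 < d) {ns : ℕ} (hns : 0 < ns)
    {C₁' C₂' C₁ C₂ C₃ p β : ℝ} (hC₁' : 0 < C₁') (hC₂' : 0 < C₂') (hC₁ : 0 < C₁) (hC₂ : 0 < C₂)
    (hC₃ : 0 < C₃) (hp : 0 < p) (hp2 : p < 2) (hβ : 0 < β) :
    ∃ C : ℝ, 0 < C ∧ ∃ s : ℕ → NetSize d, ∀ Ψ : Set ((Fin d → ℝ) → ℝ), Ψ ⊆ AP d C₁' C₂' →
      ∀ σ F : ℝ, 0 < σ → max 1 σ ≤ F → ∀ n : ℕ, 2 ≤ n →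
        ∀ fhat : (Fin n → (Fin d → ℝ) × ℝ) → (Fin d → ℝ) → ℝ,
          IsERM (clippedNetworks (s n) F) fhat →
            ∀ f ∈ bddBy (classK Ψ p ns C₁ C₂ C₃ β) F, risk σ fhat f ≤
              ENNReal.ofReal (C * F ^ 2 * (n : ℝ) ^ (-(1 - p / 2)) * Real.log n ^ 3) := by
  obtain ⟨cT, hcT0, hcT⟩ := exists_complexity_bound d hns hC₁' hC₂' hC₁ hC₃ hp hβ
  have hq1 : (2 : ℝ) ^ (p - 2) < 1 :=
    Real.rpow_lt_one_of_one_lt_of_neg (by norm_num) (by linarith)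
  set K : ℝ := (2 * C₁) ^ p / (1 - 2 ^ (p - 2)) with hK
  have hK0 : 0 ≤ K := div_nonneg (by positivity) (by linarith)
  set Ca : ℝ := ns * (Real.sqrt C₃ * (Real.sqrt (C₂ + K * C₁ ^ (2 - p)) + 4 * C₁)) with hCa
  have hCa0 : 0 ≤ Ca := by positivity
  have hΛ : 0 < Real.log 2 := Real.log_pos (by norm_num)
  refine ⟨(82 + 8 * Ca ^ 2) / Real.log 2 ^ 3 + 32 * cT, by positivity,
    netSize hns C₁' C₂' C₁ C₃ p β hC₂' hC₁ hC₃, ?_⟩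
  rintro Ψ hΨ σ F hσ hF n hn fhat hfhat f ⟨hfK, hfF⟩
  have hn0 : (0 : ℝ) < n := by exact_mod_cast (by omega : 0 < n)
  have hn2 : (2 : ℝ) ≤ n := by exact_mod_cast hn
  have hF1 : 1 ≤ F := (le_max_left _ _).trans hF
  have hσF : σ ≤ F := (le_max_right _ _).trans hF
  -- Admissible in `AP` because n ≥ 2 gives ε ≤ 1/4 < 1/2; log(1/ε) = 2 log n accounts for the 2 in
  -- `waveletSize`.
  set ε : ℝ := 1 / (n : ℝ) ^ 2 with hε
  have hε0 : 0 < ε := by positivity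
  have hε2 : ε < 1 / 2 := by
    rw [hε]
    refine one_div_lt_one_div_of_lt (by norm_num) ?_
    nlinarith
  have hlogε : Real.log (1 / ε) = 2 * Real.log n := by
    rw [hε, one_div_one_div, Real.log_pow]; norm_num
  have hΨ' : ∀ ψ ∈ Ψ, AEStronglyMeasurable ψ (cubeMeasure d) ∧ ∃ s : NetSize d,
      (s.L ≤ waveletSize C₁' n ∧ s.S ≤ waveletSize C₁' n ∧ s.D ≤ waveletSize C₁' n ∧
        s.B ≤ waveletWeight C₂' n) ∧
      ∃ g ∈ networks s, eLpNorm (g - ψ) 2 (cubeMeasure d) ≤ ENNReal.ofReal ε := fun ψ hψ => by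
    obtain ⟨hL2, hap⟩ := hΨ hψ
    obtain ⟨s, ⟨h1, h2, h3, h4⟩, hg⟩ := hap ε hε0 hε2
    have e : C₁' * Real.log (1 / ε) = 2 * C₁' * Real.log n := by rw [hlogε]; ring
    rw [e] at h1 h2 h3
    refine ⟨hL2.aestronglyMeasurable, s, ⟨Nat.le_floor h1, Nat.le_floor h2,
      Nat.le_floor h3, ?_⟩, hg⟩
    refine h4.trans ?_
    rw [hε, div_div_eq_mul_div, div_one]
    unfold waveletWeight
    linarith
  -- With this threshold the bound on the number of kept coefficients is exactly n^{p/2},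
  -- independently of C₁.
  have hN : (C₁ / (C₁ * (n : ℝ) ^ (-(1 / 2) : ℝ))) ^ p < (termCount p n : ℝ) + 1 := by
    have h1 : C₁ / (C₁ * (n : ℝ) ^ (-(1 / 2) : ℝ)) = (n : ℝ) ^ (1 / 2 : ℝ) := by
      rw [Real.rpow_neg hn0.le]; field_simp
    rw [h1, ← Real.rpow_mul hn0.le, show (1 / 2 : ℝ) * p = p / 2 by ring]
    have := Nat.lt_floor_add_one ((n : ℝ) ^ (p / 2))
    unfold termCount
    push_cast
    linarith
  obtain ⟨b1, b2, b3, b4⟩ :=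
    le_weightBound (d := d) (C₁' := C₁') (C₃ := C₃) (β := β) hC₂' hC₁ hC₃ n
  obtain ⟨hfm, φ, hφ, hnet⟩ := exists_net_approx_classK hd hp hp2 hC₁ hC₂.le hC₃ hfK
    (truncLevel β n) (t := C₁ * (n : ℝ) ^ (-(1 / 2) : ℝ)) (by positivity) hN hε0
    (by linarith) hΨ' le_rfl le_rfl b3 (by linarith) b2 b4
  have hφmem : φ ∈ networks (netSize hns C₁' C₂' C₁ C₃ p β hC₂' hC₁ hC₃ n) :=
    hnet.mem_networks (s := netSize hns C₁' C₂' C₁ C₃ p β hC₂' hC₁ hC₃ n) le_rfl le_rfl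
  have hE := hφ.trans (approx_error_le (ns := ns) (β := β) hp hp2 hC₁ hC₂ hC₃ hβ hK0 hn)
  refine (risk_le_of_approx hd (by omega) hσ hσF (by positivity) hfm hfF hφmem hE hfhat).trans
    (ENNReal.ofReal_le_ofReal ?_)
  refine rate_bound hn2 hp hF1 hσF rfl ?_ (hcT n hn _ rfl)
  rw [mul_pow, Real.sq_sqrt (by positivity)]

theorem classJ_subset_classK {d : ℕ} (ψ : (Fin d → ℝ) → ℝ) (p C₁ C₂ β : ℝ) :
    classJ ψ p C₁ C₂ β ⊆ classK {ψ} p 1 C₁ C₂ 1 β := by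
  intro f hf
  refine ⟨fun _ => 1, fun _ => 0, fun _ => ψ, fun _ => f, fun _ => ⟨by simp, by simp, ?_, ?_⟩,
    fun _ => ⟨rfl, hf⟩, ?_⟩
  · intro i j
    change |(1 : Matrix (Fin d) (Fin d) ℝ) i j| ≤ 1
    rw [Matrix.one_apply]
    split_ifs <;> simp
  · intro i; simp
  · funext x; simp

end SparseWavelet

/-! ### The two parts of the theorem -/

open SparseWavelet in
theorem theorem7 (d : ℕ) (hd : 0 < d) (C₁' C₂' p C₁ C₂ β α : ℝ)
    (hC₁' : 0 < C₁') (hC₂' : 0 < C₂') (hp : 0 < p) (hp2 : p < 2)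
    (hC₁ : 0 < C₁) (hC₂ : 0 < C₂) (hβ : 0 < β) (hα : α = 1 / p - 1 / 2) :
    (∃ C : ℝ, 0 < C ∧
      ∀ ψ : (Fin d → ℝ) → ℝ, IsWavelet ψ → ψ ∈ AP d C₁' C₂' →
        ∃ s : ℕ → NetSize d,
          ∀ σ F : ℝ, 0 < σ → max 1 σ ≤ F → ∀ n : ℕ, 2 ≤ n →
            ∀ fhat : (Fin n → (Fin d → ℝ) × ℝ) → (Fin d → ℝ) → ℝ,
              IsERM (clippedNetworks (s n) F) fhat →
                (⨆ f ∈ bddBy (classJ ψ p C₁ C₂ β) F, risk σ fhat f) ≤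
                  ENNReal.ofReal (C * F ^ 2 * (n : ℝ) ^ (-(2 * α / (2 * α + 1)))
                    * Real.log n ^ 3)) ∧
    (∀ (ns : ℕ) (C₃ : ℝ), 0 < ns → 0 < C₃ → ∃ C' : ℝ, 0 < C' ∧
      ∀ Ψ : Set ((Fin d → ℝ) → ℝ), (∀ ψ ∈ Ψ, IsWavelet ψ) → Ψ ⊆ AP d C₁' C₂' →
        ∃ s : ℕ → NetSize d,
          ∀ σ F : ℝ, 0 < σ → max 1 σ ≤ F → ∀ n : ℕ, 2 ≤ n →
            ∀ fhat : (Fin n → (Fin d → ℝ) × ℝ) → (Fin d → ℝ) → ℝ,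
              IsERM (clippedNetworks (s n) F) fhat →
                (⨆ f ∈ bddBy (classK Ψ p ns C₁ C₂ C₃ β) F, risk σ fhat f) ≤
                  ENNReal.ofReal (C' * F ^ 2 * (n : ℝ) ^ (-(2 * α / (2 * α + 1)))
                    * Real.log n ^ 3)) := by
  -- Here 2α = 2/p - 1 and 2α + 1 = 2/p.
  have hrate : 2 * α / (2 * α + 1) = 1 - p / 2 := by
    rw [hα]; field_simp; ring
  rw [hrate]
  refine ⟨?_, fun ns C₃ hns hC₃ => ?_⟩
  -- One summand with the identity map and C₃ = 1. Constant and sizes are obtained before ψ is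
  -- introduced, so they do not depend on the wavelet.
  · obtain ⟨C, hC, s, hs⟩ := exists_risk_classK_le hd one_pos hC₁' hC₂' hC₁ hC₂ one_pos hp hp2 hβ
    refine ⟨C, hC, fun ψ _ hψ => ⟨s, fun σ F hσ hF n hn fhat hfhat => iSup₂_le fun f hf => ?_⟩⟩
    exact hs {ψ} (Set.singleton_subset_iff.2 hψ) σ F hσ hF n hn fhat hfhat f
      ⟨classJ_subset_classK ψ p C₁ C₂ β hf.1, hf.2⟩
  · obtain ⟨C, hC, s, hs⟩ := exists_risk_classK_le hd hns hC₁' hC₂' hC₁ hC₂ hC₃ hp hp2 hβ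
    exact ⟨C, hC, fun Ψ _ hΨ => ⟨s, fun σ F hσ hF n hn fhat hfhat =>
      iSup₂_le fun f hf => hs Ψ hΨ σ F hσ hF n hn fhat hfhat f hf⟩⟩
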